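/- Let $X$ be a compact connected Riemann surface with canonical bundle $K$, and let $n\ge 3$. For $r\ge 1$ a holomorphic $SO(r,\mathbb{C})$-bundle on $X$ is a rank $r$ holomorphic vector bundle with a holomorphic non-degenerate symmetric bilinear form $Q$ and a holomorphic trivialisation of its determinant line bundle compatible with $Q$ (it takes the values $\pm1$ on $Q$-orthonormal frames); isomorphisms are holomorphic bundle isomorphisms preserving both. An $SO_0(n,1)$-Higgs bundle is a triple $(V,Q_V,\phi)$ where $(V,Q_V)$ is a holomorphic $SO(n,\mathbb{C})$-bundle and $\phi\in H^0(K\otimes V)$ is viewed as a holomorphic bundle map $\phi:K^{-1}\to V$; its transpose is $\phi^t:V\to K$, $\phi^t(v)=Q_V(v,\phi(\cdot))$, and its Higgs field is $\Phi=\begin{pmatrix}0&\phi\\ \phi^t&0\end{pmatrix}$ on $E=V\oplus 1$. An isomorphism of such Higgs bundles is an isomorphism of $SO(n,\mathbb{C})$-bundles carrying $\phi$ to $\phi$. (1) An $SO_0(n,1)$-Higgs bundle satisfies $\operatorname{tr}(\Phi^2)=0$ if and only if $\phi^t\circ\phi=0$. (2) Suppose $\operatorname{tr}(\Phi^2)=0$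 and $\phi$ has no zeroes. Put $V_{n-1}=\ker\phi^t$, $W=V_{n-1}/\operatorname{im}\phi$, with the form $Q_W$ induced by $Q_V$ and the trivialisation of $\det W$ induced by $\det V\cong K^{-1}\otimes\det W\otimes K\cong\det W$ (normalised by a fixed factor $\sqrt{-1}$ so as to be compatible with $Q_W$), and let $\xi\in H^1(X,\operatorname{Hom}(W,K^{-1}))$ be the class of the extension $0\to K^{-1}\xrightarrow{\ \phi\ }V_{n-1}\to W\to 0$. Then $(W,Q_W)$ is a holomorphic $SO(n-2,\mathbb{C})$-bundle, and $(V,Q_V,\phi)\mapsto (W,Q_W,[\xi])$ induces a bijection from the set of isomorphism classes of $SO_0(n,1)$-Higgs bundles with $\operatorname{tr}(\Phi^2)=0$ and $\phi$ nowhere zero onto the set of isomorphism classes of triples $(W,Q_W,[\xi])$, where $(W,Q_W)$ is a holomorphic $SO(n-2,\mathbb{C})$-bundle and $[\xi]$ is the orbit of a class $\xi\in H^1(X,\operatorname{Hom}(W,K^{-1}))$ under the group $SO(Q_W)$ of automorphisms of $(W,Q_W)$, acting by pre-composition. Two triples $(W,Q_W,[\xi])$ and $(W',Q_{W'},[\xi'])$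 are isomorphic when some isomorphism of $SO(n-2,\mathbb{C})$-bundles $W\cong W'$ matches $[\xi]$ with $[\xi']$. (3) Let $(W,Q_W,[\xi])$ be such a triple. Give the smooth complex vector bundle $K^{-1}\oplus W\oplus K$ the orthogonal structure $Q$ consisting of $Q_W$ and the canonical pairing $K^{-1}\times K\to 1$. Then there is a holomorphic structure on $K^{-1}\oplus W\oplus K$ for which (i) $K^{-1}\oplus W$ is a holomorphic subbundle and, with the inclusion of $K^{-1}$ and the projection onto $W$, is a holomorphic extension $0\to K^{-1}\to K^{-1}\oplus W\to W\to 0$ with extension class in $[\xi]$, and (ii) $Q$ is holomorphic. It is unique up to gauge equivalence: for any two such holomorphic structures there is a smooth automorphism of $K^{-1}\oplus W\oplus K$ that preserves $Q$, fixes $K^{-1}$ pointwise, acts on $W=(K^{-1}\oplus W)/K^{-1}$ by an element of $SO(Q_W)$, and carries the one to the other. Moreover a Higgs bundle $(V,Q_V,\phi)$ has data $(W,Q_W,[\xi])$ as in (2), up to isomorphism, if and only if it is isomorphic to $K^{-1}\oplus W\oplus K$ with such a holomorphic structure, the orthogonal structure $Q$, the determinant induced from $W$, and $\phi$ the inclusion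 of $K^{-1}$. -/

import Mathlib

open Bundle Manifold Set
open scoped ContDiff

namespace HiggsSO

universe u

variable {X : Type u} [TopologicalSpace X] [ChartedSpace ℂ X]

/-! ### Holomorphic vector bundles over a Riemann surface -/

/-- A holomorphic vector bundle with model fibre `F` over the Riemann surface `X`, bundled. The
last two fields hold automatically, since each fibre is linearly homeomorphic to `F`. -/
structure HolBundle (X : Type u) [TopologicalSpace X] [ChartedSpace ℂ X]
    (F : Type) [NormedAddCommGroup F] [NormedSpace ℂ F] where
  E : X → Type
  [acg : ∀ x, AddCommGroup (E x)]
  [mod : ∀ x, Module ℂ (E x)]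
  [top : ∀ x, TopologicalSpace (E x)]
  [topTotal : TopologicalSpace (TotalSpace F E)]
  [fiber : FiberBundle F E]
  [vector : VectorBundle ℂ F E]
  [holo : ContMDiffVectorBundle ω F E 𝓘(ℂ)]
  [topGroup : ∀ x, IsTopologicalAddGroup (E x)]
  [contSMul : ∀ x, ContinuousSMul ℂ (E x)]

attribute [instance] HolBundle.acg HolBundle.mod HolBundle.top HolBundle.topTotal
  HolBundle.fiber HolBundle.vector HolBundle.holo HolBundle.topGroup HolBundle.contSMul

variable {F F' F'' : Type} [NormedAddCommGroup F] [NormedSpace ℂ F]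
  [NormedAddCommGroup F'] [NormedSpace ℂ F'] [NormedAddCommGroup F''] [NormedSpace ℂ F'']

/-- The holomorphic tangent bundle, which is the inverse `K⁻¹` of the canonical bundle. -/
noncomputable abbrev tangent (X : Type u) [TopologicalSpace X] [ChartedSpace ℂ X]
    [IsManifold 𝓘(ℂ) ω X] : HolBundle X ℂ where
  E := fun x => TangentSpace 𝓘(ℂ) x

/-- The bundle `Hom(A, B)`. -/
noncomputable abbrev HolBundle.hom (A : HolBundle X F) (B : HolBundle X F') :
    HolBundle X (F →L[ℂ] F') where
  E := fun x => A.E x →L[ℂ] B.E x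

/-- The trivial line bundle. -/
noncomputable abbrev trivialLine (X : Type u) [TopologicalSpace X] [ChartedSpace ℂ X] :
    HolBundle X ℂ where
  E := Bundle.Trivial X ℂ
  topGroup := fun _ => inferInstanceAs (IsTopologicalAddGroup ℂ)
  contSMul := fun _ => inferInstanceAs (ContinuousSMul ℂ ℂ)

/-- The canonical bundle `K = Hom(K⁻¹, 1)`. -/
noncomputable abbrev canonical (X : Type u) [TopologicalSpace X] [ChartedSpace ℂ X]
    [IsManifold 𝓘(ℂ) ω X] : HolBundle X (ℂ →L[ℂ] ℂ) :=
  (tangent X).hom (trivialLine X)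

/-- The direct sum `A ⊕ B`. -/
noncomputable abbrev HolBundle.sum (A : HolBundle X F) (B : HolBundle X F') :
    HolBundle X (F × F') where
  E := A.E ×ᵇ B.E

/-- The section `s` of `A` is holomorphic on the set `U` (used for open sets `U`). -/
def IsHolSection (A : HolBundle X F) (U : Set X) (s : ∀ x, A.E x) : Prop :=
  ContMDiffOn 𝓘(ℂ) (𝓘(ℂ).prod 𝓘(ℂ, F)) ω (fun x => TotalSpace.mk' F x (s x)) U

/-- The section `s` of the smooth complex bundle underlying `A` is smooth (in the real sense). -/
def IsSmoothSection (A : HolBundle X F) (s : ∀ x, A.E x) : Prop :=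
  ContMDiff 𝓘(ℝ, ℂ) (𝓘(ℝ, ℂ).prod 𝓘(ℝ, F)) ∞ (fun x => TotalSpace.mk' F x (s x))

/-- Holomorphic bundle maps. -/
structure HolHom (A : HolBundle X F) (B : HolBundle X F') where
  toFun : ∀ x, A.E x →L[ℂ] B.E x
  hol : IsHolSection (A.hom B) univ toFun

theorem isHolSection_comp {A : HolBundle X F} {B : HolBundle X F'} {C : HolBundle X F''}
    {U : Set X} {g : ∀ x, A.E x →L[ℂ] B.E x} {f : ∀ x, B.E x →L[ℂ] C.E x}
    (hf : IsHolSection (B.hom C) U f) (hg : IsHolSection (A.hom B) U g) :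
    IsHolSection (A.hom C) U (fun x => (f x).comp (g x)) := by
  intro x hx
  have h1 := (contMDiffWithinAt_hom_bundle _).1 (hf x hx)
  have h2 := (contMDiffWithinAt_hom_bundle _).1 (hg x hx)
  refine (contMDiffWithinAt_hom_bundle _).2 ⟨contMDiffWithinAt_id, ?_⟩
  refine (h1.2.clm_comp h2.2).congr_of_eventuallyEq ?_ ?_
  · have hb : (trivializationAt F' B.E x).baseSet ∈ nhdsWithin x U :=
      mem_nhdsWithin_of_mem_nhds ((trivializationAt F' B.E x).open_baseSet.mem_nhds
        (mem_baseSet_trivializationAt F' B.E x))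
    filter_upwards [hb] with y hy
    ext v
    simp [ContinuousLinearMap.inCoordinates, hy]
  · have hy := mem_baseSet_trivializationAt F' B.E x
    ext v
    simp [ContinuousLinearMap.inCoordinates, hy]

/-! ### First cohomology with coefficients in the sheaf of holomorphic sections -/

/-- A Čech 1-cocycle of holomorphic sections of `A`, for an open cover `(U x)` of `X` indexed by
the points of `X` with `x ∈ U x`. Every open cover is refined by covers of this kind, and they
form a directed system with canonical refinement maps. -/
structure Cocycle (A : HolBundle X F) where
  U : X → Set X
  isOpen : ∀ x, IsOpen (U x)
  mem : ∀ x, x ∈ U x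
  c : X → X → ∀ z, A.E z
  hol : ∀ x y, IsHolSection A (U x ∩ U y) (c x y)
  cocycle : ∀ x y w z, z ∈ U x → z ∈ U y → z ∈ U w → c x y z + c y w z = c x w z

/-- Two cocycles are equivalent if their difference is a coboundary on a common refinement. -/
def Cocycle.Rel {A : HolBundle X F} (a b : Cocycle A) : Prop :=
  ∃ (N : X → Set X) (s : X → ∀ z, A.E z),
    (∀ x, IsOpen (N x) ∧ x ∈ N x ∧ N x ⊆ a.U x ∧ N x ⊆ b.U x ∧ IsHolSection A (N x) (s x)) ∧
    ∀ x y z, z ∈ N x → z ∈ N y → b.c x y z - a.c x y z = s y z - s x z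

theorem isHolSection_neg {A : HolBundle X F} {U : Set X} {s : ∀ x, A.E x}
    (hs : IsHolSection A U s) : IsHolSection A U (fun x => - s x) :=
  ContMDiffOn.neg_section hs

theorem isHolSection_add {A : HolBundle X F} {U : Set X} {s t : ∀ x, A.E x}
    (hs : IsHolSection A U s) (ht : IsHolSection A U t) : IsHolSection A U (fun x => s x + t x) :=
  ContMDiffOn.add_section hs ht

instance cocycleSetoid (A : HolBundle X F) : Setoid (Cocycle A) where
  r := Cocycle.Rel
  iseqv := by
    refine ⟨fun a => ?_, ?_, ?_⟩
    · refine ⟨a.U, fun _ _ => 0, fun x => ⟨a.isOpen x, a.mem x, subset_rfl, subset_rfl, ?_⟩,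
        by simp⟩
      exact (contMDiff_zeroSection ℂ A.E).contMDiffOn
    · rintro a b ⟨N, s, h, hs⟩
      refine ⟨N, fun x z => - s x z, fun x => ?_, fun x y z hx hy => ?_⟩
      · obtain ⟨h1, h2, h3, h4, h5⟩ := h x
        exact ⟨h1, h2, h4, h3, isHolSection_neg h5⟩
      · rw [← neg_sub (b.c x y z), hs x y z hx hy, neg_sub_neg, neg_sub]
    · rintro a b d ⟨N, s, h, hs⟩ ⟨M, t, k, ht⟩
      refine ⟨fun x => N x ∩ M x, fun x z => s x z + t x z, fun x => ?_, fun x y z hx hy => ?_⟩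
      · obtain ⟨h1, h2, h3, h4, h5⟩ := h x
        obtain ⟨k1, k2, k3, k4, k5⟩ := k x
        exact ⟨h1.inter k1, ⟨h2, k2⟩, inter_subset_left.trans h3, inter_subset_right.trans k4,
          isHolSection_add (h5.mono inter_subset_left) (k5.mono inter_subset_right)⟩
      · have e1 := hs x y z hx.1 hy.1
        have e2 := ht x y z hx.2 hy.2
        calc d.c x y z - a.c x y z = (b.c x y z - a.c x y z) + (d.c x y z - b.c x y z) := by abel
          _ = _ := by rw [e1, e2]; exact (add_sub_add_comm _ _ _ _).symm

/-- `H¹(X, A)`: the Čech cohomology of the sheaf of holomorphic sections of `A`, i.e. the direct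
limit over all open covers. -/
def H1 (A : HolBundle X F) : Type u := Quotient (cocycleSetoid A)

/-- The class of a cocycle. -/
def H1.mk {A : HolBundle X F} (a : Cocycle A) : H1 A := Quotient.mk _ a

/-- Pre-composition of a `Hom(B, C)`-valued cocycle with a bundle map `A → B`. -/
noncomputable def Cocycle.precomp {A : HolBundle X F} {B : HolBundle X F'} {C : HolBundle X F''}
    (g : HolHom A B) (a : Cocycle (B.hom C)) : Cocycle (A.hom C) where
  U := a.U
  isOpen := a.isOpen
  mem := a.mem
  c := fun x y z => ContinuousLinearMap.comp (a.c x y z) (g.toFun z)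
  hol := fun x y => isHolSection_comp (a.hol x y) (g.hol.mono (subset_univ _))
  cocycle := fun x y w z hx hy hw => by
    rw [← a.cocycle x y w z hx hy hw]
    exact (ContinuousLinearMap.add_comp _ _ _).symm

/-- The map `H¹(Hom(B, C)) → H¹(Hom(A, C))` given by pre-composition with `g : A → B`. -/
noncomputable def H1.precomp {A : HolBundle X F} {B : HolBundle X F'} {C : HolBundle X F''}
    (g : HolHom A B) : H1 (B.hom C) → H1 (A.hom C) :=
  Quotient.map (Cocycle.precomp g) (by
    rintro a b ⟨N, s, h, hs⟩
    refine ⟨N, fun x z => ContinuousLinearMap.comp (s x z) (g.toFun z), fun x => ?_,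
      fun x y z hx hy => ?_⟩
    · obtain ⟨h1, h2, h3, h4, h5⟩ := h x
      exact ⟨h1, h2, h3, h4, isHolSection_comp h5 (g.hol.mono (subset_univ _))⟩
    · ext v
      exact DFunLike.congr_fun (hs x y z hx hy) (g.toFun z v))

/-- `0 → A → B → C → 0` is an exact sequence of holomorphic vector bundles. -/
structure IsShortExact {A : HolBundle X F} {B : HolBundle X F'} {C : HolBundle X F''}
    (j : HolHom A B) (p : HolHom B C) : Prop where
  injective : ∀ x, Function.Injective (j.toFun x)
  exact : ∀ x (v : B.E x), p.toFun x v = 0 ↔ ∃ a, j.toFun x a = v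
  surjective : ∀ x, Function.Surjective (p.toFun x)

/-- `ξ ∈ H¹(Hom(C, A))` is the extension class of `0 → A → B → C → 0`, i.e. the image of the
identity of `C` under the connecting map: `ξ` is represented by the differences `s y - s x` of
local holomorphic splittings `s x : C → B`. -/
def IsExtensionClass {A : HolBundle X F} {B : HolBundle X F'} {C : HolBundle X F''}
    (j : HolHom A B) (p : HolHom B C) (ξ : H1 (C.hom A)) : Prop :=
  ∃ (a : Cocycle (C.hom A)) (s : X → ∀ z, C.E z →L[ℂ] B.E z),
    (∀ x, IsHolSection (C.hom B) (a.U x) (s x)) ∧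
    (∀ x, ∀ z ∈ a.U x, ∀ w, p.toFun z (s x z w) = w) ∧
    (∀ x y z, z ∈ a.U x → z ∈ a.U y → ∀ w : C.E z,
      j.toFun z (a.c x y z w) = s y z w - s x z w) ∧
    ξ = H1.mk a

/-! ### Orthogonal bundles and Higgs bundles -/

/-- A holomorphic `SO(r, ℂ)`-bundle: a holomorphic vector bundle of rank `r` with a holomorphic
non-degenerate symmetric bilinear form `Q` and a holomorphic trivialisation `vol` of the
determinant line bundle, normalised by `vol² = det Q` (so `vol = ± 1` on orthonormal frames). -/
structure SOBundle (X : Type u) [TopologicalSpace X] [ChartedSpace ℂ X] (r : ℕ) extends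
    HolBundle X (Fin r → ℂ) where
  Q : ∀ x, E x →L[ℂ] E x →L[ℂ] ℂ
  Q_hol : IsHolSection (toHolBundle.hom (toHolBundle.hom (trivialLine X))) univ Q
  Q_symm : ∀ x v w, Q x v w = Q x w v
  Q_nondeg : ∀ x v, (∀ w, Q x v w = 0) → v = 0
  vol : ∀ x, E x [⋀^Fin r]→ₗ[ℂ] ℂ
  vol_hol : ∀ (U : Set X), IsOpen U → ∀ e : Fin r → ∀ x, E x,
    (∀ k, IsHolSection toHolBundle U (e k)) →
      IsHolSection (trivialLine X) U (fun x => vol x (fun k => e k x))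
  vol_sq : ∀ x (e : Fin r → E x), vol x e ^ 2 = Matrix.det (Matrix.of fun k l => Q x (e k) (e l))

/-- Isomorphisms of holomorphic `SO(r, ℂ)`-bundles. -/
structure SOIso {r : ℕ} (A B : SOBundle X r) where
  toEquiv : ∀ x, A.E x ≃L[ℂ] B.E x
  hol : IsHolSection (A.toHolBundle.hom B.toHolBundle) univ
    (fun x => (toEquiv x : A.E x →L[ℂ] B.E x))
  hol_symm : IsHolSection (B.toHolBundle.hom A.toHolBundle) univ
    (fun x => ((toEquiv x).symm : B.E x →L[ℂ] A.E x))
  Q_eq : ∀ x v w, B.Q x (toEquiv x v) (toEquiv x w) = A.Q x v w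
  vol_eq : ∀ x (e : Fin r → A.E x), B.vol x (fun k => toEquiv x (e k)) = A.vol x e

/-- The underlying holomorphic bundle map. -/
def SOIso.toHom {r : ℕ} {A B : SOBundle X r} (g : SOIso A B) :
    HolHom A.toHolBundle B.toHolBundle where
  toFun := fun x => g.toEquiv x
  hol := g.hol

theorem isHolSection_id (A : HolBundle X F) (U : Set X) :
    IsHolSection (A.hom A) U (fun x => ContinuousLinearMap.id ℂ (A.E x)) := by
  intro x hx
  refine (contMDiffWithinAt_hom_bundle _).2 ⟨contMDiffWithinAt_id, ?_⟩
  refine (contMDiffWithinAt_const (c := ContinuousLinearMap.id ℂ F)).congr_of_eventuallyEq ?_ ?_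
  · have hb : (trivializationAt F A.E x).baseSet ∈ nhdsWithin x U :=
      mem_nhdsWithin_of_mem_nhds ((trivializationAt F A.E x).open_baseSet.mem_nhds
        (mem_baseSet_trivializationAt F A.E x))
    filter_upwards [hb] with y hy
    ext v
    simp [ContinuousLinearMap.inCoordinates, hy]
  · have hy := mem_baseSet_trivializationAt F A.E x
    ext v
    simp [ContinuousLinearMap.inCoordinates, hy]

namespace SOIso

variable {r : ℕ}

def refl (A : SOBundle X r) : SOIso A A where
  toEquiv := fun _ => ContinuousLinearEquiv.refl ℂ _
  hol := isHolSection_id _ _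
  hol_symm := isHolSection_id _ _
  Q_eq := fun _ _ _ => rfl
  vol_eq := fun _ _ => rfl

def symm {A B : SOBundle X r} (g : SOIso A B) : SOIso B A where
  toEquiv := fun x => (g.toEquiv x).symm
  hol := g.hol_symm
  hol_symm := g.hol
  Q_eq := fun x v w => by simp [← g.Q_eq]
  vol_eq := fun x e => by simp [← g.vol_eq]

def trans {A B C : SOBundle X r} (g : SOIso A B) (h : SOIso B C) : SOIso A C where
  toEquiv := fun x => (g.toEquiv x).trans (h.toEquiv x)
  hol := isHolSection_comp h.hol g.hol
  hol_symm := isHolSection_comp g.hol_symm h.hol_symm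
  Q_eq := fun x v w => (h.Q_eq x _ _).trans (g.Q_eq x v w)
  vol_eq := fun x e => (h.vol_eq x _).trans (g.vol_eq x e)

theorem symm_trans_self {A B : SOBundle X r} (g : SOIso A B) : g.symm.trans g = refl B := by
  simp [trans, symm, refl]

end SOIso

variable [IsManifold 𝓘(ℂ) ω X]

/-- An `SO₀(n, 1)`-Higgs bundle `(V, Q_V, φ)`: an `SO(n, ℂ)`-bundle with a holomorphic section `φ`
of `K ⊗ V = Hom(K⁻¹, V)`. -/
structure HiggsBundle (X : Type u) [TopologicalSpace X] [ChartedSpace ℂ X]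
    [IsManifold 𝓘(ℂ) ω X] (n : ℕ) extends SOBundle X n where
  φ : HolHom (tangent X) toHolBundle

namespace HiggsBundle

variable {n : ℕ}

/-- `φᵗ : V → K`, the map `v ↦ Q_V(v, φ(·))`. -/
noncomputable def φt (H : HiggsBundle X n) (x : X) : H.E x →ₗ[ℂ] (canonical X).E x where
  toFun := fun v => (H.Q x v).comp (H.φ.toFun x)
  map_add' := fun v w => by ext; simp
  map_smul' := fun c v => by ext; simp

/-- The Higgs field `Φ = (0 φ; φᵗ 0)` on `V ⊕ 1`, contracted with the tangent vector `Z`: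
`Φ_Z (v, c) = (c φ(Z), φᵗ(v)(Z))`. It is skew for `Q_E((v, c), (w, d)) = Q_V(v, w) - c d`. -/
noncomputable def Φ (H : HiggsBundle X n) (x : X) (Z : (tangent X).E x) :
    (H.E x × ℂ) →ₗ[ℂ] (H.E x × ℂ) where
  toFun := fun u => (u.2 • H.φ.toFun x Z, (show (tangent X).E x →L[ℂ] ℂ from H.φt x u.1) Z)
  map_add' := fun u w => by
    simp only [Prod.fst_add, Prod.snd_add, add_smul, map_add]; rfl
  map_smul' := fun c u => by
    simp only [Prod.smul_fst, Prod.smul_snd, smul_assoc, map_smul]; rfl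

/-- `tr(Φ²) = 0` as a section of `K²`; as `K` is a line bundle, it suffices to evaluate this
quadratic differential on pairs `(Z, Z)`. -/
def TraceSqZero (H : HiggsBundle X n) : Prop :=
  ∀ x (Z : (tangent X).E x), LinearMap.trace ℂ (H.E x × ℂ) (H.Φ x Z ∘ₗ H.Φ x Z) = 0

/-- `φ` has no zeroes. -/
def NowhereZero (H : HiggsBundle X n) : Prop := ∀ x, H.φ.toFun x ≠ 0

/-- Isomorphism of Higgs bundles: an isomorphism of the `SO(n, ℂ)`-bundles matching the fields
`φ`. -/
def Iso (H H' : HiggsBundle X n) : Prop :=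
  ∃ g : SOIso H.toSOBundle H'.toSOBundle, ∀ x Z, g.toEquiv x (H.φ.toFun x Z) = H'.φ.toFun x Z

end HiggsBundle

/-- Higgs bundles with `tr(Φ²) = 0` and `φ` nowhere zero. -/
def NullHiggs (X : Type u) [TopologicalSpace X] [ChartedSpace ℂ X] [IsManifold 𝓘(ℂ) ω X]
    (n : ℕ) := {H : HiggsBundle X n // H.TraceSqZero ∧ H.NowhereZero}

instance nullHiggsSetoid (n : ℕ) : Setoid (NullHiggs X n) where
  r := fun H H' => H.1.Iso H'.1
  iseqv := by
    refine ⟨fun H => ⟨SOIso.refl _, fun _ _ => rfl⟩, ?_, ?_⟩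
    · rintro H H' ⟨g, hg⟩
      refine ⟨g.symm, fun x Z => ?_⟩
      rw [← hg x Z]
      exact (g.toEquiv x).symm_apply_apply _
    · rintro H H' H'' ⟨g, hg⟩ ⟨h, hh⟩
      refine ⟨g.trans h, fun x Z => ?_⟩
      rw [← hh x Z, ← hg x Z]
      rfl

/-- Isomorphism classes of Higgs bundles with `tr(Φ²) = 0` and `φ` nowhere zero. -/
def NullHiggsClass (X : Type u) [TopologicalSpace X] [ChartedSpace ℂ X] [IsManifold 𝓘(ℂ) ω X]
    (n : ℕ) := Quotient (nullHiggsSetoid (X := X) n)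

/-! ### Triples `(W, Q_W, [ξ])` -/

variable {m : ℕ}

/-- `H¹(Hom(W, K⁻¹))`. -/
abbrev ExtH1 (W : SOBundle X m) : Type u := H1 (W.toHolBundle.hom (tangent X))

/-- The map `H¹(Hom(W', K⁻¹)) → H¹(Hom(W, K⁻¹))` defined by an isomorphism `W ≅ W'`. -/
noncomputable def pull {W W' : SOBundle X m} (g : SOIso W W') : ExtH1 W' → ExtH1 W :=
  H1.precomp g.toHom

theorem pull_refl {W : SOBundle X m} (ξ : ExtH1 W) : pull (SOIso.refl W) ξ = ξ := by
  induction ξ using Quotient.inductionOn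
  rfl

theorem pull_trans {W W' W'' : SOBundle X m} (g : SOIso W W') (h : SOIso W' W'') (ξ : ExtH1 W'') :
    pull (g.trans h) ξ = pull g (pull h ξ) := by
  induction ξ using Quotient.inductionOn
  rfl

theorem pull_symm_pull {W W' : SOBundle X m} (g : SOIso W W') (ξ : ExtH1 W') :
    pull g.symm (pull g ξ) = ξ := by
  rw [← pull_trans, SOIso.symm_trans_self, pull_refl]

/-- The orbit relation of the group `SO(Q_W)` of automorphisms of `(W, Q_W)`, acting on
`H¹(Hom(W, K⁻¹))` by pre-composition. -/
instance orbitSetoid (W : SOBundle X m) : Setoid (ExtH1 W) where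
  r := fun ξ ξ' => ∃ g : SOIso W W, ξ = pull g ξ'
  iseqv := by
    refine ⟨fun ξ => ⟨SOIso.refl W, (pull_refl ξ).symm⟩, ?_, ?_⟩
    · rintro ξ ξ' ⟨g, rfl⟩
      exact ⟨g.symm, (pull_symm_pull g _).symm⟩
    · rintro ξ ξ' ξ'' ⟨g, rfl⟩ ⟨h, rfl⟩
      exact ⟨g.trans h, (pull_trans g h _).symm⟩

/-- `H¹(Hom(W, K⁻¹)) / SO(Q_W)`. -/
def ExtOrbit (W : SOBundle X m) : Type u := Quotient (orbitSetoid W)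

/-- The orbit `[ξ]`. -/
def ExtOrbit.mk {W : SOBundle X m} (ξ : ExtH1 W) : ExtOrbit W := Quotient.mk _ ξ

/-- Triples `(W, Q_W, [ξ])`. -/
structure Triple (X : Type u) [TopologicalSpace X] [ChartedSpace ℂ X] [IsManifold 𝓘(ℂ) ω X]
    (m : ℕ) where
  W : SOBundle X m
  cls : ExtOrbit W

/-- Triples are isomorphic if some isomorphism of the `SO(m, ℂ)`-bundles matches the orbits. -/
instance tripleSetoid (m : ℕ) : Setoid (Triple X m) where
  r := fun t t' => ∃ (g : SOIso t.W t'.W) (ξ : ExtH1 t'.W),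
    t'.cls = ExtOrbit.mk ξ ∧ t.cls = ExtOrbit.mk (pull g ξ)
  iseqv := by
    refine ⟨fun t => ?_, ?_, ?_⟩
    · obtain ⟨ξ, hξ⟩ := Quotient.exists_rep t.cls
      exact ⟨SOIso.refl _, ξ, hξ.symm, by rw [pull_refl]; exact hξ.symm⟩
    · rintro t t' ⟨g, ξ, h1, h2⟩
      exact ⟨g.symm, pull g ξ, h2, by rw [pull_symm_pull]; exact h1⟩
    · rintro t t' t'' ⟨g, ξ, h1, h2⟩ ⟨h, ζ, h3, h4⟩
      obtain ⟨k, hk⟩ := Quotient.exact (h1.symm.trans h4)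
      refine ⟨(g.trans k).trans h, ζ, h3, ?_⟩
      rw [pull_trans, pull_trans, ← hk, h2]

/-- Isomorphism classes of triples `(W, Q_W, [ξ])`. -/
def TripleClass (X : Type u) [TopologicalSpace X] [ChartedSpace ℂ X] [IsManifold 𝓘(ℂ) ω X]
    (m : ℕ) := Quotient (tripleSetoid (X := X) m)

/-- A holomorphic bundle `V₁` of rank `m + 1` which is identified by `i` with the subbundle of `V`
with fibres `N x`, contains the image of `φ : K⁻¹ → V`, and sits in an exact sequence
`0 → K⁻¹ → V₁ → W → 0` whose first map is `φ`. -/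
structure Extension (W : SOBundle X m) {V : HolBundle X F} (φ : HolHom (tangent X) V)
    (N : ∀ x, Submodule ℂ (V.E x)) where
  V₁ : HolBundle X (Fin (m + 1) → ℂ)
  i : HolHom V₁ V
  i_injective : ∀ x, Function.Injective (i.toFun x)
  i_range : ∀ x, LinearMap.range (i.toFun x : V₁.E x →ₗ[ℂ] V.E x) = N x
  j : HolHom (tangent X) V₁
  p : HolHom V₁ W.toHolBundle
  i_j : ∀ x Z, i.toFun x (j.toFun x Z) = φ.toFun x Z
  exact : IsShortExact j p

/-- `(V, Q_V, φ)` determines `(W, Q_W)` and the extension class `ξ`: `V_{n-1} = ker φᵗ` is an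
extension of `W` by `K⁻¹` with inclusion `φ` and extension class `ξ` (so `W ≅ ker φᵗ / im φ`), the
form `Q_W` is induced by `Q_V`, and the determinants correspond under
`det V ≅ K⁻¹ ⊗ det W ⊗ K ≅ det W`. The factor `i = √-1` accounts for the determinant `-1` of the
hyperbolic plane `K⁻¹ ⊕ K`. -/
def Determines (H : HiggsBundle X (m + 2)) (W : SOBundle X m) (ξ : ExtH1 W) : Prop :=
  ∃ D : Extension W H.φ (fun x => LinearMap.ker (H.φt x)),
    (∀ x u v, W.Q x (D.p.toFun x u) (D.p.toFun x v) = H.Q x (D.i.toFun x u) (D.i.toFun x v)) ∧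
    (∀ x (Z : (tangent X).E x) (u : Fin m → D.V₁.E x) (v : H.E x),
      H.vol x (Fin.cons (H.φ.toFun x Z) (Fin.snoc (fun k => D.i.toFun x (u k)) v)) =
        Complex.I * H.Q x (H.φ.toFun x Z) v * W.vol x (fun k => D.p.toFun x (u k))) ∧
    IsExtensionClass D.j D.p ξ

/-! ### Holomorphic structures on the smooth bundle `K⁻¹ ⊕ W ⊕ K` -/

/-- The bundle `K⁻¹ ⊕ W ⊕ K`; only its underlying smooth complex bundle is used. -/
noncomputable abbrev model (W : SOBundle X m) : HolBundle X (ℂ × (Fin m → ℂ) × (ℂ →L[ℂ] ℂ)) :=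
  (tangent X).sum (W.toHolBundle.sum (canonical X))

/-- The element `(Z, w, η)` of the fibre of `K⁻¹ ⊕ W ⊕ K`. -/
noncomputable def model.mk (W : SOBundle X m) {x : X} (Z : (tangent X).E x) (w : W.E x)
    (η : (canonical X).E x) : (model W).E x := (Z, w, η)

/-- The orthogonal structure given by `Q_W` and the canonical pairing of `K⁻¹` with `K`. -/
noncomputable def modelQ (W : SOBundle X m) (x : X) (a b : (model W).E x) : ℂ :=
  (show (tangent X).E x →L[ℂ] ℂ from b.2.2) a.1 + W.Q x a.2.1 b.2.1 +
    (show (tangent X).E x →L[ℂ] ℂ from a.2.2) b.1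

/-- The subspace `K⁻¹ ⊕ W` of the fibre of `K⁻¹ ⊕ W ⊕ K`. -/
noncomputable def modelFlag (W : SOBundle X m) (x : X) : Submodule ℂ ((model W).E x) :=
  LinearMap.ker (LinearMap.snd ℂ (W.E x) ((canonical X).E x) ∘ₗ
    LinearMap.snd ℂ ((tangent X).E x) (W.E x × (canonical X).E x))

/-- A holomorphic structure on the smooth bundle `K⁻¹ ⊕ W ⊕ K`: a holomorphic bundle `V` with a
smooth isomorphism `Θ` of the underlying smooth complex bundles. -/
structure HolStructure (W : SOBundle X m) where
  V : HolBundle X (Fin (m + 2) → ℂ)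
  Θ : ∀ x, (model W).E x ≃L[ℂ] V.E x
  smooth : IsSmoothSection ((model W).hom V) (fun x => (Θ x : (model W).E x →L[ℂ] V.E x))
  smooth_symm : IsSmoothSection (V.hom (model W))
    (fun x => ((Θ x).symm : V.E x →L[ℂ] (model W).E x))

/-- The conditions on a holomorphic structure on `K⁻¹ ⊕ W ⊕ K`: the flag
`K⁻¹ ⊂ K⁻¹ ⊕ W` is holomorphic, and with the given inclusion of `K⁻¹` and the projection to `W`
the bundle `V_{n-1} = K⁻¹ ⊕ W` becomes a holomorphic extension of `W` by `K⁻¹` with class in the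
orbit `o`; and the orthogonal structure of `K⁻¹ ⊕ W ⊕ K` is holomorphic. -/
def HolStructure.IsAdmissible {W : SOBundle X m} (S : HolStructure W) (o : ExtOrbit W) : Prop :=
  (∃ (φ : HolHom (tangent X) S.V)
    (D : Extension W φ (fun x => Submodule.map
      ((S.Θ x).toLinearEquiv : (model W).E x →ₗ[ℂ] S.V.E x) (modelFlag W x))) (ξ : ExtH1 W),
    (∀ x Z, φ.toFun x Z = S.Θ x (model.mk W Z 0 0)) ∧
    (∀ x u, D.p.toFun x u = ((S.Θ x).symm (D.i.toFun x u)).2.1) ∧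
    IsExtensionClass D.j D.p ξ ∧ ExtOrbit.mk ξ = o) ∧
  ∃ Q : ∀ x, S.V.E x →L[ℂ] S.V.E x →L[ℂ] ℂ,
    IsHolSection (S.V.hom (S.V.hom (trivialLine X))) univ Q ∧
    ∀ x a b, Q x (S.Θ x a) (S.Θ x b) = modelQ W x a b

/-- `H` is the Higgs bundle defined by the holomorphic structure `S` on `K⁻¹ ⊕ W ⊕ K`: up to a
holomorphic isomorphism `g`, its bundle is `S.V`, its orthogonal structure and its determinant are
the ones of `K⁻¹ ⊕ W ⊕ K`, and its field `φ` is the inclusion of `K⁻¹`. -/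
def HolStructure.Carries {W : SOBundle X m} (S : HolStructure W) (H : HiggsBundle X (m + 2)) :
    Prop :=
  ∃ g : ∀ x, S.V.E x ≃L[ℂ] H.E x,
    IsHolSection (S.V.hom H.toHolBundle) univ (fun x => (g x : S.V.E x →L[ℂ] H.E x)) ∧
    IsHolSection (H.toHolBundle.hom S.V) univ (fun x => ((g x).symm : H.E x →L[ℂ] S.V.E x)) ∧
    (∀ x a b, H.Q x (g x (S.Θ x a)) (g x (S.Θ x b)) = modelQ W x a b) ∧
    (∀ x Z, H.φ.toFun x Z = g x (S.Θ x (model.mk W Z 0 0))) ∧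
    ∀ x (Z : (tangent X).E x) (w : Fin m → W.E x) (η : (tangent X).E x →L[ℂ] ℂ),
      H.vol x (Fin.cons (g x (S.Θ x (model.mk W Z 0 0)))
        (Fin.snoc (fun k => g x (S.Θ x (model.mk W 0 (w k) 0)))
          (g x (S.Θ x (model.mk W 0 0 η))))) = Complex.I * η Z * W.vol x w

/-- Two holomorphic structures on `K⁻¹ ⊕ W ⊕ K` are gauge equivalent: some smooth automorphism `T`
of `K⁻¹ ⊕ W ⊕ K` preserves the orthogonal structure and the Higgs field (the inclusion of `K⁻¹`),
acts on `W` by an element `k` of `SO(Q_W)`, and carries the first holomorphic structure to the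
second one. -/
def HolStructure.GaugeEquiv {W : SOBundle X m} (S S' : HolStructure W) : Prop :=
  ∃ (T : ∀ x, (model W).E x ≃L[ℂ] (model W).E x) (k : SOIso W W),
    IsSmoothSection ((model W).hom (model W))
      (fun x => (T x : (model W).E x →L[ℂ] (model W).E x)) ∧
    IsSmoothSection ((model W).hom (model W))
      (fun x => ((T x).symm : (model W).E x →L[ℂ] (model W).E x)) ∧
    (∀ x a b, modelQ W x (T x a) (T x b) = modelQ W x a b) ∧
    (∀ x Z, T x (model.mk W Z 0 0) = model.mk W Z 0 0) ∧
    (∀ x w, ∃ Z, T x (model.mk W 0 w 0) = model.mk W Z (k.toEquiv x w) 0) ∧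
    IsHolSection (S.V.hom S'.V) univ
      (fun x => (((S.Θ x).symm.trans (T x)).trans (S'.Θ x) : S.V.E x →L[ℂ] S'.V.E x)) ∧
    IsHolSection (S'.V.hom S.V) univ
      (fun x => (((S.Θ x).symm.trans (T x)).trans (S'.Θ x)).symm)

end HiggsSO

/-! Write `n = m + 2`. For a tangent vector `Z`, the square of the Higgs field is block diagonal
with trace `2 Q(φZ, φZ)` (`HiggsBundle.trace_Φ_sq`). Since `K⁻¹` is a line, the vanishing of this
quadratic form is the vanishing of `φᵗ ∘ φ`; this is (1).

If `φ` is null and has no zeroes, `v ↦ Q(v, φ(·))` maps `V` onto `K`. Its kernel `φ^⊥` is a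
holomorphic bundle containing the line `im φ`, and both the form and the volume descend to `W = φ^⊥
/ im φ` (`HiggsBundle.exists_determines`). An isomorphism of Higgs bundles preserves the whole flag,
so the triple is well defined up to isomorphism (`Determines.exists_soIso`).

Conversely nothing beyond `W` and the extension class is needed to recover `V`. Two isometries that
match the null lines and agree on `φ^⊥` are equal (`isometry_eq_of_eqOn`). Locally, a lift of `W` to
`φ^⊥` and a null vector `f` dual to `φ(Z)` split `V` as a line, a copy of `W` and a dual line, so
two bundles with the same `W` are locally isometric. If the extension classes match, the lifts can
be chosen with the same transition cocycle on both sides, and rigidity makes the local isometries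
agree on overlaps (`NullExtension.exists_isometry`). This yields both injectivity in (2) and
uniqueness up to gauge in (3).

For existence, a map `β : W → K⁻¹` exponentiates to a unipotent isometry of `K⁻¹ ⊕ W ⊕ K`, and `β ↦
unipotent W β` is additive because `Λ² K⁻¹ = 0` (`unipotent_comp`). Gluing copies of `K⁻¹ ⊕ W ⊕ K`
along the isometries attached to a cocycle of class `ξ` gives a bundle with the required form,
volume, flag and class. A smooth splitting of the cocycle, from a partition of unity
(`exists_smooth_splitting`), identifies the underlying smooth bundle with `K⁻¹ ⊕ W ⊕ K`
(`exists_isAdmissible_carries`). The last claim of (3) follows by combining this existence with the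
injectivity in (2).

The sections below treat the holomorphic and the smooth category together, through a parameter `ρ :
Regularity`. -/

section

open Filter Topology

namespace HiggsSO

universe u

variable {X : Type u} [TopologicalSpace X] [ChartedSpace ℂ X]
variable {F F' F'' : Type} [NormedAddCommGroup F] [NormedSpace ℂ F]
  [NormedAddCommGroup F'] [NormedSpace ℂ F'] [NormedAddCommGroup F''] [NormedSpace ℂ F'']

/-! ### Holomorphic and smooth maps at a point -/

/-- The two kinds of regularity considered: holomorphic over `ℂ`, and smooth over `ℝ`. -/
inductive Regularity
  | hol
  | smooth

/-- The map `f` is holomorphic, respectively smooth, at `x`. -/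
def RegAt (ρ : Regularity) (f : X → F) (x : X) : Prop :=
  match ρ with
  | .hol => ContMDiffAt 𝓘(ℂ) 𝓘(ℂ, F) ω f x
  | .smooth => ContMDiffAt 𝓘(ℝ, ℂ) 𝓘(ℝ, F) ∞ f x

namespace RegAt

variable {ρ : Regularity} {x : X}

theorem congr {f g : X → F} (hf : RegAt ρ f x) (h : g =ᶠ[𝓝 x] f) : RegAt ρ g x := by
  cases ρ
  · exact ContMDiffAt.congr_of_eventuallyEq hf h
  · exact ContMDiffAt.congr_of_eventuallyEq hf h

theorem const (c : F) : RegAt ρ (fun _ : X => c) x := by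
  cases ρ
  · exact contMDiffAt_const
  · exact contMDiffAt_const

theorem comp {f : X → F} {g : F → F'} (hg : ContDiffAt ℂ ω g (f x)) (hf : RegAt ρ f x) :
    RegAt ρ (fun z => g (f z)) x := by
  cases ρ
  · exact ContMDiffAt.comp x hg.contMDiffAt hf
  · exact ContMDiffAt.comp x ((hg.restrict_scalars ℝ).of_le le_top).contMDiffAt hf

theorem prodMk {f : X → F} {g : X → F'} (hf : RegAt ρ f x) (hg : RegAt ρ g x) :
    RegAt ρ (fun z => (f z, g z)) x := by
  cases ρ
  · exact ContMDiffAt.prodMk_space hf hg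
  · exact ContMDiffAt.prodMk_space hf hg

theorem comp₂ {f : X → F} {g : X → F'} {h : F × F' → F''} (hh : ContDiff ℂ ω h)
    (hf : RegAt ρ f x) (hg : RegAt ρ g x) : RegAt ρ (fun z => h (f z, g z)) x :=
  comp hh.contDiffAt (hf.prodMk hg)

theorem clm (L : F →L[ℂ] F') {f : X → F} (hf : RegAt ρ f x) : RegAt ρ (fun z => L (f z)) x :=
  comp L.contDiff.contDiffAt hf

theorem fst {f : X → F × F'} (hf : RegAt ρ f x) : RegAt ρ (fun z => (f z).1) x :=
  hf.clm (ContinuousLinearMap.fst ℂ F F')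

theorem snd {f : X → F × F'} (hf : RegAt ρ f x) : RegAt ρ (fun z => (f z).2) x :=
  hf.clm (ContinuousLinearMap.snd ℂ F F')

theorem add {f g : X → F} (hf : RegAt ρ f x) (hg : RegAt ρ g x) :
    RegAt ρ (fun z => f z + g z) x :=
  comp₂ contDiff_add hf hg

theorem smul {c : X → ℂ} {f : X → F} (hc : RegAt ρ c x) (hf : RegAt ρ f x) :
    RegAt ρ (fun z => c z • f z) x :=
  comp₂ contDiff_smul hc hf

theorem mul {f g : X → ℂ} (hf : RegAt ρ f x) (hg : RegAt ρ g x) :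
    RegAt ρ (fun z => f z * g z) x :=
  hf.smul hg

theorem inv {f : X → ℂ} (hf : RegAt ρ f x) (h : f x ≠ 0) : RegAt ρ (fun z => (f z)⁻¹) x :=
  comp (contDiffAt_inv ℂ h) hf

theorem clm_apply {L : X → F →L[ℂ] F'} {f : X → F} (hL : RegAt ρ L x) (hf : RegAt ρ f x) :
    RegAt ρ (fun z => L z (f z)) x :=
  comp₂ (h := fun p : (F →L[ℂ] F') × F => p.1 p.2) isBoundedBilinearMap_apply.contDiff hL hf

theorem clm_comp {L : X → F' →L[ℂ] F''} {M : X → F →L[ℂ] F'} (hL : RegAt ρ L x)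
    (hM : RegAt ρ M x) : RegAt ρ (fun z => (L z).comp (M z)) x :=
  comp₂ (h := fun p : (F' →L[ℂ] F'') × (F →L[ℂ] F') => p.1.comp p.2)
    isBoundedBilinearMap_comp.contDiff hL hM

/-- The complex and the real model use the same charts, so the two chart expressions of `f` coincide
and only scalars have to be restricted. -/
theorem of_hol {f : X → F} (hf : RegAt .hol f x) : RegAt ρ f x := by
  cases ρ
  · exact hf
  · change ContMDiffAt _ _ _ _ _ at hf
    change ContMDiffAt _ _ _ _ _
    rw [contMDiffAt_iff] at hf ⊢
    exact ⟨hf.1, (hf.2.restrict_scalars ℝ).of_le le_top⟩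

theorem continuousAt {f : X → F} (hf : RegAt ρ f x) : ContinuousAt f x := by
  cases ρ
  · exact ContMDiffAt.continuousAt hf
  · exact ContMDiffAt.continuousAt hf

theorem pi {ι : Type} [Fintype ι] {f : X → ι → F} (h : ∀ i, RegAt ρ (fun z => f z i) x) :
    RegAt ρ f x := by
  cases ρ
  · exact contMDiffAt_pi_space.2 h
  · exact contMDiffAt_pi_space.2 h

/-- An operator on a finite-dimensional space is the image of its values on a basis under a fixed
continuous linear map `T`. -/
theorem clm_of_apply [FiniteDimensional ℂ F] {L : X → F →L[ℂ] F'}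
    (h : ∀ v, RegAt ρ (fun z => L z v) x) : RegAt ρ L x := by
  let b := Module.finBasis ℂ F
  let T : (Fin (Module.finrank ℂ F) → F') →L[ℂ] (F →L[ℂ] F') :=
    ∑ i, (ContinuousLinearMap.smulRightL ℂ F F' (LinearMap.toContinuousLinearMap (b.coord i))).comp
      (ContinuousLinearMap.proj i)
  have hT : L = fun z => T (fun i => L z (b i)) := by
    funext z
    ext v
    simp only [T, sum_apply, ContinuousLinearMap.comp_apply,
      ContinuousLinearMap.proj_apply, ContinuousLinearMap.smulRightL_apply_apply]
    conv_lhs => rw [← b.sum_repr v, map_sum]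
    simp
  rw [hT]
  exact (pi fun i => h (b i)).clm T

theorem finset_sum {ι : Type*} (s : Finset ι) {f : ι → X → F} (h : ∀ i ∈ s, RegAt ρ (f i) x) :
    RegAt ρ (fun z => ∑ i ∈ s, f i z) x := by
  classical
  induction s using Finset.induction_on with
  | empty => simpa using const 0
  | insert i s hi ih =>
    simp only [Finset.sum_insert hi]
    exact (h i (Finset.mem_insert_self _ _)).add
      (ih fun j hj => h j (Finset.mem_insert_of_mem hj))

theorem finset_prod {ι : Type*} (s : Finset ι) {f : ι → X → ℂ} (h : ∀ i ∈ s, RegAt ρ (f i) x) :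
    RegAt ρ (fun z => ∏ i ∈ s, f i z) x := by
  classical
  induction s using Finset.induction_on with
  | empty => simpa using const 1
  | insert i s hi ih =>
    simp only [Finset.prod_insert hi]
    exact (h i (Finset.mem_insert_self _ _)).mul
      (ih fun j hj => h j (Finset.mem_insert_of_mem hj))

theorem det {n : ℕ} {M : X → Matrix (Fin n) (Fin n) ℂ}
    (h : ∀ i j, RegAt ρ (fun z => M z i j) x) : RegAt ρ (fun z => (M z).det) x := by
  simp only [Matrix.det_apply']
  exact finset_sum _ fun σ _ => (const _).mul (finset_prod _ fun i _ => h _ _)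

end RegAt

/-! ### Local coordinates of sections -/

namespace HolBundle

/-- The domain of the preferred trivialization at `x`. -/
def dom (A : HolBundle X F) (x : X) : Set X := (trivializationAt F A.E x).baseSet

theorem isOpen_dom (A : HolBundle X F) (x : X) : IsOpen (A.dom x) :=
  (trivializationAt F A.E x).open_baseSet

theorem mem_dom (A : HolBundle X F) (x : X) : x ∈ A.dom x :=
  mem_baseSet_trivializationAt F A.E x

theorem dom_mem_nhds (A : HolBundle X F) (x : X) : A.dom x ∈ 𝓝 x :=
  (A.isOpen_dom x).mem_nhds (A.mem_dom x)

open Classical in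
/-- The preferred trivialization at `x`, extended arbitrarily to all fibres. -/
noncomputable def coord (A : HolBundle X F) (x z : X) : A.E z ≃L[ℂ] F :=
  if h : z ∈ A.dom x then (trivializationAt F A.E x).continuousLinearEquivAt ℂ z h
  -- Off the domain any linear equivalence would do, and the trivialization at `z` always contains
  -- `z`. Making `coord x z` total lets it cancel with its inverse at every `z` without a membership
  -- check.
  else (trivializationAt F A.E z).continuousLinearEquivAt ℂ z (A.mem_dom z)

theorem coord_apply (A : HolBundle X F) {x z : X} (h : z ∈ A.dom x) (v : A.E z) :
    A.coord x z v = (trivializationAt F A.E x ⟨z, v⟩).2 := by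
  simp only [coord, h, dif_pos]
  rfl

theorem coord_symm_apply (A : HolBundle X F) {x z : X} (h : z ∈ A.dom x) (v : F) :
    (A.coord x z).symm v = (trivializationAt F A.E x).symm z v := by
  simp only [coord, h, dif_pos]
  rfl

theorem finiteDimensional_fiber (A : HolBundle X F) [FiniteDimensional ℂ F] (x : X) :
    FiniteDimensional ℂ (A.E x) :=
  (A.coord x x).symm.toLinearEquiv.finiteDimensional

theorem finrank_fiber (A : HolBundle X F) (x : X) :
    Module.finrank ℂ (A.E x) = Module.finrank ℂ F :=
  (A.coord x x).toLinearEquiv.finrank_eq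

end HolBundle

/-- The section `s` of `A` is holomorphic, respectively smooth, at `x`. -/
def RegSecAt (ρ : Regularity) (A : HolBundle X F) (s : ∀ x, A.E x) (x : X) : Prop :=
  RegAt ρ (fun z => A.coord x z (s z)) x

variable {A : HolBundle X F} {B : HolBundle X F'} {C : HolBundle X F''} {ρ : Regularity}

theorem isHolSection_iff {U : Set X} (hU : IsOpen U) {s : ∀ x, A.E x} :
    IsHolSection A U s ↔ ∀ x ∈ U, RegSecAt .hol A s x := by
  refine forall₂_congr fun x hx => ?_
  have h : ContMDiffWithinAt 𝓘(ℂ) (𝓘(ℂ).prod 𝓘(ℂ, F)) ω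
      (fun x => TotalSpace.mk' F x (s x)) U x ↔ ContMDiffAt 𝓘(ℂ) (𝓘(ℂ).prod 𝓘(ℂ, F)) ω
      (fun x => TotalSpace.mk' F x (s x)) x :=
    ⟨fun h => h.contMDiffAt (hU.mem_nhds hx), fun h => h.contMDiffWithinAt⟩
  rw [h, contMDiffAt_section]
  refine Filter.EventuallyEq.contMDiffAt_iff ?_
  filter_upwards [A.dom_mem_nhds x] with z hz
  rw [A.coord_apply hz]

theorem isHolSection_univ_iff {s : ∀ x, A.E x} :
    IsHolSection A univ s ↔ ∀ x, RegSecAt .hol A s x := by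
  simp [isHolSection_iff isOpen_univ]

theorem isSmoothSection_iff {s : ∀ x, A.E x} :
    IsSmoothSection A s ↔ ∀ x, RegSecAt .smooth A s x := by
  refine forall_congr' fun x => ?_
  rw [contMDiffAt_section]
  refine Filter.EventuallyEq.contMDiffAt_iff ?_
  filter_upwards [A.dom_mem_nhds x] with z hz
  rw [A.coord_apply hz]

/-- Coordinate changes are holomorphic by the definition of a holomorphic bundle, hence regular of
either kind. -/
theorem regAt_coord_change (A : HolBundle X F) {x y z : X} (hx : z ∈ A.dom x) (hy : z ∈ A.dom y) :
    RegAt ρ (fun w => ((A.coord y w : A.E w →L[ℂ] F).comp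
      ((A.coord x w).symm : F →L[ℂ] A.E w))) z := by
  refine RegAt.of_hol ?_
  have h : ContMDiffAt 𝓘(ℂ) 𝓘(ℂ, F →L[ℂ] F) ω _ z :=
    contMDiffAt_coordChangeL (IB := 𝓘(ℂ)) (n := ω)
    (e := trivializationAt F A.E x) (e' := trivializationAt F A.E y) hx hy
  refine RegAt.congr (ρ := .hol) h ?_
  filter_upwards [(A.isOpen_dom x).mem_nhds hx, (A.isOpen_dom y).mem_nhds hy] with w hw hw'
  ext v
  simp only [ContinuousLinearMap.comp_apply, ContinuousLinearEquiv.coe_coe]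
  rw [A.coord_apply hw', A.coord_symm_apply hw,
    Trivialization.coordChangeL_apply (R := ℂ) (b := w) _ _ ⟨hw, hw'⟩]

/-- `RegSecAt` at `z` is defined with the trivialization centred at `z`; since coordinate changes
are holomorphic, any trivialization around `z` may be used instead. This allows one trivialization
to serve a whole neighbourhood. -/
theorem regSecAt_iff {s : ∀ x, A.E x} {x z : X} (hz : z ∈ A.dom x) :
    RegSecAt ρ A s z ↔ RegAt ρ (fun w => A.coord x w (s w)) z := by
  constructor <;> intro h
  · refine ((regAt_coord_change A (A.mem_dom z) hz).clm_apply h).congr (.of_forall fun w => ?_)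
    simp
  · refine ((regAt_coord_change A hz (A.mem_dom z)).clm_apply h).congr (.of_forall fun w => ?_)
    simp

theorem regSecAt_hom_iff {f : ∀ x, A.E x →L[ℂ] B.E x} {x : X} :
    RegSecAt ρ (A.hom B) f x ↔ RegAt ρ (fun z => ((B.coord x z : B.E z →L[ℂ] F').comp
      ((f z).comp ((A.coord x z).symm : F →L[ℂ] A.E z)))) x := by
  refine ⟨fun h => h.congr ?_, fun h => h.congr ?_⟩
  all_goals
    filter_upwards [A.dom_mem_nhds x, B.dom_mem_nhds x] with z hA hB
    have hAB : z ∈ (A.hom B).dom x := ⟨hA, hB⟩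
    rw [(A.hom B).coord_apply hAB, hom_trivializationAt_apply,
      ContinuousLinearMap.inCoordinates_eq hA hB]
    ext v
    simp [HolBundle.coord, hA, hB]

theorem regSecAt_sum_iff [IsManifold 𝓘(ℂ) ω X] {s : ∀ x, A.E x} {t : ∀ x, B.E x} {x : X} :
    RegSecAt ρ (A.sum B) (fun z => (s z, t z)) x ↔ RegSecAt ρ A s x ∧ RegSecAt ρ B t x := by
  have key : (fun z => (A.sum B).coord x z (s z, t z)) =ᶠ[𝓝 x]
      fun z => (A.coord x z (s z), B.coord x z (t z)) := by
    filter_upwards [A.dom_mem_nhds x, B.dom_mem_nhds x] with z hA hB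
    have hAB : z ∈ (A.sum B).dom x := ⟨hA, hB⟩
    rw [(A.sum B).coord_apply hAB, A.coord_apply hA, B.coord_apply hB]
    rfl
  exact ⟨fun h => ⟨(RegAt.congr h key.symm).fst, (RegAt.congr h key.symm).snd⟩,
    fun h => (RegAt.prodMk h.1 h.2).congr key⟩

theorem regSecAt_trivialLine_iff {s : X → ℂ} {x : X} :
    RegSecAt ρ (trivialLine X) s x ↔ RegAt ρ s x := by
  have key : (fun z => (trivialLine X).coord x z (s z)) = s := by
    funext z
    rw [(trivialLine X).coord_apply (show z ∈ (trivialLine X).dom x from mem_univ _)]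
    rfl
  rw [RegSecAt, key]

/-! ### Calculus of regular sections -/

namespace RegSecAt

variable {x : X}

theorem congr {s t : ∀ z, A.E z} (hs : RegSecAt ρ A s x) (h : ∀ᶠ z in 𝓝 x, t z = s z) :
    RegSecAt ρ A t x :=
  RegAt.congr hs (h.mono fun z hz => by simp only [hz])

theorem of_hol {s : ∀ z, A.E z} (hs : RegSecAt .hol A s x) : RegSecAt ρ A s x :=
  RegAt.of_hol hs

theorem zero : RegSecAt ρ A (fun _ => 0) x :=
  (RegAt.const 0).congr (.of_forall fun z => by simp)

theorem add {s t : ∀ z, A.E z} (hs : RegSecAt ρ A s x) (ht : RegSecAt ρ A t x) :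
    RegSecAt ρ A (fun z => s z + t z) x :=
  (RegAt.add hs ht).congr (.of_forall fun z => by simp)

theorem smul {c : X → ℂ} {s : ∀ z, A.E z} (hc : RegAt ρ c x) (hs : RegSecAt ρ A s x) :
    RegSecAt ρ A (fun z => c z • s z) x :=
  (RegAt.smul hc hs).congr (.of_forall fun z => by simp)

theorem neg {s : ∀ z, A.E z} (hs : RegSecAt ρ A s x) : RegSecAt ρ A (fun z => -s z) x :=
  (smul (RegAt.const (-1)) hs).congr (.of_forall fun z => by simp)

theorem sub {s t : ∀ z, A.E z} (hs : RegSecAt ρ A s x) (ht : RegSecAt ρ A t x) :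
    RegSecAt ρ A (fun z => s z - t z) x :=
  (hs.add ht.neg).congr (.of_forall fun _ => sub_eq_add_neg _ _)

theorem coord_symm {y : X} (hx : x ∈ A.dom y) {c : X → F} (hc : RegAt ρ c x) :
    RegSecAt ρ A (fun z => (A.coord y z).symm (c z)) x :=
  (regSecAt_iff hx).2 (hc.congr (.of_forall fun z => by simp))

theorem hom_apply {f : ∀ z, A.E z →L[ℂ] B.E z} {s : ∀ z, A.E z} (hf : RegSecAt ρ (A.hom B) f x)
    (hs : RegSecAt ρ A s x) : RegSecAt ρ B (fun z => f z (s z)) x :=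
  ((regSecAt_hom_iff.1 hf).clm_apply hs).congr (.of_forall fun z => by simp)

theorem comp {f : ∀ z, B.E z →L[ℂ] C.E z} {g : ∀ z, A.E z →L[ℂ] B.E z}
    (hf : RegSecAt ρ (B.hom C) f x) (hg : RegSecAt ρ (A.hom B) g x) :
    RegSecAt ρ (A.hom C) (fun z => (f z).comp (g z)) x :=
  regSecAt_hom_iff.2 (((regSecAt_hom_iff.1 hf).clm_comp (regSecAt_hom_iff.1 hg)).congr
    (.of_forall fun z => by ext v; simp))

/-- Local sections with constant coordinates are holomorphic and span every nearby fibre, so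
holomorphic test sections suffice even when the conclusion is about smoothness. -/
theorem hom_of_apply [FiniteDimensional ℂ F] {f : ∀ z, A.E z →L[ℂ] B.E z}
    (h : ∀ s : ∀ z, A.E z, RegSecAt .hol A s x → RegSecAt ρ B (fun z => f z (s z)) x) :
    RegSecAt ρ (A.hom B) f x := by
  refine regSecAt_hom_iff.2 (RegAt.clm_of_apply fun v => ?_)
  exact h _ (coord_symm (A.mem_dom x) (RegAt.const v))

/-- In coordinates this is the analyticity of inversion at an invertible operator between Banach
spaces. -/
theorem symm [CompleteSpace F] {e : ∀ z, A.E z ≃L[ℂ] B.E z}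
    (h : RegSecAt ρ (A.hom B) (fun z => (e z : A.E z →L[ℂ] B.E z)) x) :
    RegSecAt ρ (B.hom A) (fun z => ((e z).symm : B.E z →L[ℂ] A.E z)) x := by
  let E : X → F ≃L[ℂ] F' := fun z => ((A.coord x z).symm.trans (e z)).trans (B.coord x z)
  have h1 : RegAt ρ (fun z => (E z : F →L[ℂ] F')) x :=
    (regSecAt_hom_iff.1 h).congr (.of_forall fun z => by ext v; simp [E])
  refine regSecAt_hom_iff.2 ((RegAt.comp (f := fun z => (E z : F →L[ℂ] F'))
    (contDiffAt_map_inverse (n := ω) (E x)) h1).congr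
    (.of_forall fun z => ?_))
  simp only [ContinuousLinearMap.inverse_equiv]
  ext v
  simp [E]

end RegSecAt

theorem regSecAt_hom_iff' {f : ∀ x, A.E x →L[ℂ] B.E x} {x z : X} (hA : z ∈ A.dom x)
    (hB : z ∈ B.dom x) :
    RegSecAt ρ (A.hom B) f z ↔ RegAt ρ (fun z => ((B.coord x z : B.E z →L[ℂ] F').comp
      ((f z).comp ((A.coord x z).symm : F →L[ℂ] A.E z)))) z := by
  rw [regSecAt_hom_iff]
  constructor <;> intro h
  · refine (((regAt_coord_change B (B.mem_dom z) hB).clm_comp h).clm_comp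
      (regAt_coord_change A hA (A.mem_dom z))).congr (.of_forall fun w => ?_)
    ext v
    simp
  · refine (((regAt_coord_change B hB (B.mem_dom z)).clm_comp h).clm_comp
      (regAt_coord_change A (A.mem_dom z) hA)).congr (.of_forall fun w => ?_)
    ext v
    simp

/-- A holomorphic family of endomorphisms that is the identity at `x` has a holomorphic inverse
near `x`. -/
theorem exists_local_inverse [CompleteSpace F] {U : Set X} (hU : IsOpen U) {x : X} (hx : x ∈ U)
    {M : X → F →L[ℂ] F} (hM : ∀ z ∈ U, RegAt .hol M z) (h1 : M x = 1) :
    ∃ V ⊆ U, IsOpen V ∧ x ∈ V ∧ ∃ N : X → F →L[ℂ] F,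
      ∀ z ∈ V, RegAt .hol N z ∧ (∀ v, N z (M z v) = v) ∧ ∀ v, M z (N z v) = v := by
  have hc : ContinuousOn M U := fun z hz => (hM z hz).continuousAt.continuousWithinAt
  -- Units form an open subset of the Banach algebra `F →L[ℂ] F`, and `Ring.inverse` is analytic
  -- there; `V` is the part of `U` on which `M` is a unit.
  refine ⟨U ∩ M ⁻¹' {T | IsUnit T}, inter_subset_left, hc.isOpen_inter_preimage hU Units.isOpen,
    ⟨hx, by simp [h1]⟩, fun z => Ring.inverse (M z), fun z hz => ⟨?_, fun v => ?_, fun v => ?_⟩⟩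
  · obtain ⟨T, hT⟩ := hz.2
    refine RegAt.comp (g := Ring.inverse) ?_ (hM z hz.1)
    rw [← hT]
    exact contDiffAt_ringInverse ℂ T
  · exact DFunLike.congr_fun (Ring.inverse_mul_cancel _ hz.2) v
  · exact DFunLike.congr_fun (Ring.mul_inverse_cancel _ hz.2) v

/-! ### Local holomorphic one-sided inverses of bundle maps -/

section LocalInverse

variable [FiniteDimensional ℂ F']

/-- Read in coordinates at `x`, `f` is a holomorphic family `T`. Freeze a right inverse `R` of `T
x`: then `T z ∘ R` is the identity at `x`, so it has a holomorphic inverse `N z` nearby, and `R ∘ N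
z` is a right inverse of `T z`. -/
theorem exists_local_rightInverse {U : Set X} (hU : IsOpen U) {x : X} (hx : x ∈ U)
    {f : ∀ z, A.E z →L[ℂ] B.E z} (hf : ∀ z ∈ U, RegSecAt .hol (A.hom B) f z)
    (hsurj : Function.Surjective (f x)) :
    ∃ V ⊆ U, IsOpen V ∧ x ∈ V ∧ ∃ g : ∀ z, B.E z →L[ℂ] A.E z,
      ∀ z ∈ V, RegSecAt .hol (B.hom A) g z ∧ ∀ v, f z (g z v) = v := by
  let T : X → F →L[ℂ] F' := fun z => (B.coord x z : B.E z →L[ℂ] F').comp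
      ((f z).comp ((A.coord x z).symm : F →L[ℂ] A.E z))
  have hT : Function.Surjective (T x) :=
    (B.coord x x).surjective.comp (hsurj.comp (A.coord x x).symm.surjective)
  obtain ⟨R, hR⟩ := LinearMap.exists_rightInverse_of_surjective (T x : F →ₗ[ℂ] F')
    (LinearMap.range_eq_top.2 hT)
  let R' : F' →L[ℂ] F := LinearMap.toContinuousLinearMap R
  obtain ⟨V, hVU, hV, hxV, N, hN⟩ := exists_local_inverse
    (M := fun z => (T z).comp R') (hU.inter ((A.isOpen_dom x).inter (B.isOpen_dom x)))
    ⟨hx, A.mem_dom x, B.mem_dom x⟩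
    (fun z hz => ((regSecAt_hom_iff' hz.2.1 hz.2.2).1 (hf z hz.1)).clm_comp (RegAt.const R'))
    (by ext v; exact DFunLike.congr_fun hR v)
  refine ⟨V, hVU.trans inter_subset_left, hV, hxV, fun z =>
    ((A.coord x z).symm : F →L[ℂ] A.E z).comp ((R'.comp (N z)).comp
      (B.coord x z : B.E z →L[ℂ] F')), fun z hz => ⟨?_, fun v => ?_⟩⟩
  · refine (regSecAt_hom_iff' (hVU hz).2.2 (hVU hz).2.1).2
      (((RegAt.const R').clm_comp (hN z hz).1).congr (.of_forall fun w => ?_))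
    ext v
    simp
  · have h2 := (hN z hz).2.2 (B.coord x z v)
    simp only [T, ContinuousLinearMap.comp_apply, ContinuousLinearEquiv.coe_coe] at h2 ⊢
    exact (B.coord x z).injective h2

variable [FiniteDimensional ℂ F]

/-- Dual to the previous argument: with a frozen left inverse `L` of `T x`, the family `L ∘ T z` is
invertible near `x` with inverse `N z`, and `N z ∘ L` is a left inverse of `T z`. -/
theorem exists_local_leftInverse {U : Set X} (hU : IsOpen U) {x : X} (hx : x ∈ U)
    {f : ∀ z, A.E z →L[ℂ] B.E z} (hf : ∀ z ∈ U, RegSecAt .hol (A.hom B) f z)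
    (hinj : Function.Injective (f x)) :
    ∃ V ⊆ U, IsOpen V ∧ x ∈ V ∧ ∃ g : ∀ z, B.E z →L[ℂ] A.E z,
      ∀ z ∈ V, RegSecAt .hol (B.hom A) g z ∧ ∀ v, g z (f z v) = v := by
  let T : X → F →L[ℂ] F' := fun z => (B.coord x z : B.E z →L[ℂ] F').comp
      ((f z).comp ((A.coord x z).symm : F →L[ℂ] A.E z))
  have hT : Function.Injective (T x) :=
    (B.coord x x).injective.comp (hinj.comp (A.coord x x).symm.injective)
  obtain ⟨L, hL⟩ := LinearMap.exists_leftInverse_of_injective (T x : F →ₗ[ℂ] F')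
    (LinearMap.ker_eq_bot.2 hT)
  let L' : F' →L[ℂ] F := LinearMap.toContinuousLinearMap L
  obtain ⟨V, hVU, hV, hxV, N, hN⟩ := exists_local_inverse
    (M := fun z => L'.comp (T z)) (hU.inter ((A.isOpen_dom x).inter (B.isOpen_dom x)))
    ⟨hx, A.mem_dom x, B.mem_dom x⟩
    (fun z hz => (RegAt.const L').clm_comp ((regSecAt_hom_iff' hz.2.1 hz.2.2).1 (hf z hz.1)))
    (by ext v; exact DFunLike.congr_fun hL v)
  refine ⟨V, hVU.trans inter_subset_left, hV, hxV, fun z =>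
    ((A.coord x z).symm : F →L[ℂ] A.E z).comp (((N z).comp L').comp
      (B.coord x z : B.E z →L[ℂ] F')), fun z hz => ⟨?_, fun v => ?_⟩⟩
  · refine (regSecAt_hom_iff' (hVU hz).2.2 (hVU hz).2.1).2
      (((hN z hz).1.clm_comp (RegAt.const L')).congr (.of_forall fun w => ?_))
    ext v
    simp
  · have h2 := (hN z hz).2.1 (A.coord x z v)
    simp only [T, ContinuousLinearMap.comp_apply, ContinuousLinearEquiv.coe_coe,
      ContinuousLinearEquiv.symm_apply_apply] at h2 ⊢
    rw [h2, ContinuousLinearEquiv.symm_apply_apply]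

/-- A section is regular if its image under an injective holomorphic bundle map is. -/
theorem RegSecAt.of_injective {f : ∀ z, A.E z →L[ℂ] B.E z} {x : X} {U : Set X} (hU : IsOpen U)
    (hx : x ∈ U) (hf : ∀ z ∈ U, RegSecAt .hol (A.hom B) f z) (hinj : Function.Injective (f x))
    {s : ∀ z, A.E z} (hs : RegSecAt ρ B (fun z => f z (s z)) x) : RegSecAt ρ A s x := by
  obtain ⟨V, -, hV, hxV, g, hg⟩ := exists_local_leftInverse hU hx hf hinj
  refine ((RegSecAt.of_hol (hg x hxV).1).hom_apply hs).congr ?_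
  filter_upwards [hV.mem_nhds hxV] with z hz
  exact ((hg z hz).2 _).symm

end LocalInverse

/-! ### Bundles from local frames -/

/-- The transition functions between the frames `τ x`. -/
noncomputable def transition [FiniteDimensional ℂ F] {E : X → Type} [∀ x, AddCommGroup (E x)]
    [∀ x, Module ℂ (E x)] (τ : X → ∀ z, F ≃ₗ[ℂ] E z) (x y z : X) : F →L[ℂ] F :=
  ((τ y z).trans (τ x z).symm).toLinearMap.toContinuousLinearMap

/-- The vector bundle core with frames `τ`. -/
noncomputable def frameCore [FiniteDimensional ℂ F] {E : X → Type} [∀ x, AddCommGroup (E x)]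
    [∀ x, Module ℂ (E x)] (U : X → Set X) (hU : ∀ x, IsOpen (U x)) (hx : ∀ x, x ∈ U x)
    (τ : X → ∀ z, F ≃ₗ[ℂ] E z)
    (hτ : ∀ x y, ∀ z ∈ U x ∩ U y, RegAt .hol (transition τ x y) z) :
    VectorBundleCore ℂ X F X where
  baseSet := U
  isOpen_baseSet := hU
  indexAt := id
  mem_baseSet_at := hx
  -- The coordinate change from index `x` to index `y` is `(τ y)⁻¹ ∘ τ x`, whence the exchanged
  -- indices.
  coordChange := fun x y => transition τ y x
  coordChange_self := fun x z _ v => by simp [transition]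
  continuousOn_coordChange := fun x y z hz =>
    (hτ y x z ⟨hz.2, hz.1⟩).continuousAt.continuousWithinAt
  coordChange_comp := fun x y w z _ v => by simp [transition]

theorem frameCore_isContMDiff [FiniteDimensional ℂ F] {E : X → Type} [∀ x, AddCommGroup (E x)]
    [∀ x, Module ℂ (E x)] (U : X → Set X) (hU : ∀ x, IsOpen (U x)) (hx : ∀ x, x ∈ U x)
    (τ : X → ∀ z, F ≃ₗ[ℂ] E z)
    (hτ : ∀ x y, ∀ z ∈ U x ∩ U y, RegAt .hol (transition τ x y) z) :
    (frameCore U hU hx τ hτ).IsContMDiff 𝓘(ℂ) ω where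
  contMDiffOn_coordChange := fun x y z hz =>
    ContMDiffAt.contMDiffWithinAt (hτ y x z ⟨hz.2, hz.1⟩)

/-- Vector spaces `E x` with local frames `τ x` that differ by holomorphic functions are the fibres
of a holomorphic vector bundle, in which the frames are holomorphic. -/
theorem exists_bundle_of_frames [FiniteDimensional ℂ F] {E : X → Type} [∀ x, AddCommGroup (E x)]
    [∀ x, Module ℂ (E x)] (U : X → Set X) (hU : ∀ x, IsOpen (U x)) (hx : ∀ x, x ∈ U x)
    (τ : X → ∀ z, F ≃ₗ[ℂ] E z)
    (hτ : ∀ x y, ∀ z ∈ U x ∩ U y, RegAt .hol (transition τ x y) z) :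
    ∃ (B : HolBundle X F) (κ : ∀ z, B.E z ≃ₗ[ℂ] E z), ∀ (ρ : Regularity) (s : ∀ z, B.E z) (x z : X),
      z ∈ U x → (RegSecAt ρ B s z ↔ RegAt ρ (fun w => (τ x w).symm (κ w (s w))) z) := by
  let Z := frameCore U hU hx τ hτ
  have : Z.IsContMDiff 𝓘(ℂ) ω := frameCore_isContMDiff U hU hx τ hτ
  let B : HolBundle X F :=
    { E := Z.Fiber
      topGroup := fun _ => inferInstanceAs (IsTopologicalAddGroup F)
      contSMul := fun _ => inferInstanceAs (ContinuousSMul ℂ F) }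
  -- The fibre of the core at `z` is `F`, read in the frame with index `z`; so `τ z z` is the
  -- identification with `E z`.
  refine ⟨B, fun z => τ z z, fun ρ s x z hz => ?_⟩
  have h1 : RegSecAt ρ B s z ↔ RegAt ρ (fun w => (τ z w).symm (τ w w (s w))) z := by
    have key : (fun w => B.coord z w (s w)) =ᶠ[𝓝 z] fun w => (τ z w).symm (τ w w (s w)) := by
      filter_upwards [B.dom_mem_nhds z] with w hw
      rw [B.coord_apply hw]
      rfl
    exact ⟨fun h => RegAt.congr h key.symm, fun h => RegAt.congr h key⟩
  rw [h1]
  constructor <;> intro h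
  · refine ((RegAt.of_hol (hτ x z z ⟨hz, hx z⟩)).clm_apply h).congr (.of_forall fun w => ?_)
    simp only [transition, LinearMap.coe_toContinuousLinearMap', LinearEquiv.coe_coe,
      LinearEquiv.trans_apply, LinearEquiv.apply_symm_apply]
    rfl
  · refine ((RegAt.of_hol (hτ z x z ⟨hx z, hz⟩)).clm_apply h).congr (.of_forall fun w => ?_)
    simp only [transition, LinearMap.coe_toContinuousLinearMap', LinearEquiv.coe_coe,
      LinearEquiv.trans_apply, LinearEquiv.apply_symm_apply]
    rfl

/-- A linear map out of a fibre of a bundle of finite rank is continuous. -/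
noncomputable def HolBundle.clm (A : HolBundle X F) [FiniteDimensional ℂ F] {x : X} {W : Type*}
    [AddCommGroup W] [Module ℂ W] [TopologicalSpace W] [IsTopologicalAddGroup W]
    [ContinuousSMul ℂ W] (L : A.E x →ₗ[ℂ] W) : A.E x →L[ℂ] W :=
  (LinearMap.toContinuousLinearMap (L.comp (A.coord x x).symm.toLinearEquiv.toLinearMap)).comp
    (A.coord x x : A.E x →L[ℂ] F)

@[simp]
theorem HolBundle.clm_apply (A : HolBundle X F) [FiniteDimensional ℂ F] {x : X} {W : Type*}
    [AddCommGroup W] [Module ℂ W] [TopologicalSpace W] [IsTopologicalAddGroup W]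
    [ContinuousSMul ℂ W] (L : A.E x →ₗ[ℂ] W) (v : A.E x) : A.clm L v = L v := by
  simp [HolBundle.clm]

/-- The trivial bundle with fibre `F`. -/
noncomputable abbrev trivialBundle (X : Type u) [TopologicalSpace X] [ChartedSpace ℂ X] (F : Type)
    [NormedAddCommGroup F] [NormedSpace ℂ F] : HolBundle X F where
  E := Bundle.Trivial X F
  topGroup := fun _ => inferInstanceAs (IsTopologicalAddGroup F)
  contSMul := fun _ => inferInstanceAs (ContinuousSMul ℂ F)

theorem regSecAt_trivialBundle_iff {s : X → F} {x : X} :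
    RegSecAt ρ (trivialBundle X F) s x ↔ RegAt ρ s x := by
  have key : (fun z => (trivialBundle X F).coord x z (s z)) = s := by
    funext z
    rw [(trivialBundle X F).coord_apply (show z ∈ (trivialBundle X F).dom x from mem_univ _)]
    rfl
  rw [RegSecAt, key]

/-! ### Kernels of surjective bundle maps -/

section Kernel

variable [FiniteDimensional ℂ F] [FiniteDimensional ℂ F']

/-- A basis of the kernel at `x`, continued with constant coordinates to `σ₀`, is pushed back into
the kernel by a local right inverse `h` of `f`: put `σ = σ₀ - h f σ₀`. At `x` nothing changes, so
`σ` stays injective nearby, with a holomorphic left inverse `g`. The kernels have constant dimension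
`r`, so `σ` fills them. -/
theorem exists_kernel_frame {f : HolHom A B} (hf : ∀ x, Function.Surjective (f.toFun x)) {r : ℕ}
    (hr : Module.finrank ℂ F = r + Module.finrank ℂ F') (x : X) :
    ∃ (U : Set X) (_ : IsOpen U) (_ : x ∈ U) (σ : ∀ z, (trivialBundle X (Fin r → ℂ)).E z →L[ℂ] A.E z)
      (g : ∀ z, A.E z →L[ℂ] (trivialBundle X (Fin r → ℂ)).E z),
      ∀ z ∈ U, RegSecAt .hol ((trivialBundle X (Fin r → ℂ)).hom A) σ z ∧
        RegSecAt .hol (A.hom (trivialBundle X (Fin r → ℂ))) g z ∧ (∀ v, g z (σ z v) = v) ∧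
        LinearMap.range (σ z).toLinearMap = LinearMap.ker (f.toFun z : A.E z →ₗ[ℂ] B.E z) := by
  have hker : ∀ z, Module.finrank ℂ (LinearMap.ker (f.toFun z : A.E z →ₗ[ℂ] B.E z)) = r := by
    intro z
    have := A.finiteDimensional_fiber z
    have h := LinearMap.finrank_range_add_finrank_ker (f.toFun z : A.E z →ₗ[ℂ] B.E z)
    rw [LinearMap.range_eq_top.2 (hf z), finrank_top, A.finrank_fiber, B.finrank_fiber] at h
    omega
  have := A.finiteDimensional_fiber x
  obtain ⟨V, -, hV, hxV, h, hh⟩ := exists_local_rightInverse isOpen_univ (mem_univ x)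
    (fun z _ => isHolSection_univ_iff.1 f.hol z) (hf x)
  let u : (Fin r → ℂ) ≃ₗ[ℂ] LinearMap.ker (f.toFun x : A.E x →ₗ[ℂ] B.E x) :=
    LinearEquiv.ofFinrankEq _ _ (by rw [hker x]; simp)
  let w : (Fin r → ℂ) →L[ℂ] F := LinearMap.toContinuousLinearMap
    ((A.coord x x).toLinearEquiv.toLinearMap ∘ₗ Submodule.subtype _ ∘ₗ u.toLinearMap)
  let σ₀ : ∀ z, (trivialBundle X (Fin r → ℂ)).E z →L[ℂ] A.E z := fun z =>
    ((A.coord x z).symm : F →L[ℂ] A.E z).comp w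
  let σ : ∀ z, (trivialBundle X (Fin r → ℂ)).E z →L[ℂ] A.E z := fun z =>
    σ₀ z - (h z).comp ((f.toFun z).comp (σ₀ z))
  have hσ : ∀ z ∈ V ∩ A.dom x, RegSecAt .hol ((trivialBundle X (Fin r → ℂ)).hom A) σ z := by
    intro z hz
    have h0 : RegSecAt .hol ((trivialBundle X (Fin r → ℂ)).hom A) σ₀ z :=
      RegSecAt.hom_of_apply fun s hs => RegSecAt.coord_symm hz.2
        ((regSecAt_trivialBundle_iff.1 hs).clm w)
    exact h0.sub ((hh z hz.1).1.comp ((isHolSection_univ_iff.1 f.hol z).comp h0))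
  have hσx : ∀ v, σ x v = u v := by
    intro v
    have h0 : σ₀ x v = u v := by simp [σ₀, w]
    have h1 : f.toFun x (u v) = 0 := (u v).2
    change σ₀ x v - h x (f.toFun x (σ₀ x v)) = u v
    rw [h0, h1, map_zero, sub_zero]
  obtain ⟨U, hUV, hU, hxU, g, hg⟩ := exists_local_leftInverse (hV.inter (A.isOpen_dom x))
    ⟨hxV, A.mem_dom x⟩ hσ (fun v v' hvv => by
      rw [hσx, hσx] at hvv
      exact u.injective (Subtype.ext hvv))
  refine ⟨U, hU, hxU, σ, g, fun z hz => ⟨hσ z (hUV hz), (hg z hz).1, (hg z hz).2, ?_⟩⟩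
  have := A.finiteDimensional_fiber z
  refine Submodule.eq_of_le_of_finrank_eq ?_ ?_
  · rintro _ ⟨v, rfl⟩
    change f.toFun z (σ₀ z v - h z (f.toFun z (σ₀ z v))) = 0
    rw [map_sub, (hh z (hUV hz).1).2, sub_self]
  · rw [hker, LinearMap.finrank_range_of_inj (Function.LeftInverse.injective (hg z hz).2)]
    exact Module.finrank_fin_fun ℂ

/-- The kernel of a surjective holomorphic bundle map is a holomorphic bundle. -/
theorem exists_kernel_bundle {f : HolHom A B} (hf : ∀ x, Function.Surjective (f.toFun x)) {r : ℕ}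
    (hr : Module.finrank ℂ F = r + Module.finrank ℂ F') :
    ∃ (K : HolBundle X (Fin r → ℂ)) (i : HolHom K A), (∀ x, Function.Injective (i.toFun x)) ∧
      ∀ x, LinearMap.range (i.toFun x : K.E x →ₗ[ℂ] A.E x) =
        LinearMap.ker (f.toFun x : A.E x →ₗ[ℂ] B.E x) := by
  classical
  choose U hU hxU σ g h using exists_kernel_frame hf hr
  let e : ∀ x z, z ∈ U x →
      (Fin r → ℂ) ≃ₗ[ℂ] LinearMap.ker (f.toFun z : A.E z →ₗ[ℂ] B.E z) := fun x z hz =>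
    (LinearEquiv.ofInjective (σ x z).toLinearMap
      (Function.LeftInverse.injective (h x z hz).2.2.1)).trans
      (LinearEquiv.ofEq _ _ (h x z hz).2.2.2)
  let τ : X → ∀ z, (Fin r → ℂ) ≃ₗ[ℂ] LinearMap.ker (f.toFun z : A.E z →ₗ[ℂ] B.E z) := fun x z =>
    -- Off `U x` the frame centred at `z` is a default value that keeps `τ x z` an isomorphism for
    -- all `z`.
    if hz : z ∈ U x then e x z hz else e z z (hxU z)
  have hτ : ∀ x z, z ∈ U x → ∀ v, (τ x z v : A.E z) = σ x z v := by
    intro x z hz v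
    simp only [τ, hz, dif_pos]
    rfl
  have hτs : ∀ x z, z ∈ U x → ∀ k, (τ x z).symm k = g x z (k : A.E z) := by
    intro x z hz k
    obtain ⟨v, rfl⟩ := (τ x z).surjective k
    rw [LinearEquiv.symm_apply_apply, hτ x z hz]
    exact ((h x z hz).2.2.1 v).symm
  obtain ⟨K, κ, hK⟩ := exists_bundle_of_frames U hU hxU τ (by
    intro x y z hz
    refine RegAt.clm_of_apply fun v => ?_
    have h1 : RegSecAt .hol A (fun w => σ y w v) z :=
      (h y z hz.2).1.hom_apply (regSecAt_trivialBundle_iff.2 (RegAt.const v))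
    refine (regSecAt_trivialBundle_iff.1 ((h x z hz.1).2.1.hom_apply h1)).congr ?_
    filter_upwards [(hU x).mem_nhds hz.1, (hU y).mem_nhds hz.2] with w hx hy
    rw [← hτ y w hy]
    exact hτs x w hx _)
  let i : ∀ z, K.E z →L[ℂ] A.E z := fun z => K.clm (Submodule.subtype _ ∘ₗ (κ z).toLinearMap)
  have hi : ∀ z k, i z k = κ z k := fun z k => by simp [i]
  refine ⟨K, ⟨i, isHolSection_univ_iff.2 fun x => RegSecAt.hom_of_apply fun s hs => ?_⟩,
    fun x k k' hk => ?_, fun x => ?_⟩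
  · have h1 := (h x x (hxU x)).1.hom_apply
      (regSecAt_trivialBundle_iff.2 ((hK _ s x x (hxU x)).1 hs))
    refine h1.congr ?_
    filter_upwards [(hU x).mem_nhds (hxU x)] with w hw
    rw [hi, ← hτ x w hw, LinearEquiv.apply_symm_apply]
  · change i x k = i x k' at hk
    rw [hi, hi] at hk
    exact (κ x).injective (Subtype.ext hk)
  · ext v
    constructor
    · rintro ⟨k, rfl⟩
      change i x k ∈ _
      rw [hi]
      exact (κ x k).2
    · intro hv
      exact ⟨(κ x).symm ⟨v, hv⟩, by change i x _ = v; rw [hi]; simp⟩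

end Kernel

/-! ### Cokernels of injective bundle maps -/

section Cokernel

variable [FiniteDimensional ℂ F] [FiniteDimensional ℂ F']

/-- A local left inverse `l` of `j` gives the projection `P = 1 - j l`, which kills `im j`. A basis
of `ker (l x)`, continued with constant coordinates and projected by `P`, is a frame of a complement
of `im j`. If `g` is a left inverse of this frame, `g ∘ P` is the quotient map read in it: its
kernel contains `im j` and has the same dimension. -/
theorem exists_cokernel_frame {j : HolHom A B} (hj : ∀ x, Function.Injective (j.toFun x)) {r : ℕ}
    (hr : Module.finrank ℂ F' = r + Module.finrank ℂ F) (x : X) :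
    ∃ (U : Set X) (_ : IsOpen U) (_ : x ∈ U) (σ : ∀ z, (trivialBundle X (Fin r → ℂ)).E z →L[ℂ] B.E z)
      (g : ∀ z, B.E z →L[ℂ] (trivialBundle X (Fin r → ℂ)).E z),
      ∀ z ∈ U, RegSecAt .hol ((trivialBundle X (Fin r → ℂ)).hom B) σ z ∧
        RegSecAt .hol (B.hom (trivialBundle X (Fin r → ℂ))) g z ∧ (∀ v, g z (σ z v) = v) ∧
        LinearMap.ker (g z).toLinearMap = LinearMap.range (j.toFun z).toLinearMap := by
  have := B.finiteDimensional_fiber x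
  obtain ⟨V, -, hV, hxV, l, hl⟩ := exists_local_leftInverse isOpen_univ (mem_univ x)
    (fun z _ => isHolSection_univ_iff.1 j.hol z) (hj x)
  have hker : Module.finrank ℂ (LinearMap.ker (l x).toLinearMap) = r := by
    have h := LinearMap.finrank_range_add_finrank_ker (l x).toLinearMap
    rw [LinearMap.range_eq_top.2 (Function.RightInverse.surjective (hl x hxV).2), finrank_top,
      A.finrank_fiber, B.finrank_fiber] at h
    omega
  let u : (Fin r → ℂ) ≃ₗ[ℂ] LinearMap.ker (l x).toLinearMap :=
    LinearEquiv.ofFinrankEq _ _ (by rw [hker]; simp)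
  let w : (Fin r → ℂ) →L[ℂ] F' := LinearMap.toContinuousLinearMap
    ((B.coord x x).toLinearEquiv.toLinearMap ∘ₗ Submodule.subtype _ ∘ₗ u.toLinearMap)
  let σ₀ : ∀ z, (trivialBundle X (Fin r → ℂ)).E z →L[ℂ] B.E z := fun z =>
    ((B.coord x z).symm : F' →L[ℂ] B.E z).comp w
  let P : ∀ z, B.E z →L[ℂ] B.E z := fun z =>
    ContinuousLinearMap.id ℂ (B.E z) - (j.toFun z).comp (l z)
  have hPdef : ∀ z b, P z b = b - j.toFun z (l z b) := fun _ _ => rfl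
  have hP : ∀ z ∈ V, RegSecAt .hol (B.hom B) P z := fun z hz =>
    (isHolSection_univ_iff.1 (isHolSection_id B univ) z).sub
      ((isHolSection_univ_iff.1 j.hol z).comp (hl z hz).1)
  have hPj : ∀ z ∈ V, ∀ a, P z (j.toFun z a) = 0 := fun z hz a => by
    rw [hPdef, (hl z hz).2, sub_self]
  have hPP : ∀ z ∈ V, ∀ b, P z (P z b) = P z b := fun z hz b => by
    rw [hPdef z b, map_sub, hPj z hz, sub_zero, hPdef]
  let σ : ∀ z, (trivialBundle X (Fin r → ℂ)).E z →L[ℂ] B.E z := fun z => (P z).comp (σ₀ z)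
  have hσ : ∀ z ∈ V ∩ B.dom x, RegSecAt .hol ((trivialBundle X (Fin r → ℂ)).hom B) σ z := by
    intro z hz
    have h0 : RegSecAt .hol ((trivialBundle X (Fin r → ℂ)).hom B) σ₀ z :=
      RegSecAt.hom_of_apply fun s hs => RegSecAt.coord_symm hz.2
        ((regSecAt_trivialBundle_iff.1 hs).clm w)
    exact (hP z hz.1).comp h0
  have hσx : ∀ v, σ x v = u v := by
    intro v
    have h0 : σ₀ x v = u v := by simp [σ₀, w]
    have h1 : l x (u v) = 0 := (u v).2
    change P x (σ₀ x v) = u v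
    rw [h0, hPdef, h1, map_zero, sub_zero]
  obtain ⟨U, hUV, hU, hxU, g, hg⟩ := exists_local_leftInverse (hV.inter (B.isOpen_dom x))
    ⟨hxV, B.mem_dom x⟩ hσ (fun v v' hvv => by
      rw [hσx, hσx] at hvv
      exact u.injective (Subtype.ext hvv))
  have hgσ : ∀ z ∈ U, ∀ v, ((g z).comp (P z)) (σ z v) = v := fun z hz v => by
    change g z (P z (P z (σ₀ z v))) = v
    rw [hPP z (hUV hz).1]
    exact (hg z hz).2 v
  refine ⟨U, hU, hxU, σ, fun z => (g z).comp (P z), fun z hz => ⟨hσ z (hUV hz),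
    (hg z hz).1.comp (hP z (hUV hz).1), hgσ z hz, ?_⟩⟩
  have := B.finiteDimensional_fiber z
  symm
  refine Submodule.eq_of_le_of_finrank_eq ?_ ?_
  · rintro _ ⟨v, rfl⟩
    change g z (P z (j.toFun z v)) = 0
    rw [hPj z (hUV hz).1, map_zero]
  · have h := LinearMap.finrank_range_add_finrank_ker ((g z).comp (P z)).toLinearMap
    have h3 : Module.finrank ℂ ((trivialBundle X (Fin r → ℂ)).E z) = r :=
      Module.finrank_fin_fun ℂ
    rw [LinearMap.range_eq_top.2 (Function.RightInverse.surjective (hgσ z hz)), finrank_top,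
      B.finrank_fiber, h3] at h
    change _ = Module.finrank ℂ (LinearMap.ker ((g z).comp (P z)).toLinearMap)
    rw [LinearMap.finrank_range_of_inj (hj z), A.finrank_fiber]
    omega

/-- The cokernel of an injective holomorphic bundle map is a holomorphic bundle. -/
theorem exists_cokernel_bundle {j : HolHom A B} (hj : ∀ x, Function.Injective (j.toFun x)) {r : ℕ}
    (hr : Module.finrank ℂ F' = r + Module.finrank ℂ F) :
    ∃ (K : HolBundle X (Fin r → ℂ)) (p : HolHom B K), IsShortExact j p := by
  classical
  choose U hU hxU σ g h using exists_cokernel_frame hj hr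
  let e : ∀ x z, z ∈ U x →
      (Fin r → ℂ) ≃ₗ[ℂ] (B.E z ⧸ LinearMap.range (j.toFun z).toLinearMap) := fun x z hz =>
    ((Submodule.quotEquivOfEq _ _ (h x z hz).2.2.2.symm).trans
      ((g x z).toLinearMap.quotKerEquivOfSurjective
        (Function.RightInverse.surjective (h x z hz).2.2.1))).symm
  let τ : X → ∀ z, (Fin r → ℂ) ≃ₗ[ℂ] (B.E z ⧸ LinearMap.range (j.toFun z).toLinearMap) :=
    fun x z => if hz : z ∈ U x then e x z hz else e z z (hxU z)
  have hτs : ∀ x z, z ∈ U x → ∀ b, (τ x z).symm (Submodule.Quotient.mk b) = g x z b := by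
    intro x z hz b
    simp only [τ, hz, dif_pos]
    rfl
  have hτ : ∀ x z, z ∈ U x → ∀ v, τ x z v = Submodule.Quotient.mk (σ x z v) := by
    intro x z hz v
    refine (τ x z).symm.injective ?_
    rw [LinearEquiv.symm_apply_apply, hτs x z hz]
    exact ((h x z hz).2.2.1 v).symm
  obtain ⟨K, κ, hK⟩ := exists_bundle_of_frames U hU hxU τ (by
    intro x y z hz
    refine RegAt.clm_of_apply fun v => ?_
    have h1 : RegSecAt .hol B (fun w => σ y w v) z :=
      (h y z hz.2).1.hom_apply (regSecAt_trivialBundle_iff.2 (RegAt.const v))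
    refine (regSecAt_trivialBundle_iff.1 ((h x z hz.1).2.1.hom_apply h1)).congr ?_
    filter_upwards [(hU x).mem_nhds hz.1, (hU y).mem_nhds hz.2] with w hx hy
    rw [← hτs x w hx, ← hτ y w hy]
    rfl)
  let p : ∀ z, B.E z →L[ℂ] K.E z := fun z =>
    B.clm ((κ z).symm.toLinearMap ∘ₗ Submodule.mkQ _)
  have hp : ∀ z b, κ z (p z b) = Submodule.Quotient.mk b := fun z b => by simp [p]
  refine ⟨K, ⟨p, isHolSection_univ_iff.2 fun x => RegSecAt.hom_of_apply fun s hs => ?_⟩, hj,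
    fun x v => ?_, fun x w => ?_⟩
  · rw [hK _ _ x x (hxU x)]
    refine (regSecAt_trivialBundle_iff.1 ((h x x (hxU x)).2.1.hom_apply hs)).congr ?_
    filter_upwards [(hU x).mem_nhds (hxU x)] with w hw
    rw [hp, hτs x w hw]
  · change p x v = 0 ↔ _
    rw [← (κ x).map_eq_zero_iff, hp, Submodule.Quotient.mk_eq_zero]
    rfl
  · obtain ⟨b, hb⟩ := Submodule.Quotient.mk_surjective _ (κ x w)
    exact ⟨b, (κ x).injective ((hp x b).trans hb)⟩

end Cokernel

/-! ### Extension classes -/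

section ExtensionClass

/-- A map into the total space of an extension whose projection vanishes factors through the
subbundle. -/
theorem exists_lift_of_exact {A₁ A₂ : Type*} [AddCommGroup A₁] [Module ℂ A₁] [AddCommGroup A₂]
    [Module ℂ A₂] (j : A₁ →ₗ[ℂ] A₂) (hj : Function.Injective j) {W : Type*} [AddCommGroup W]
    [Module ℂ W] (f : W →ₗ[ℂ] A₂) (h : ∀ w, ∃ a, j a = f w) :
    ∃ g : W →ₗ[ℂ] A₁, ∀ w, j (g w) = f w := by
  refine ⟨(LinearEquiv.ofInjective j hj).symm.toLinearMap ∘ₗ f.codRestrict (LinearMap.range j) h,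
    fun w => ?_⟩
  exact congrArg Subtype.val ((LinearEquiv.ofInjective j hj).apply_symm_apply
    (f.codRestrict (LinearMap.range j) h w))

variable {j : HolHom A B} {p : HolHom B C}

variable [FiniteDimensional ℂ F'']

theorem exists_clm_lift (hj : ∀ x, Function.Injective (j.toFun x)) {z : X}
    (f : C.E z →L[ℂ] B.E z) (h : ∀ w, ∃ a, j.toFun z a = f w) :
    ∃ g : C.E z →L[ℂ] A.E z, ∀ w, j.toFun z (g w) = f w := by
  obtain ⟨g, hg⟩ := exists_lift_of_exact (j.toFun z).toLinearMap (hj z) f.toLinearMap h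
  exact ⟨C.clm g, fun w => by rw [C.clm_apply]; exact hg w⟩

variable [FiniteDimensional ℂ F] [FiniteDimensional ℂ F']

theorem regSecAt_hom_of_injective {f : HolHom B C} (hf : ∀ x, Function.Injective (f.toFun x))
    {g : ∀ z, A.E z →L[ℂ] B.E z} {x : X}
    (h : RegSecAt ρ (A.hom C) (fun z => (f.toFun z).comp (g z)) x) :
    RegSecAt ρ (A.hom B) g x :=
  RegSecAt.hom_of_apply fun _ hs => RegSecAt.of_injective isOpen_univ (mem_univ x)
    (fun z _ => isHolSection_univ_iff.1 f.hol z) (hf x) (h.hom_apply (RegSecAt.of_hol hs))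

/-- Local right inverses of `p` are local splittings. Their differences are killed by `p`, hence
factor through `j`, and the factors form a cocycle since `j` is injective. -/
theorem IsShortExact.exists_isExtensionClass (h : IsShortExact j p) :
    ∃ ξ : H1 (C.hom A), IsExtensionClass j p ξ := by
  classical
  choose U _ hU hxU s hs using fun x => exists_local_rightInverse isOpen_univ (mem_univ x)
    (fun z _ => isHolSection_univ_iff.1 p.hol z) (h.surjective x)
  have hc : ∀ x y z, ∃ c : C.E z →L[ℂ] A.E z, z ∈ U x ∩ U y →
      ∀ w, j.toFun z (c w) = s y z w - s x z w := by
    intro x y z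
    by_cases hz : z ∈ U x ∩ U y
    · obtain ⟨c, hc⟩ := exists_clm_lift h.injective (s y z - s x z) (fun w => by
        refine (h.exact z _).1 ?_
        rw [sub_apply, map_sub, (hs x z hz.1).2, (hs y z hz.2).2,
          sub_self])
      exact ⟨c, fun _ => hc⟩
    -- A cochain is a function on all of `X`; its values off the overlap play no role, so `0` is
    -- taken.
    · exact ⟨0, fun h => absurd h hz⟩
  choose c hc using hc
  let a : Cocycle (C.hom A) :=
    { U := U
      isOpen := hU
      mem := hxU
      c := c
      hol := fun x y => (isHolSection_iff ((hU x).inter (hU y))).2 fun z hz => by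
        refine regSecAt_hom_of_injective h.injective
          (((hs y z hz.2).1.sub (hs x z hz.1).1).congr ?_)
        filter_upwards [((hU x).inter (hU y)).mem_nhds hz] with w hw
        ext v
        exact hc x y w hw v
      cocycle := fun x y w z hx hy hw => by
        ext v
        refine h.injective z ?_
        rw [add_apply, map_add, hc x y z ⟨hx, hy⟩, hc y w z ⟨hy, hw⟩,
          hc x w z ⟨hx, hw⟩, add_comm, sub_add_sub_cancel] }
  exact ⟨H1.mk a, a, s, fun x => (isHolSection_iff (hU x)).2 fun z hz => (hs x z hz).1,
    fun x z hz w => (hs x z hz).2 w, fun x y z hx hy w => hc x y z ⟨hx, hy⟩ w, rfl⟩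

/-- Two splittings over the same open set differ by `j ∘ u`. The maps `u` form a 0-cochain on the
intersections of the two covers whose coboundary is the difference of the cocycles. -/
theorem IsExtensionClass.unique (h : IsShortExact j p) {ξ ξ' : H1 (C.hom A)}
    (hξ : IsExtensionClass j p ξ) (hξ' : IsExtensionClass j p ξ') : ξ = ξ' := by
  classical
  obtain ⟨a, s, hs, hp, hc, rfl⟩ := hξ
  obtain ⟨b, t, ht, hq, hd, rfl⟩ := hξ'
  have hu : ∀ x z, ∃ u : C.E z →L[ℂ] A.E z, z ∈ a.U x ∩ b.U x →
      ∀ w, j.toFun z (u w) = t x z w - s x z w := by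
    intro x z
    by_cases hz : z ∈ a.U x ∩ b.U x
    · obtain ⟨u, hu⟩ := exists_clm_lift h.injective (t x z - s x z) (fun w => by
        refine (h.exact z _).1 ?_
        rw [sub_apply, map_sub, hp x z hz.1, hq x z hz.2, sub_self])
      exact ⟨u, fun _ => hu⟩
    · exact ⟨0, fun h => absurd h hz⟩
  choose u hu using hu
  refine Quotient.sound ⟨fun x => a.U x ∩ b.U x, u, fun x => ⟨(a.isOpen x).inter (b.isOpen x),
    ⟨a.mem x, b.mem x⟩, inter_subset_left, inter_subset_right, ?_⟩, fun x y z hx hy => ?_⟩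
  · refine (isHolSection_iff ((a.isOpen x).inter (b.isOpen x))).2 fun z hz => ?_
    refine regSecAt_hom_of_injective h.injective
      ((((isHolSection_iff (b.isOpen x)).1 (ht x) z hz.2).sub
        ((isHolSection_iff (a.isOpen x)).1 (hs x) z hz.1)).congr ?_)
    filter_upwards [((a.isOpen x).inter (b.isOpen x)).mem_nhds hz] with w hw
    ext v
    exact hu x w hw v
  · ext w
    refine h.injective z ?_
    rw [sub_apply, sub_apply, map_sub, map_sub,
      hc x y z hx.1 hy.1, hd x y z hx.2 hy.2, hu x z hx, hu y z hy]
    abel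

end ExtensionClass

/-! ### Linear algebra of alternating forms and Gram determinants -/

section LinearAlgebra

variable {V W : Type*} [AddCommGroup V] [Module ℂ V] [AddCommGroup W] [Module ℂ W] {m : ℕ}

/-- In the expansion of `η (u + d)` over subsets of the slots, every term but the one taking all its
entries from `u` contains some `d i` in slot `i`. -/
theorem multilinear_map_add_eq {ι : Type*} [Fintype ι] {N : Type*} [AddCommGroup N]
    [Module ℂ N] (η : MultilinearMap ℂ (fun _ : ι => V) N) (u d : ι → V)
    (h : ∀ v i, v i = d i → η v = 0) : η (u + d) = η u := by
  classical
  rw [η.map_add_univ, Finset.sum_eq_single Finset.univ]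
  · simp
  · intro s _ hs
    obtain ⟨i, hi⟩ : ∃ i, i ∉ s := by
      by_contra hcon
      push Not at hcon
      exact hs (Finset.eq_univ_iff_forall.2 hcon)
    exact h _ i (by simp [hi])
  · simp

/-- The alternating form `u ↦ θ (a, u, b)`. -/
def consSnoc {N : Type*} [AddCommGroup N] [Module ℂ N] (θ : V [⋀^Fin (m + 2)]→ₗ[ℂ] N) (a b : V) :
    V [⋀^Fin m]→ₗ[ℂ] N where
  toFun := fun u => θ (Fin.cons a (Fin.snoc u b : Fin (m + 1) → V))
  map_update_add' := by
    intro inst u i x y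
    obtain rfl : inst = instDecidableEqFin m := Subsingleton.elim _ _
    have h : ∀ t : V, (Fin.cons a (Fin.snoc (Function.update u i t) b : Fin (m + 1) → V) :
        Fin (m + 2) → V) = Function.update (Fin.cons a (Fin.snoc u b : Fin (m + 1) → V))
          i.castSucc.succ t := fun t => by
      rw [Fin.snoc_update, Fin.cons_update]
    simp only [h, θ.map_update_add]
  map_update_smul' := by
    intro inst u i c x
    obtain rfl : inst = instDecidableEqFin m := Subsingleton.elim _ _
    have h : ∀ t : V, (Fin.cons a (Fin.snoc (Function.update u i t) b : Fin (m + 1) → V) :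
        Fin (m + 2) → V) = Function.update (Fin.cons a (Fin.snoc u b : Fin (m + 1) → V))
          i.castSucc.succ t := fun t => by
      rw [Fin.snoc_update, Fin.cons_update]
    simp only [h, θ.map_update_smul]
  map_eq_zero_of_eq' := fun u i j h hij => by
    refine θ.map_eq_zero_of_eq (i := i.castSucc.succ) (j := j.castSucc.succ) _ ?_ ?_
    · simpa using h
    · simpa using hij

theorem consSnoc_apply {N : Type*} [AddCommGroup N] [Module ℂ N] (θ : V [⋀^Fin (m + 2)]→ₗ[ℂ] N)
    (a b : V) (u : Fin m → V) :
    consSnoc θ a b u = θ (Fin.cons a (Fin.snoc u b : Fin (m + 1) → V)) := rfl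

theorem consSnoc_smul_left (θ : V [⋀^Fin (m + 2)]→ₗ[ℂ] ℂ) (c : ℂ) (a b : V) (u : Fin m → V) :
    consSnoc θ (c • a) b u = c * consSnoc θ a b u := by
  have h : ∀ t : V, (Fin.cons t (Fin.snoc u b : Fin (m + 1) → V) : Fin (m + 2) → V) =
      Function.update (Fin.cons a (Fin.snoc u b : Fin (m + 1) → V)) 0 t := by simp
  rw [consSnoc_apply, consSnoc_apply, h, θ.map_update_smul, smul_eq_mul, ← h]

theorem consSnoc_update_last (θ : V [⋀^Fin (m + 2)]→ₗ[ℂ] ℂ) (a b : V) (u : Fin m → V) (t : V) :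
    consSnoc θ a t u =
      θ (Function.update (Fin.cons a (Fin.snoc u b : Fin (m + 1) → V)) (Fin.last _) t) := by
  rw [consSnoc_apply, ← Fin.succ_last, ← Fin.cons_update, Fin.update_snoc_last]

theorem consSnoc_add_right (θ : V [⋀^Fin (m + 2)]→ₗ[ℂ] ℂ) (a b b' : V) (u : Fin m → V) :
    consSnoc θ a (b + b') u = consSnoc θ a b u + consSnoc θ a b' u := by
  simp only [consSnoc_update_last θ a 0 u, θ.map_update_add]

theorem consSnoc_smul_right (θ : V [⋀^Fin (m + 2)]→ₗ[ℂ] ℂ) (c : ℂ) (a b : V) (u : Fin m → V) :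
    consSnoc θ a (c • b) u = c * consSnoc θ a b u := by
  simp only [consSnoc_update_last θ a 0 u, θ.map_update_smul, smul_eq_mul]

theorem consSnoc_self (θ : V [⋀^Fin (m + 2)]→ₗ[ℂ] ℂ) (a : V) (u : Fin m → V) :
    consSnoc θ a a u = 0 := by
  refine θ.map_eq_zero_of_eq (i := 0) (j := Fin.last _) _ ?_ (Fin.last_pos).ne
  rw [← Fin.succ_last, Fin.cons_succ, Fin.cons_zero, Fin.snoc_last]

/-- A term with a multiple of `a` in a middle slot vanishes, because `a` already occupies the first
slot. This is what makes the volume of `W` independent of the lifts of its vectors to `φ^⊥`. -/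
theorem consSnoc_add_smul (θ : V [⋀^Fin (m + 2)]→ₗ[ℂ] ℂ) (a b : V) (u : Fin m → V)
    (c : Fin m → ℂ) : consSnoc θ a b (fun k => u k + c k • a) = consSnoc θ a b u := by
  refine multilinear_map_add_eq (consSnoc θ a b).toMultilinearMap u (fun k => c k • a)
    fun v i hv => ?_
  have h : (v : Fin m → V) = Function.update v i (c i • a) := by simp [← hv]
  change consSnoc θ a b v = 0
  rw [h, (consSnoc θ a b).map_update_smul]
  refine (congrArg _ ?_).trans (smul_zero _)
  refine θ.map_eq_zero_of_eq (i := 0) (j := i.castSucc.succ) _ ?_ (Fin.succ_pos _).ne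
  simp

/-- All slots but the first hold images of `m + 1` vectors of `W`, which has dimension `m`, so they
are linearly dependent. -/
theorem consSnoc_eq_zero_of_finrank_lt [FiniteDimensional ℂ W] (hW : Module.finrank ℂ W = m)
    (θ : V [⋀^Fin (m + 2)]→ₗ[ℂ] ℂ) (a : V) (l : W →ₗ[ℂ] V) (w : Fin m → W) (w' : W) :
    consSnoc θ a (l w') (fun k => l (w k)) = 0 := by
  refine θ.map_linearDependent _ fun h => ?_
  have h1 := h.comp Fin.succ (Fin.succ_injective _)
  have h2 : (Fin.cons a (Fin.snoc (fun k => l (w k)) (l w') : Fin (m + 1) → V) :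
      Fin (m + 2) → V) ∘ Fin.succ = l ∘ (Fin.snoc w w' : Fin (m + 1) → W) := by
    funext k
    refine Fin.lastCases ?_ (fun i => ?_) k <;> simp
  rw [h2] at h1
  have h3 := (LinearIndependent.of_comp l h1).fintype_card_le_finrank
  rw [hW] at h3
  simp at h3

/-- Evaluation of a volume form on a frame adapted to a flag `e ⊂ e ⊕ W ⊂ e ⊕ W ⊕ f`. -/
theorem volume_adapted [FiniteDimensional ℂ W] (hW : Module.finrank ℂ W = m)
    (θ : V [⋀^Fin (m + 2)]→ₗ[ℂ] ℂ) (e f : V) (l : W →ₗ[ℂ] V) (w : Fin m → W) (w' : W)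
    (a : Fin m → ℂ) (c α β : ℂ) :
    consSnoc θ (c • e) (α • e + l w' + β • f) (fun k => l (w k) + a k • e) =
      c * β * consSnoc θ e f (fun k => l (w k)) := by
  rw [consSnoc_smul_left, consSnoc_add_smul, consSnoc_add_right, consSnoc_add_right,
    consSnoc_smul_right, consSnoc_smul_right, consSnoc_self, consSnoc_eq_zero_of_finrank_lt hW]
  ring

/-- Row `0` and column `0` each have a single nonzero entry, a `1` in the last place. Expanding
along both produces the signs `(-1) ^ (m + 1)` and `(-1) ^ m`, whose product is `-1`: the
determinant of a hyperbolic plane, and the source of the factor `√-1` in the volumes. -/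
theorem det_gram_adapted (M : Matrix (Fin (m + 2)) (Fin (m + 2)) ℂ) (h0 : M 0 0 = 0)
    (h1 : ∀ k : Fin m, M 0 k.castSucc.succ = 0) (h2 : M 0 (Fin.last _) = 1)
    (h3 : ∀ k : Fin m, M k.castSucc.succ 0 = 0) (h4 : M (Fin.last _) 0 = 1) :
    M.det = -(Matrix.of fun k l : Fin m => M k.castSucc.succ l.castSucc.succ).det := by
  rw [Matrix.det_succ_row_zero, Fin.sum_univ_castSucc, Finset.sum_eq_zero, zero_add, h2,
    Matrix.det_succ_column_zero, Fin.sum_univ_castSucc, Finset.sum_eq_zero, zero_add]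
  · have h5 : (M.submatrix Fin.succ (Fin.last (m + 1)).succAbove) (Fin.last m) 0 = 1 := by
      simpa using h4
    rw [h5]
    have h6 : (M.submatrix Fin.succ (Fin.last (m + 1)).succAbove).submatrix
        (Fin.last m).succAbove Fin.succ =
        Matrix.of fun k l : Fin m => M k.castSucc.succ l.castSucc.succ := by
      ext k l
      simp
    rw [h6]
    simp only [Fin.val_last, pow_succ]
    have h7 : ((-1 : ℂ) ^ m) * (-1) ^ m = 1 := by rw [← mul_pow]; simp
    linear_combination (-(Matrix.of fun k l : Fin m => M k.castSucc.succ l.castSucc.succ).det) * h7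
  · intro k _
    have h5 : (M.submatrix Fin.succ (Fin.last (m + 1)).succAbove) k.castSucc 0 = 0 := by
      simpa using h3 k
    rw [h5]
    ring
  · intro k _
    have h5 : M 0 k.castSucc = 0 := by
      refine Fin.cases ?_ (fun i => ?_) k
      · simpa using h0
      · simpa using h1 i
    rw [h5]
    ring

/-- Neither `Q f f` nor `Q f (u k)` is constrained: the vanishing entries in the row and column of
`e` already eliminate the row and column of `f`. So `f` need not be null or orthogonal to `u`. -/
theorem gram_det_cons_snoc (Q : V →ₗ[ℂ] V →ₗ[ℂ] ℂ) (hQ : ∀ v w, Q v w = Q w v) {e f : V}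
    {u : Fin m → V} (he : Q e e = 0) (heu : ∀ k, Q e (u k) = 0) (hef : Q e f = 1) :
    (Matrix.of fun k l : Fin (m + 2) =>
      Q ((Fin.cons e (Fin.snoc u f : Fin (m + 1) → V) : Fin (m + 2) → V) k)
        ((Fin.cons e (Fin.snoc u f : Fin (m + 1) → V) : Fin (m + 2) → V) l)).det =
      -(Matrix.of fun k l => Q (u k) (u l)).det := by
  have hlast : (Fin.cons e (Fin.snoc u f : Fin (m + 1) → V) : Fin (m + 2) → V) (Fin.last _) = f := by
    rw [← Fin.succ_last, Fin.cons_succ, Fin.snoc_last]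
  rw [det_gram_adapted]
  · simp
  · simpa using he
  · intro k
    simpa using heu k
  · rw [Matrix.of_apply, hlast]
    simpa using hef
  · intro k
    simpa [hQ] using (hQ _ _).trans (heu k)
  · rw [Matrix.of_apply, hlast]
    simpa [hQ] using (hQ _ _).trans hef

/-- The polarised normalisation `θ ⊗ θ = det Q` of a volume form can be checked on one basis. -/
theorem volume_mul_of_basis {r : ℕ} (b : Module.Basis (Fin r) ℂ V) (θ : V [⋀^Fin r]→ₗ[ℂ] ℂ)
    (Q : V →ₗ[ℂ] V →ₗ[ℂ] ℂ) (h : θ b ^ 2 = (Matrix.of fun k l => Q (b k) (b l)).det)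
    (e e' : Fin r → V) : θ e * θ e' = (Matrix.of fun k l => Q (e k) (e' l)).det := by
  have h1 : (Matrix.of fun k l => Q (e k) (e' l)) =
      (b.toMatrix e).transpose * (Matrix.of fun k l => Q (b k) (b l)) * b.toMatrix e' := by
    ext k l
    rw [Matrix.of_apply]
    conv_lhs => rw [← b.sum_repr (e k), ← b.sum_repr (e' l)]
    simp only [map_sum, map_smul, LinearMap.sum_apply, LinearMap.smul_apply, smul_eq_mul,
      Matrix.mul_apply, Matrix.transpose_apply, Matrix.of_apply, Module.Basis.toMatrix_apply,
      Finset.mul_sum, Finset.sum_mul]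
    exact Finset.sum_congr rfl fun i _ => Finset.sum_congr rfl fun j _ => by ring
  have h2 : ∀ e, θ e = θ b * (b.toMatrix e).det := fun e => by
    have h3 := DFunLike.congr_fun (AlternatingMap.eq_smul_basis_det b θ) e
    rwa [AlternatingMap.smul_apply, Module.Basis.det_apply, smul_eq_mul] at h3
  rw [h1, Matrix.det_mul, Matrix.det_mul, Matrix.det_transpose, ← h, h2 e, h2 e']
  ring

/-- Vectors with nonzero Gram determinant are linearly independent. -/
theorem linearIndependent_of_gram_det_ne_zero {r : ℕ} (Q : V →ₗ[ℂ] V →ₗ[ℂ] ℂ) {e : Fin r → V}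
    (h : (Matrix.of fun k l => Q (e k) (e l)).det ≠ 0) : LinearIndependent ℂ e := by
  rw [Fintype.linearIndependent_iff]
  intro c hc
  refine fun i => congrFun (Matrix.eq_zero_of_mulVec_eq_zero h (funext fun k => ?_)) i
  have h1 := congrArg (Q (e k)) hc
  rw [map_sum, map_zero] at h1
  refine Eq.trans (show ∑ l, Q (e k) (e l) * c l = ∑ l, Q (e k) (c l • e l) from ?_) h1
  exact Finset.sum_congr rfl fun l _ => by rw [map_smul, smul_eq_mul, mul_comm]

/-- Isometries of a space with a null line agree if they agree on its orthogonal complement. -/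
theorem isometry_eq_of_eqOn {V' L : Type*} [AddCommGroup V'] [Module ℂ V'] [AddCommGroup L]
    [Module ℂ L] (hL : Module.finrank ℂ L = 1) {Q : V →ₗ[ℂ] V →ₗ[ℂ] ℂ} {Q' : V' →ₗ[ℂ] V' →ₗ[ℂ] ℂ}
    (hQ' : ∀ v w, Q' v w = Q' w v) {φ : L →ₗ[ℂ] V} {φ' : L →ₗ[ℂ] V'}
    {G H : V →ₗ[ℂ] V'} (hG : ∀ v w, Q' (G v) (G w) = Q v w) (hH : ∀ v w, Q' (H v) (H w) = Q v w)
    (hGφ : ∀ Z, G (φ Z) = φ' Z)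
    (hGH : ∀ v, (∀ Z, Q v (φ Z) = 0) → G v = H v) (hφ : ∀ Z Z', Q (φ Z) (φ Z') = 0)
    (hperp : ∀ d, (∀ v, (∀ Z, Q v (φ Z) = 0) → Q' d (G v) = 0) → ∃ Z, d = φ' Z) : G = H := by
  ext v
  by_cases hv : ∀ Z, Q v (φ Z) = 0
  · exact hGH v hv
  push Not at hv
  obtain ⟨Z₁, hZ₁⟩ := hv
  -- For `n` orthogonal to the null line, `G n = H n`, so `Q' (G v) (G n) = Q v n = Q' (H v) (G n)`.
  -- Hence `G v - H v` is orthogonal to the image of that complement and lies on the null line.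
  obtain ⟨Z, hZ⟩ := hperp (G v - H v) (fun n hn => by
    rw [map_sub, LinearMap.sub_apply, hG, hGH n hn, hH, sub_self])
  have hGφH : G (φ Z) = H (φ Z) := hGH _ fun _ => hφ _ _
  have h1 : Q' (G v - H v) (G v - H v) = 0 := by rw [hZ, ← hGφ, hG, hφ]
  -- The difference `d = G v - H v` is null, while `G v` and `H v` have equal squares, so `Q' (G v)
  -- d` is half of `Q' d d = 0`. As `d = G (φ Z)`, this says `Q v (φ Z) = 0`; since `L` is a line
  -- and `Q v (φ Z₁) ≠ 0`, it forces `Z = 0`.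
  have h2 : Q' (G v) (G v - H v) = 0 := by
    have h3 := hG v v
    have h4 := hH v v
    simp only [map_sub, LinearMap.sub_apply] at h1 ⊢
    rw [hQ' (H v) (G v)] at h1
    linear_combination (1 / 2) * h1 + (1 / 2) * h3 - (1 / 2) * h4
  rw [hZ, ← hGφ, hG] at h2
  have hZ₁0 : Z₁ ≠ 0 := fun h => hZ₁ (by rw [h, map_zero, map_zero])
  obtain ⟨c, rfl⟩ := exists_smul_eq_of_finrank_eq_one hL hZ₁0 Z
  rw [map_smul, map_smul, smul_eq_mul, mul_eq_zero, or_iff_left hZ₁] at h2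
  rw [h2, zero_smul, map_zero, sub_eq_zero] at hZ
  exact hZ

end LinearAlgebra

/-! ### Smooth splittings of holomorphic cocycles -/

/-- Holomorphic chart changes are smooth over the reals; this real structure is where partitions of
unity live. -/
theorem isManifold_real [IsManifold 𝓘(ℂ) ω X] : IsManifold 𝓘(ℝ, ℂ) ∞ X := by
  refine isManifold_of_contDiffOn _ _ _ fun e e' he he' => ?_
  have h := (contDiffGroupoid ω 𝓘(ℂ)).compatible (M := X) he he'
  have h2 := (mem_groupoid_of_pregroupoid.1 h).1
  exact (ContDiffOn.restrict_scalars ℝ h2).of_le le_top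

/-- The sheaf of smooth sections is fine. For a smooth partition of unity `f` subordinate to the
cover take `s x = ∑ j, f j • a.c j x`; the cocycle identity turns `s y - s x` into `∑ j, f j • a.c x
y = a.c x y`. Compactness and the Hausdorff property enter the proof through this partition of
unity. -/
theorem exists_smooth_splitting [IsManifold 𝓘(ℂ) ω X] [T2Space X] [CompactSpace X]
    (a : Cocycle A) : ∃ s : X → ∀ z, A.E z,
      (∀ x, ∀ z ∈ a.U x, RegSecAt .smooth A (s x) z) ∧
      ∀ x y z, z ∈ a.U x → z ∈ a.U y → s y z - s x z = a.c x y z := by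
  have := isManifold_real (X := X)
  obtain ⟨f, hf⟩ := SmoothPartitionOfUnity.exists_isSubordinate 𝓘(ℝ, ℂ) (isClosed_univ (X := X))
    a.U a.isOpen (fun x _ => mem_iUnion.2 ⟨x, a.mem x⟩)
  have hfin : ∀ z, {j | f j z ≠ 0}.Finite := fun z => f.locallyFinite.point_finite z
  have hmem : ∀ j z, f j z ≠ 0 → z ∈ a.U j := fun j z h => hf j (subset_tsupport _ h)
  have hsupp : ∀ (t : X → ∀ z, A.E z) z,
      (Function.support fun j => (f j z : ℂ) • t j z) ⊆ {j | f j z ≠ 0} := by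
    intro t z j hj h0
    refine hj ?_
    simp only [h0, Complex.ofReal_zero, zero_smul]
  refine ⟨fun x z => ∑ᶠ j, (f j z : ℂ) • a.c j x z, fun x z hz => ?_, fun x y z hx hy => ?_⟩
  · have h1 : ContMDiffAt 𝓘(ℝ, ℂ) 𝓘(ℝ, F) ∞
        (fun w => ∑ᶠ j, f j w • A.coord z w (a.c j x w)) z := by
      refine f.contMDiffAt_finsum fun j hj => ?_
      have h2 : RegAt .smooth (fun w => A.coord z w (a.c j x w)) z := RegAt.of_hol
        ((isHolSection_iff ((a.isOpen j).inter (a.isOpen x))).1 (a.hol j x) z ⟨hf j hj, hz⟩)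
      exact h2
    refine RegAt.congr (ρ := .smooth) h1 (.of_forall fun w => ?_)
    have h3 := (A.coord z w).toLinearEquiv.toAddEquiv.toAddMonoidHom.map_finsum
      ((hfin w).subset (hsupp (fun j => a.c j x) w))
    refine h3.trans (finsum_congr fun j => ?_)
    exact ((A.coord z w).map_smul _ _).trans (Complex.coe_smul _ _)
  · rw [← finsum_sub_distrib ((hfin z).subset (hsupp (fun j => a.c j y) z))
      ((hfin z).subset (hsupp (fun j => a.c j x) z))]
    have h1 : ∀ j, (f j z : ℂ) • a.c j y z - (f j z : ℂ) • a.c j x z =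
        (f j z : ℂ) • a.c x y z := by
      intro j
      by_cases h0 : f j z = 0
      · simp only [h0, Complex.ofReal_zero, zero_smul, sub_zero]
      · rw [← a.cocycle j x y z (hmem j z h0) hx hy, smul_add, add_sub_cancel_left]
    rw [finsum_congr h1, ← finsum_smul']
    · have h2 : ∑ᶠ j, (f j z : ℂ) = 1 := by
        have h3 := Complex.ofRealHom.toAddMonoidHom.map_finsum (hfin z)
        have h4 := f.sum_eq_one (mem_univ z)
        rw [h4] at h3
        exact h3.symm.trans Complex.ofReal_one
      rw [h2, one_smul]
    · exact (hfin z).subset fun j hj h0 => hj (by simp [h0])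

/-- The pairing `Q` as a bilinear map. -/
noncomputable def bilinearOf {E : Type*} [AddCommGroup E] [Module ℂ E] [TopologicalSpace E]
    (q : E →L[ℂ] E →L[ℂ] ℂ) : E →ₗ[ℂ] E →ₗ[ℂ] ℂ :=
  LinearMap.mk₂ ℂ (fun v w => q v w) (fun _ _ _ => by rw [map_add]; rfl)
    (fun _ _ _ => by rw [map_smul]; rfl) (fun _ _ _ => map_add _ _ _) (fun _ _ _ => map_smul _ _ _)

theorem isHolSection_hom_apply {f : ∀ x, A.E x →L[ℂ] B.E x} (hf : IsHolSection (A.hom B) univ f)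
    {s : ∀ x, A.E x} {x : X} (hs : RegSecAt ρ A s x) : RegSecAt ρ B (fun z => f z (s z)) x :=
  (RegSecAt.of_hol (isHolSection_univ_iff.1 hf x)).hom_apply hs

theorem HolHom.regSecAt (f : HolHom A B) (x : X) : RegSecAt ρ (A.hom B) f.toFun x :=
  RegSecAt.of_hol (isHolSection_univ_iff.1 f.hol x)

theorem HolHom.apply (f : HolHom A B) {s : ∀ x, A.E x} {x : X} (hs : RegSecAt ρ A s x) :
    RegSecAt ρ B (fun z => f.toFun z (s z)) x :=
  (f.regSecAt x).hom_apply hs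

theorem regAt_pairing {Q : ∀ x, A.E x →L[ℂ] A.E x →L[ℂ] ℂ} {x : X}
    (hQ : RegSecAt ρ (A.hom (A.hom (trivialLine X))) Q x) {s t : ∀ x, A.E x}
    (hs : RegSecAt ρ A s x) (ht : RegSecAt ρ A t x) : RegAt ρ (fun z => Q z (s z) (t z)) x :=
  regSecAt_trivialLine_iff.1 ((hQ.hom_apply hs).hom_apply ht)

theorem regSecAt_pairing_of_apply [FiniteDimensional ℂ F]
    {Q : ∀ x, A.E x →L[ℂ] A.E x →L[ℂ] ℂ} {x : X}
    (h : ∀ s t : ∀ x, A.E x, RegSecAt .hol A s x → RegSecAt .hol A t x →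
      RegAt ρ (fun z => Q z (s z) (t z)) x) :
    RegSecAt ρ (A.hom (A.hom (trivialLine X))) Q x :=
  RegSecAt.hom_of_apply fun s hs => RegSecAt.hom_of_apply fun t ht =>
    regSecAt_trivialLine_iff.2 (h s t hs ht)

/-! ### The musical isomorphism of an orthogonal bundle -/

section Sharp

variable {m : ℕ} (W : SOBundle X m)

theorem SOBundle.finrank_fiber (x : X) : Module.finrank ℂ (W.E x) = m :=
  (W.toHolBundle.finrank_fiber x).trans (Module.finrank_fin_fun ℂ)

theorem finrank_clm_dual (F : Type) [NormedAddCommGroup F] [NormedSpace ℂ F]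
    [FiniteDimensional ℂ F] : Module.finrank ℂ (F →L[ℂ] ℂ) = Module.finrank ℂ F :=
  (LinearMap.toContinuousLinearMap (𝕜 := ℂ) (E := F) (F' := ℂ)).finrank_eq.symm.trans
    Subspace.dual_finrank_eq

theorem SOBundle.Q_bijective (x : X) : Function.Bijective (W.Q x) := by
  have h1 : Function.Injective (W.Q x).toLinearMap := by
    rw [← LinearMap.ker_eq_bot, LinearMap.ker_eq_bot']
    intro v hv
    exact W.Q_nondeg x v fun w => DFunLike.congr_fun hv w
  have := W.toHolBundle.finiteDimensional_fiber x
  have h2 : Module.finrank ℂ (W.E x →L[ℂ] ℂ) = Module.finrank ℂ (W.E x) := by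
    rw [W.toHolBundle.finrank_fiber, ← finrank_clm_dual]
    exact (W.toHolBundle.hom (trivialLine X)).finrank_fiber x
  have : FiniteDimensional ℂ (W.E x →L[ℂ] ℂ) :=
    (W.toHolBundle.hom (trivialLine X)).finiteDimensional_fiber x
  exact ⟨h1, (LinearMap.injective_iff_surjective_of_finrank_eq_finrank h2.symm).1 h1⟩

/-- The isomorphism `W ≅ W*` given by the orthogonal structure. -/
noncomputable def SOBundle.flat (x : X) :
    W.E x ≃L[ℂ] (W.toHolBundle.hom (trivialLine X)).E x where
  toLinearEquiv := LinearEquiv.ofBijective (W.Q x).toLinearMap (W.Q_bijective x)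
  continuous_toFun := (W.Q x).continuous
  continuous_invFun := by
    let L := LinearEquiv.ofBijective (W.Q x).toLinearMap (W.Q_bijective x)
    have h := ((W.toHolBundle.hom (trivialLine X)).clm (x := x) L.symm.toLinearMap).continuous
    refine h.congr fun v => ?_
    rw [HolBundle.clm_apply]
    rfl

/-- The inverse `W* ≅ W` of the isomorphism given by the orthogonal structure. -/
noncomputable def SOBundle.sharp (x : X) (l : W.E x →L[ℂ] ℂ) : W.E x := (W.flat x).symm l

theorem SOBundle.Q_sharp (x : X) (l : W.E x →L[ℂ] ℂ) (w : W.E x) : W.Q x (W.sharp x l) w = l w :=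
  DFunLike.congr_fun ((W.flat x).apply_symm_apply l) w

theorem SOBundle.Q_sharp' (x : X) (l : W.E x →L[ℂ] ℂ) (w : W.E x) : W.Q x w (W.sharp x l) = l w :=
  (W.Q_symm x _ _).trans (W.Q_sharp x l w)

theorem SOBundle.ext_Q {x : X} {v w : W.E x} (h : ∀ u, W.Q x v u = W.Q x w u) : v = w :=
  sub_eq_zero.1 (W.Q_nondeg x _ fun u => by rw [map_sub, sub_apply, h, sub_self])

theorem SOBundle.regSecAt_Q (x : X) :
    RegSecAt ρ (W.toHolBundle.hom (W.toHolBundle.hom (trivialLine X))) W.Q x :=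
  RegSecAt.of_hol (isHolSection_univ_iff.1 W.Q_hol x)

theorem SOBundle.regSecAt_sharp {x : X} {l : ∀ x, W.E x →L[ℂ] ℂ}
    (hl : RegSecAt ρ (W.toHolBundle.hom (trivialLine X)) l x) :
    RegSecAt ρ W.toHolBundle (fun z => W.sharp z (l z)) x := by
  have h : RegSecAt ρ (W.toHolBundle.hom (W.toHolBundle.hom (trivialLine X)))
      (fun z => (W.flat z : W.E z →L[ℂ] (W.toHolBundle.hom (trivialLine X)).E z)) x :=
    W.regSecAt_Q x
  exact h.symm.hom_apply hl

/-- The component in `W` of a vector of `V`, relative to the lift `σ`. -/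
noncomputable def component {V : HolBundle X F} (W : SOBundle X m)
    (Q : ∀ x, V.E x →L[ℂ] V.E x →L[ℂ] ℂ) (x : X)
    (σ : W.E x →L[ℂ] V.E x) (v : V.E x) : W.E x :=
  W.sharp x ((Q x v).comp σ)

theorem Q_component {V : HolBundle X F} {Q : ∀ x, V.E x →L[ℂ] V.E x →L[ℂ] ℂ} {W : SOBundle X m}
    (x : X) (σ : W.E x →L[ℂ] V.E x) (v : V.E x)
    (w : W.E x) :
    W.Q x (component W Q x σ v) w = Q x v (σ w) :=
  W.Q_sharp x _ w

/-- The square of the volume is the Gram determinant; if it vanished, a nontrivial combination of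
basis vectors would be orthogonal to everything. -/
theorem SOBundle.vol_basis_ne_zero {x : X} (b : Module.Basis (Fin m) ℂ (W.E x)) :
    W.vol x b ≠ 0 := by
  intro h
  have h1 := W.vol_sq x b
  rw [h, zero_pow two_ne_zero, eq_comm] at h1
  obtain ⟨c, hc, h2⟩ := Matrix.exists_mulVec_eq_zero_iff.2 h1
  refine hc ?_
  have h3 : ∀ k, W.Q x (∑ l, c l • b l) (b k) = 0 := by
    intro k
    have h4 : ∑ l, W.Q x (b k) (b l) * c l = 0 := congrFun h2 k
    rw [W.Q_symm, map_sum, ← h4]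
    exact Finset.sum_congr rfl fun l _ => by rw [map_smul, smul_eq_mul, mul_comm]
  have h5 : ∑ l, c l • b l = 0 := by
    refine W.Q_nondeg x _ fun u => ?_
    conv_lhs => rw [← b.sum_repr u, map_sum]
    exact Finset.sum_eq_zero fun k _ => by rw [map_smul, h3, smul_zero]
  exact funext fun l => Fintype.linearIndependent_iff.1 b.linearIndependent c h5 l

theorem SOBundle.exists_vol_ne_zero (x : X) : ∃ w, W.vol x w ≠ 0 := by
  have := W.toHolBundle.finiteDimensional_fiber x
  exact ⟨_, W.vol_basis_ne_zero (Module.finBasisOfFinrankEq ℂ (W.E x) (W.finrank_fiber x))⟩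

end Sharp

/-! ### Null extensions -/

variable [IsManifold 𝓘(ℂ) ω X] {m : ℕ} {W W' : SOBundle X m} {V : HolBundle X F}
  {V' : HolBundle X F'} {φ : HolHom (tangent X) V} {φ' : HolHom (tangent X) V'}
  {N : ∀ x, Submodule ℂ (V.E x)} {N' : ∀ x, Submodule ℂ (V'.E x)}

/-- A holomorphic orthogonal structure `Q` on `V` for which `φ` spans a line whose orthogonal
complement is the extension `D` of `W`, the form of `W` being induced by `Q`. -/
structure NullExtension (Q : ∀ x, V.E x →L[ℂ] V.E x →L[ℂ] ℂ) (D : Extension W φ N) : Prop where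
  hol : IsHolSection (V.hom (V.hom (trivialLine X))) univ Q
  symm : ∀ x v w, Q x v w = Q x w v
  nondeg : ∀ x v, (∀ w, Q x v w = 0) → v = 0
  perp : ∀ x v, v ∈ N x ↔ ∀ Z, Q x v (φ.toFun x Z) = 0
  isometric : ∀ x u v, W.Q x (D.p.toFun x u) (D.p.toFun x v) = Q x (D.i.toFun x u) (D.i.toFun x v)

/-- The map `σ : W → V` lifts the identity of `W` over the extension `D`. -/
def Extension.IsLift (D : Extension W φ N) (x : X) (σ : W.E x →L[ℂ] V.E x) : Prop :=
  ∀ w, ∃ u, D.i.toFun x u = σ w ∧ D.p.toFun x u = w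

theorem finrank_tangent (x : X) : Module.finrank ℂ ((tangent X).E x) = 1 :=
  ((tangent X).finrank_fiber x).trans (Module.finrank_self ℂ)

/-- A local holomorphic vector field without zeroes. -/
noncomputable def localField (x z : X) : (tangent X).E z := ((tangent X).coord x z).symm 1

theorem localField_ne_zero (x z : X) : localField x z ≠ 0 := by
  simp [localField]

theorem regSecAt_localField {x z : X} (h : z ∈ (tangent X).dom x) :
    RegSecAt ρ (tangent X) (localField x) z :=
  RegSecAt.coord_symm h (RegAt.const 1)

theorem exists_smul_localField (x z : X) (Z : (tangent X).E z) : ∃ c : ℂ, c • localField x z = Z :=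
  exists_smul_eq_of_finrank_eq_one (finrank_tangent z) (localField_ne_zero x z) Z

variable {Q : ∀ x, V.E x →L[ℂ] V.E x →L[ℂ] ℂ} {Q' : ∀ x, V'.E x →L[ℂ] V'.E x →L[ℂ] ℂ}
  {D : Extension W φ N} {D' : Extension W' φ' N'}

theorem Extension.i_mem (D : Extension W φ N) (x : X) (u : D.V₁.E x) : D.i.toFun x u ∈ N x := by
  rw [← D.i_range]
  exact ⟨u, rfl⟩

theorem Extension.φ_mem (D : Extension W φ N) (x : X) (Z : (tangent X).E x) :
    φ.toFun x Z ∈ N x := by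
  rw [← D.i_j]
  exact D.i_mem _ _

theorem Extension.exists_i (D : Extension W φ N) {x : X} {v : V.E x} (hv : v ∈ N x) :
    ∃ u, D.i.toFun x u = v := by
  rw [← D.i_range] at hv
  exact hv

theorem Extension.φ_injective (D : Extension W φ N) (x : X) : Function.Injective (φ.toFun x) := by
  intro Z Z' h
  rw [← D.i_j, ← D.i_j] at h
  exact D.exact.injective x (D.i_injective x h)

theorem Extension.exists_of_p_eq (D : Extension W φ N) {x : X} {u v : D.V₁.E x}
    (h : D.p.toFun x u = D.p.toFun x v) : ∃ Z, D.i.toFun x u = D.i.toFun x v + φ.toFun x Z := by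
  obtain ⟨Z, hZ⟩ := (D.exact.exact x (u - v)).1 (by rw [map_sub, h, sub_self])
  exact ⟨Z, by rw [← D.i_j, hZ, map_sub, add_sub_cancel]⟩

namespace Extension.IsLift

variable {x : X} {σ : W.E x →L[ℂ] V.E x}

theorem exists_eq (hσ : D.IsLift x σ) {v : V.E x} (hv : v ∈ N x) :
    ∃ w Z, v = σ w + φ.toFun x Z := by
  obtain ⟨u, rfl⟩ := D.exists_i hv
  obtain ⟨u', h1, h2⟩ := hσ (D.p.toFun x u)
  obtain ⟨Z, hZ⟩ := D.exists_of_p_eq h2.symm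
  exact ⟨_, Z, by rw [hZ, h1]⟩

theorem add (hσ : D.IsLift x σ) (c : W.E x →L[ℂ] (tangent X).E x) :
    D.IsLift x (σ + (φ.toFun x).comp c) := by
  intro w
  obtain ⟨u, h1, h2⟩ := hσ w
  refine ⟨u + D.j.toFun x (c w), ?_, ?_⟩
  · rw [map_add, h1, D.i_j]
    rfl
  · rw [map_add, h2, (D.exact.exact x _).2 ⟨_, rfl⟩, add_zero]

end Extension.IsLift

namespace NullExtension

theorem φ_null (h : NullExtension Q D) (x : X) (Z Z' : (tangent X).E x) :
    Q x (φ.toFun x Z) (φ.toFun x Z') = 0 :=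
  (h.perp x _).1 (D.φ_mem x Z) Z'

/-- This is `(φ^⊥)^⊥ = im φ`, obtained without counting dimensions: `d` is orthogonal to `im φ`, so
it lies in `N`; its class in `W` is orthogonal to all of `W`, so it vanishes; and the kernel of `N →
W` is `im φ`. -/
theorem eq_φ_of_perp (h : NullExtension Q D) {x : X} {d : V.E x} (hd : ∀ v ∈ N x, Q x d v = 0) :
    ∃ Z, d = φ.toFun x Z := by
  obtain ⟨u, rfl⟩ := D.exists_i ((h.perp x d).2 fun Z => hd _ (D.φ_mem x Z))
  have h0 : D.p.toFun x u = 0 := by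
    refine W.Q_nondeg x _ fun w => ?_
    obtain ⟨v, rfl⟩ := D.exact.surjective x w
    rw [h.isometric]
    exact hd _ (D.i_mem x v)
  obtain ⟨Z, hZ⟩ := D.exists_of_p_eq (u := u) (v := 0) (by rw [h0, map_zero])
  exact ⟨Z, by rw [hZ, map_zero, zero_add]⟩

variable {x : X} {σ : W.E x →L[ℂ] V.E x}

theorem lift_φ (h : NullExtension Q D) (hσ : D.IsLift x σ) (w : W.E x) (Z : (tangent X).E x) :
    Q x (σ w) (φ.toFun x Z) = 0 := by
  obtain ⟨u, h1, -⟩ := hσ w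
  rw [← h1]
  exact (h.perp x _).1 (D.i_mem x u) Z

theorem lift_lift (h : NullExtension Q D) (hσ : D.IsLift x σ) (w w' : W.E x) :
    Q x (σ w) (σ w') = W.Q x w w' := by
  obtain ⟨u, h1, h2⟩ := hσ w
  obtain ⟨u', h1', h2'⟩ := hσ w'
  rw [← h1, ← h1', ← h.isometric, h2, h2']

theorem regSecAt (h : NullExtension Q D) (x : X) :
    RegSecAt ρ (V.hom (V.hom (trivialLine X))) Q x :=
  RegSecAt.of_hol (isHolSection_univ_iff.1 h.hol x)

end NullExtension

/-! ### Isometries between null extensions -/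

/-- The null vector `f` is dual to `e = φ(Z)` and orthogonal to the lift `σ` of `W`. -/
structure IsHyperbolic (Q : ∀ x, V.E x →L[ℂ] V.E x →L[ℂ] ℂ) (φ : HolHom (tangent X) V) {x : X}
    (Z : (tangent X).E x) (σ : W.E x →L[ℂ] V.E x) (f : V.E x) : Prop where
  pair : Q x f (φ.toFun x Z) = 1
  perp : ∀ w, Q x f (σ w) = 0
  null : Q x f f = 0

theorem regSecAt_component (h : NullExtension Q D) {x : X} {σ : ∀ z, W.E z →L[ℂ] V.E z}
    (hσ : RegSecAt ρ (W.toHolBundle.hom V) σ x) {v : ∀ z, V.E z} (hv : RegSecAt ρ V v x) :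
    RegSecAt ρ W.toHolBundle (fun z => component W Q z (σ z) (v z)) x :=
  W.regSecAt_sharp (((h.regSecAt x).hom_apply hv).comp hσ)

/-- A Gram–Schmidt argument. A vector field `v₀` not orthogonal to `e` is scaled to `f₁` with `Q f₁
e = 1`, then made orthogonal to the lift of `W` by removing its `W`-component (`f₂`), then made null
by subtracting `(1/2) Q(f₂, f₂) e`. Because `e` is null and orthogonal to the lift, no correction
spoils the earlier ones. -/
theorem NullExtension.exists_hyperbolic (h : NullExtension Q D) {x : X} {U : Set X}
    (hU : IsOpen U) (hx : x ∈ U) {σ : ∀ z, W.E z →L[ℂ] V.E z}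
    (hσ : ∀ z ∈ U, RegSecAt .hol (W.toHolBundle.hom V) σ z) (hl : ∀ z ∈ U, D.IsLift z (σ z)) :
    ∃ (M : Set X) (f : ∀ z, V.E z), IsOpen M ∧ x ∈ M ∧ M ⊆ U ∩ (tangent X).dom x ∧
      ∀ z ∈ M, RegSecAt .hol V f z ∧ IsHyperbolic Q φ (localField x z) (σ z) (f z) := by
  let e : ∀ z, V.E z := fun z => φ.toFun z (localField x z)
  have he : ∀ z ∈ (tangent X).dom x, RegSecAt .hol V e z := fun z hz =>
    φ.apply (regSecAt_localField hz)
  obtain ⟨v, hv⟩ : ∃ v, Q x v (e x) ≠ 0 := by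
    by_contra hcon
    push Not at hcon
    have h0 := h.nondeg x (e x) fun w => (h.symm x _ _).trans (hcon w)
    exact localField_ne_zero x x (D.φ_injective x (h0.trans (map_zero _).symm))
  let v₀ : ∀ z, V.E z := fun z => (V.coord x z).symm (V.coord x x v)
  have hv₀ : ∀ z ∈ V.dom x, RegSecAt .hol V v₀ z := fun z hz =>
    RegSecAt.coord_symm hz (RegAt.const _)
  let c : X → ℂ := fun z => Q z (v₀ z) (e z)
  have hc : ∀ z ∈ (tangent X).dom x ∩ V.dom x, RegAt .hol c z := fun z hz =>
    regAt_pairing (h.regSecAt z) (hv₀ z hz.2) (he z hz.1)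
  have hcx : c x ≠ 0 := by simpa [c, v₀] using hv
  have hdom : IsOpen ((tangent X).dom x ∩ V.dom x) :=
    ((tangent X).isOpen_dom x).inter (V.isOpen_dom x)
  have hcont : ContinuousOn c ((tangent X).dom x ∩ V.dom x) := fun z hz =>
    (hc z hz).continuousAt.continuousWithinAt
  let M : Set X := U ∩ (((tangent X).dom x ∩ V.dom x) ∩ c ⁻¹' {0}ᶜ)
  let f₁ : ∀ z, V.E z := fun z => (c z)⁻¹ • v₀ z
  let f₂ : ∀ z, V.E z := fun z => f₁ z - σ z (component W Q z (σ z) (f₁ z))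
  let f : ∀ z, V.E z := fun z => f₂ z - ((1 / 2 : ℂ) * Q z (f₂ z) (f₂ z)) • e z
  refine ⟨M, f, hU.inter (hcont.isOpen_inter_preimage hdom isOpen_compl_singleton),
    ⟨hx, ⟨(tangent X).mem_dom x, V.mem_dom x⟩, hcx⟩, fun z hz => ⟨hz.1, hz.2.1.1⟩,
    fun z hz => ?_⟩
  have h1 : RegSecAt .hol V f₁ z := RegSecAt.smul ((hc z hz.2.1).inv hz.2.2) (hv₀ z hz.2.1.2)
  have h2 : RegSecAt .hol V f₂ z :=
    h1.sub ((hσ z hz.1).hom_apply (regSecAt_component h (hσ z hz.1) h1))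
  have hlz := hl z hz.1
  have e1 : Q z (f₁ z) (e z) = 1 := by
    simp only [f₁, map_smul, smul_apply, smul_eq_mul]
    exact inv_mul_cancel₀ hz.2.2
  have e2 : Q z (f₂ z) (e z) = 1 := by
    simp only [f₂, map_sub, sub_apply]
    rw [e1, h.lift_φ hlz, sub_zero]
  have e3 : ∀ w, Q z (f₂ z) (σ z w) = 0 := fun w => by
    simp only [f₂, map_sub, sub_apply]
    rw [h.lift_lift hlz, Q_component, sub_self]
  have e4 : ∀ w, Q z (e z) (σ z w) = 0 := fun w =>
    (h.symm z _ _).trans (h.lift_φ hlz w _)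
  have e5 : Q z (e z) (e z) = 0 := h.φ_null z _ _
  refine ⟨h2.sub (RegSecAt.smul ((RegAt.const _).mul (regAt_pairing (h.regSecAt z) h2 h2))
    (he z hz.2.1.1)), ?_, fun w => ?_, ?_⟩
  · change Q z (f z) (e z) = 1
    simp only [f, map_sub, sub_apply, map_smul, smul_apply, e2, e5, smul_zero, sub_zero]
  · simp only [f, map_sub, sub_apply, map_smul, smul_apply, e3, e4, smul_zero, sub_zero]
  · simp only [f, map_sub, sub_apply, map_smul, smul_apply, e2, e5,
      h.symm z (e z) (f₂ z), smul_eq_mul]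
    ring

/-- Decomposition of a vector along the lines spanned by `e = φ(Z)`, `f` and the lift of `W`. -/
theorem NullExtension.decompose (h : NullExtension Q D) {x z : X} {σ : W.E z →L[ℂ] V.E z}
    (hl : D.IsLift z σ) {f : V.E z} (hf : IsHyperbolic Q φ (localField x z) σ f) (v : V.E z) :
    v = Q z v f • φ.toFun z (localField x z) + σ (component W Q z σ v) +
      Q z v (φ.toFun z (localField x z)) • f := by
  have e1 : Q z (φ.toFun z (localField x z)) f = 1 := (h.symm z _ _).trans hf.pair
  -- The difference of the two sides is orthogonal to `N`, which the lift and `φ` span, so it is a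
  -- multiple of `φ(Z)`; pairing with `f` then shows that this multiple is `0`.
  obtain ⟨Z, hZ⟩ := h.eq_φ_of_perp (d := v - (Q z v f • φ.toFun z (localField x z) +
      σ (component W Q z σ v) + Q z v (φ.toFun z (localField x z)) • f)) (fun n hn => by
    obtain ⟨w, Z, rfl⟩ := hl.exists_eq hn
    obtain ⟨c, rfl⟩ := exists_smul_localField x z Z
    simp only [map_add, map_sub, map_smul, sub_apply, add_apply, smul_apply, smul_eq_mul,
      h.lift_φ hl, h.lift_lift hl, Q_component, h.φ_null, hf.pair, hf.perp,
      (h.symm z (φ.toFun z _) (σ w)).trans (h.lift_φ hl w _)]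
    ring)
  obtain ⟨c, rfl⟩ := exists_smul_localField x z Z
  have h0 := congrArg (fun t => Q z t f) hZ
  simp only [map_add, map_sub, map_smul, sub_apply, add_apply, smul_apply, smul_eq_mul, e1,
    hf.null, (h.symm z (σ _) f).trans (hf.perp _), mul_one, mul_zero, add_zero, sub_self] at h0
  rw [← h0, zero_smul, map_zero, sub_eq_zero] at hZ
  exact hZ

/-- The isometry matching the decompositions of two null extensions. -/
noncomputable def matchingIsometry (Q : ∀ x, V.E x →L[ℂ] V.E x →L[ℂ] ℂ) (φ : HolHom (tangent X) V)
    (φ' : HolHom (tangent X) V') (k : SOIso W W') {x : X} (Z : (tangent X).E x)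
    (σ : W.E x →L[ℂ] V.E x) (f : V.E x) (σ' : W'.E x →L[ℂ] V'.E x) (f' : V'.E x) :
    V.E x →ₗ[ℂ] V'.E x where
  toFun := fun v => Q x v f • φ'.toFun x Z + σ' (k.toEquiv x (component W Q x σ v)) +
      Q x v (φ.toFun x Z) • f'
  map_add' := fun v w => by
    have h1 : component W Q x σ (v + w) = component W Q x σ v + component W Q x σ w :=
      W.ext_Q fun u => by simp only [Q_component, map_add, add_apply]
    simp only [h1, map_add, add_apply, add_smul]
    abel
  map_smul' := fun c v => by
    have h1 : component W Q x σ (c • v) = c • component W Q x σ v :=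
      W.ext_Q fun u => by simp only [Q_component, map_smul, smul_apply]
    simp only [h1, map_smul, smul_apply, smul_add, smul_eq_mul, mul_smul, RingHom.id_apply]

section Matching

variable {k : SOIso W W'} {x z : X} {σ : W.E z →L[ℂ] V.E z} {f : V.E z}
  {σ' : W'.E z →L[ℂ] V'.E z} {f' : V'.E z}

theorem matchingIsometry_apply (Z : (tangent X).E z) (v : V.E z) :
    matchingIsometry Q φ φ' k Z σ f σ' f' v = Q z v f • φ'.toFun z Z +
      σ' (k.toEquiv z (component W Q z σ v)) + Q z v (φ.toFun z Z) • f' := rfl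

/-- Both decompositions have the same pairings: `e` and `f` span a hyperbolic plane orthogonal to a
copy of `W`, and `k` is an isometry of the middle summands. -/
theorem matchingIsometry_isometric (h : NullExtension Q D) (h' : NullExtension Q' D')
    (hl : D.IsLift z σ) (hl' : D'.IsLift z σ') (hf : IsHyperbolic Q φ (localField x z) σ f)
    (hf' : IsHyperbolic Q' φ' (localField x z) σ' f') (v w : V.E z) :
    Q' z (matchingIsometry Q φ φ' k (localField x z) σ f σ' f' v)
      (matchingIsometry Q φ φ' k (localField x z) σ f σ' f' w) = Q z v w := by
  have e1 : Q z (φ.toFun z (localField x z)) f = 1 := (h.symm z _ _).trans hf.pair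
  have e1' : Q' z (φ'.toFun z (localField x z)) f' = 1 := (h'.symm z _ _).trans hf'.pair
  have e2 : ∀ w, Q z (σ w) f = 0 := fun w => (h.symm z _ _).trans (hf.perp w)
  have e2' : ∀ w, Q' z (σ' w) f' = 0 := fun w => (h'.symm z _ _).trans (hf'.perp w)
  have e3 : ∀ w Z, Q z (φ.toFun z Z) (σ w) = 0 := fun w Z =>
    (h.symm z _ _).trans (h.lift_φ hl w _)
  have e3' : ∀ w Z, Q' z (φ'.toFun z Z) (σ' w) = 0 := fun w Z =>
    (h'.symm z _ _).trans (h'.lift_φ hl' w _)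
  have key : Q z v w = Q z (Q z v f • φ.toFun z (localField x z) + σ (component W Q z σ v) +
      Q z v (φ.toFun z (localField x z)) • f) (Q z w f • φ.toFun z (localField x z) +
      σ (component W Q z σ w) + Q z w (φ.toFun z (localField x z)) • f) := by
    rw [← h.decompose hl hf v, ← h.decompose hl hf w]
  rw [key]
  simp only [matchingIsometry_apply, map_add, map_smul, add_apply, smul_apply, smul_eq_mul,
    h.lift_φ hl, h'.lift_φ hl', h.lift_lift hl, h'.lift_lift hl', h.φ_null, h'.φ_null,
    hf.pair, hf.perp, hf.null, hf'.pair, hf'.perp, hf'.null, e1, e1', e2, e2', e3, e3', k.Q_eq]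

theorem matchingIsometry_φ (h : NullExtension Q D) (hl : D.IsLift z σ)
    (hf : IsHyperbolic Q φ (localField x z) σ f) (Z : (tangent X).E z) :
    matchingIsometry Q φ φ' k (localField x z) σ f σ' f' (φ.toFun z Z) = φ'.toFun z Z := by
  obtain ⟨c, rfl⟩ := exists_smul_localField x z Z
  have h1 : component W Q z σ (φ.toFun z (c • localField x z)) = 0 := W.ext_Q fun u => by
    rw [Q_component, h.symm, h.lift_φ hl, map_zero, zero_apply]
  rw [matchingIsometry_apply, h1, h.φ_null, h.symm, map_smul, map_smul, hf.pair]
  simp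

theorem matchingIsometry_lift (h : NullExtension Q D) (hl : D.IsLift z σ)
    (hf : IsHyperbolic Q φ (localField x z) σ f) (w : W.E z) :
    matchingIsometry Q φ φ' k (localField x z) σ f σ' f' (σ w) = σ' (k.toEquiv z w) := by
  have h1 : component W Q z σ (σ w) = w := W.ext_Q fun u => by
    rw [Q_component, h.lift_lift hl]
  rw [matchingIsometry_apply, h1, h.lift_φ hl, h.symm, hf.perp]
  simp

theorem matchingIsometry_hyperbolic (hf : IsHyperbolic Q φ (localField x z) σ f) :
    matchingIsometry Q φ φ' k (localField x z) σ f σ' f' f = f' := by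
  have h1 : component W Q z σ f = 0 := W.ext_Q fun u => by
    rw [Q_component, hf.perp, map_zero, zero_apply]
  rw [matchingIsometry_apply, h1, hf.null, hf.pair]
  simp

/-- Injectivity follows from being isometric out of a nondegenerate space; surjectivity from
decomposing the target vector and transporting its three components back. -/
theorem matchingIsometry_bijective (h : NullExtension Q D) (h' : NullExtension Q' D')
    (hl : D.IsLift z σ) (hl' : D'.IsLift z σ') (hf : IsHyperbolic Q φ (localField x z) σ f)
    (hf' : IsHyperbolic Q' φ' (localField x z) σ' f') :
    Function.Bijective (matchingIsometry Q φ φ' k (localField x z) σ f σ' f') := by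
  constructor
  · rw [← LinearMap.ker_eq_bot, LinearMap.ker_eq_bot']
    intro v hv
    refine h.nondeg z v fun w => ?_
    rw [← matchingIsometry_isometric (k := k) h h' hl hl' hf hf', hv, map_zero, zero_apply]
  · intro v
    refine ⟨Q' z v f' • φ.toFun z (localField x z) +
      σ ((k.toEquiv z).symm (component W' Q' z σ' v)) +
      Q' z v (φ'.toFun z (localField x z)) • f, ?_⟩
    conv_rhs => rw [h'.decompose hl' hf' v]
    rw [map_add, map_add, map_smul, map_smul, matchingIsometry_φ h hl hf,
      matchingIsometry_lift h hl hf, matchingIsometry_hyperbolic hf,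
      ContinuousLinearEquiv.apply_symm_apply]

end Matching

theorem regSecAt_matchingIsometry [FiniteDimensional ℂ F] (h : NullExtension Q D)
    {k : SOIso W W'} {x y : X} (hy : y ∈ (tangent X).dom x)
    {σ : ∀ z, W.E z →L[ℂ] V.E z} {f : ∀ z, V.E z}
    {σ' : ∀ z, W'.E z →L[ℂ] V'.E z} {f' : ∀ z, V'.E z}
    (hσ : RegSecAt ρ (W.toHolBundle.hom V) σ y) (hf : RegSecAt ρ V f y)
    (hσ' : RegSecAt ρ (W'.toHolBundle.hom V') σ' y) (hf' : RegSecAt ρ V' f' y) :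
    RegSecAt ρ (V.hom V') (fun z => V.clm
      (matchingIsometry Q φ φ' k (localField x z) (σ z) (f z) (σ' z) (f' z))) y := by
  refine RegSecAt.hom_of_apply fun s hs => ?_
  have hs' : RegSecAt ρ V s y := RegSecAt.of_hol hs
  have hZ := regSecAt_localField (ρ := ρ) hy
  have h1 := RegSecAt.smul (regAt_pairing (h.regSecAt y) hs' hf) (φ'.apply hZ)
  have h2 := hσ'.hom_apply (k.toHom.apply (regSecAt_component h hσ hs'))
  have h3 := RegSecAt.smul (regAt_pairing (h.regSecAt y) hs' (φ.apply hZ)) hf'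
  refine ((h1.add h2).add h3).congr (.of_forall fun z => ?_)
  rw [HolBundle.clm_apply]
  rfl

/-- Isometries of null extensions are determined by their values on a lift of `W`. -/
theorem NullExtension.isometry_unique (h : NullExtension Q D) (h' : NullExtension Q' D')
    {k : SOIso W W'} {z : X} {σ : W.E z →L[ℂ] V.E z} {σ' : W'.E z →L[ℂ] V'.E z}
    (hl : D.IsLift z σ) (hl' : D'.IsLift z σ') {G H : V.E z →L[ℂ] V'.E z}
    (hG : ∀ v w, Q' z (G v) (G w) = Q z v w) (hH : ∀ v w, Q' z (H v) (H w) = Q z v w)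
    (hGφ : ∀ Z, G (φ.toFun z Z) = φ'.toFun z Z) (hHφ : ∀ Z, H (φ.toFun z Z) = φ'.toFun z Z)
    (hGσ : ∀ w, G (σ w) = σ' (k.toEquiv z w)) (hHσ : ∀ w, H (σ w) = σ' (k.toEquiv z w)) :
    G = H := by
  have key : G.toLinearMap = H.toLinearMap := by
    refine isometry_eq_of_eqOn (Q := bilinearOf (Q z)) (Q' := bilinearOf (Q' z)) (φ := (φ.toFun z).toLinearMap)
      (φ' := (φ'.toFun z).toLinearMap) (finrank_tangent z) (h'.symm z) hG hH hGφ ?_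
      (h.φ_null z) ?_
    · intro v hv
      obtain ⟨w, Z, rfl⟩ := hl.exists_eq ((h.perp z v).2 hv)
      change G _ = H _
      rw [map_add, map_add, hGσ, hHσ, hGφ, hHφ]
    · intro d hd
      refine h'.eq_φ_of_perp fun v hv => ?_
      obtain ⟨w, Z, rfl⟩ := hl'.exists_eq hv
      -- `G` maps `N` onto `N'`: this vector of `N` is a preimage of `σ' w + φ' Z`.
      have h1 := hd (σ ((k.toEquiv z).symm w) + φ.toFun z Z) (fun Z' => by
        change Q z _ _ = 0
        rw [map_add, add_apply]
        exact (congrArg₂ (· + ·) (h.lift_φ hl _ Z') (h.φ_null z Z Z')).trans (add_zero 0))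
      change Q' z d (G _) = 0 at h1
      rw [map_add, hGσ, hGφ, ContinuousLinearEquiv.apply_symm_apply] at h1
      exact h1
  ext v
  exact DFunLike.congr_fun key v

/-- Null extensions with matching extension classes are isometric. -/
theorem NullExtension.exists_isometry [FiniteDimensional ℂ F] [FiniteDimensional ℂ F']
    (h : NullExtension Q D) (h' : NullExtension Q' D') (k : SOIso W W')
    {ξ : ExtH1 W} {ξ' : ExtH1 W'} (hξ : IsExtensionClass D.j D.p ξ)
    (hξ' : IsExtensionClass D'.j D'.p ξ') (hk : ξ = pull k ξ') :
    ∃ G : ∀ x, V.E x ≃L[ℂ] V'.E x,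
      IsHolSection (V.hom V') univ (fun x => (G x : V.E x →L[ℂ] V'.E x)) ∧
      IsHolSection (V'.hom V) univ (fun x => ((G x).symm : V'.E x →L[ℂ] V.E x)) ∧
      (∀ x v w, Q' x (G x v) (G x w) = Q x v w) ∧
      (∀ x Z, G x (φ.toFun x Z) = φ'.toFun x Z) ∧
      ∀ x u, ∃ u', G x (D.i.toFun x u) = D'.i.toFun x u' ∧
        D'.p.toFun x u' = k.toEquiv x (D.p.toFun x u) := by
  obtain ⟨a, s, hs, hsp, hsc, rfl⟩ := hξ
  obtain ⟨a', s', hs', hsp', hsc', rfl⟩ := hξ'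
  obtain ⟨U, t, hU, ht⟩ := Quotient.exact hk
  -- The cochain `t` has coboundary `a' ∘ k - a`. Adding `φ ∘ t` to the lifts `i ∘ s` turns their
  -- transition cocycle from `a` into `a' ∘ k`, the one of the lifts `σ' ∘ k` on the other side.
  let σ : X → ∀ z, W.E z →L[ℂ] V.E z := fun x z =>
    (D.i.toFun z).comp (s x z) + (φ.toFun z).comp (t x z)
  let σ' : X → ∀ z, W'.E z →L[ℂ] V'.E z := fun x z => (D'.i.toFun z).comp (s' x z)
  have hσ : ∀ x, ∀ z ∈ U x, RegSecAt .hol (W.toHolBundle.hom V) (σ x) z := fun x z hz =>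
    ((D.i.regSecAt z).comp ((isHolSection_iff (a.isOpen x)).1 (hs x) z ((hU x).2.2.1 hz))).add
      ((φ.regSecAt z).comp ((isHolSection_iff (hU x).1).1 (hU x).2.2.2.2 z hz))
  have hσ' : ∀ x, ∀ z ∈ U x, RegSecAt .hol (W'.toHolBundle.hom V') (σ' x) z := fun x z hz =>
    (D'.i.regSecAt z).comp
      ((isHolSection_iff (a'.isOpen x)).1 (hs' x) z ((hU x).2.2.2.1 hz))
  have hl : ∀ x, ∀ z ∈ U x, D.IsLift z (σ x z) := fun x z hz => by
    refine Extension.IsLift.add (fun w => ⟨s x z w, rfl, hsp x z ((hU x).2.2.1 hz) w⟩) _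
  have hl' : ∀ x, ∀ z ∈ U x, D'.IsLift z (σ' x z) := fun x z hz w =>
    ⟨s' x z w, rfl, hsp' x z ((hU x).2.2.2.1 hz) w⟩
  choose M f hM hxM hMU hf using fun x => h.exists_hyperbolic (hU x).1 (hU x).2.1 (hσ x) (hl x)
  choose M' f' hM' hxM' hMU' hf' using fun x =>
    h'.exists_hyperbolic (hU x).1 (hU x).2.1 (hσ' x) (hl' x)
  let G : ∀ x z, V.E z →L[ℂ] V'.E z := fun x z => V.clm
    (matchingIsometry Q φ φ' k (localField x z) (σ x z) (f x z) (σ' x z) (f' x z))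
  have hGdef : ∀ x z v, G x z v =
      matchingIsometry Q φ φ' k (localField x z) (σ x z) (f x z) (σ' x z) (f' x z) v :=
    fun x z v => HolBundle.clm_apply _ _ _
  have hGiso : ∀ x, ∀ z ∈ M x ∩ M' x, ∀ v w, Q' z (G x z v) (G x z w) = Q z v w := by
    intro x z hz v w
    rw [hGdef, hGdef]
    exact matchingIsometry_isometric h h' (hl x z (hMU x hz.1).1) (hl' x z (hMU x hz.1).1)
      (hf x z hz.1).2 (hf' x z hz.2).2 v w
  have hGφ : ∀ x, ∀ z ∈ M x ∩ M' x, ∀ Z, G x z (φ.toFun z Z) = φ'.toFun z Z := by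
    intro x z hz Z
    rw [hGdef]
    exact matchingIsometry_φ h (hl x z (hMU x hz.1).1) (hf x z hz.1).2 Z
  have hGσ : ∀ x, ∀ z ∈ M x ∩ M' x, ∀ w, G x z (σ x z w) = σ' x z (k.toEquiv z w) := by
    intro x z hz w
    rw [hGdef]
    exact matchingIsometry_lift h (hl x z (hMU x hz.1).1) (hf x z hz.1).2 w
  have hGhol : ∀ x, ∀ z ∈ M x ∩ M' x, RegSecAt .hol (V.hom V') (G x) z := fun x z hz =>
    regSecAt_matchingIsometry h (hMU x hz.1).2 (hσ x z (hMU x hz.1).1) (hf x z hz.1).1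
      (hσ' x z (hMU x hz.1).1) (hf' x z hz.2).1
  -- By rigidity it suffices to compare the two isometries on the single lift `σ x z`. Both lifts
  -- jump by the same cocycle `a' ∘ k` between `x` and `z`, so `G z z` also takes `σ x z w` to `σ' x
  -- z (k w)`. Consequently the family `z ↦ G z z` coincides near `x` with the holomorphic family `G
  -- x`.
  have hglue : ∀ x, ∀ z ∈ M x ∩ M' x, G z z = G x z := by
    intro x z hz
    have hzz : z ∈ M z ∩ M' z := ⟨hxM z, hxM' z⟩
    have hUx := (hMU x hz.1).1
    have hUz := (hU z).2.1
    refine h.isometry_unique h' (k := k) (hl x z hUx) (hl' x z hUx) (hGiso z z hzz)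
      (hGiso x z hz) (hGφ z z hzz) (hGφ x z hz) (fun w => ?_) (hGσ x z hz)
    have e1 : σ z z w - σ x z w = φ.toFun z (a'.c x z z (k.toEquiv z w)) := by
      have e2 := DFunLike.congr_fun (ht x z z hUx hUz) w
      have e3 := hsc x z z ((hU x).2.2.1 hUx) ((hU z).2.2.1 hUz) w
      have e4 := congrArg (D.i.toFun z) e3
      rw [D.i_j, map_sub] at e4
      change a'.c x z z (k.toEquiv z w) - a.c x z z w = t z z w - t x z w at e2
      rw [← sub_add_cancel (a'.c x z z (k.toEquiv z w)) (a.c x z z w), e2, map_add, map_sub, e4]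
      change (D.i.toFun z (s z z w) + φ.toFun z (t z z w)) -
        (D.i.toFun z (s x z w) + φ.toFun z (t x z w)) = _
      abel
    have e5 : ∀ w', σ' z z w' - σ' x z w' = φ'.toFun z (a'.c x z z w') := by
      intro w'
      have e3 := hsc' x z z ((hU x).2.2.2.1 hUx) ((hU z).2.2.2.1 hUz) w'
      have e4 := congrArg (D'.i.toFun z) e3
      rw [D'.i_j, map_sub] at e4
      exact e4.symm
    have e6 : σ x z w = σ z z w - φ.toFun z (a'.c x z z (k.toEquiv z w)) := by
      rw [← e1, sub_sub_cancel]
    rw [e6, map_sub, hGσ z z hzz, hGφ z z hzz, ← e5, sub_sub_cancel]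
  have hbij : ∀ z, Function.Bijective (G z z) := by
    intro z
    have hzz : z ∈ M z ∩ M' z := ⟨hxM z, hxM' z⟩
    have e1 := matchingIsometry_bijective (k := k) h h' (hl z z (hU z).2.1) (hl' z z (hU z).2.1)
      (hf z z hzz.1).2 (hf' z z hzz.2).2
    convert e1 using 1
    funext v
    exact hGdef z z v
  let E : ∀ z, V.E z ≃L[ℂ] V'.E z := fun z =>
    { toLinearEquiv := LinearEquiv.ofBijective (G z z).toLinearMap (hbij z)
      continuous_toFun := (G z z).continuous
      continuous_invFun := by
        refine (V'.clm (LinearEquiv.ofBijective (G z z).toLinearMap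
          (hbij z)).symm.toLinearMap).continuous.congr fun v => ?_
        rw [HolBundle.clm_apply]
        rfl }
  have hE : ∀ z, (E z : V.E z →L[ℂ] V'.E z) = G z z := fun z => by
    ext v
    rfl
  have hhol : ∀ x, RegSecAt .hol (V.hom V') (fun z => (E z : V.E z →L[ℂ] V'.E z)) x := by
    intro x
    refine (hGhol x x ⟨hxM x, hxM' x⟩).congr ?_
    filter_upwards [((hM x).inter (hM' x)).mem_nhds ⟨hxM x, hxM' x⟩] with z hz
    rw [hE, hglue x z hz]
  have := FiniteDimensional.complete ℂ F
  refine ⟨E, isHolSection_univ_iff.2 hhol, isHolSection_univ_iff.2 fun x => (hhol x).symm,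
    fun x => hGiso x x ⟨hxM x, hxM' x⟩, fun x => hGφ x x ⟨hxM x, hxM' x⟩, fun x u => ?_⟩
  have hx := (hU x).2.1
  obtain ⟨u₁, e1, e2⟩ := hl x x hx (D.p.toFun x u)
  obtain ⟨Z, hZ⟩ := D.exists_of_p_eq e2.symm
  obtain ⟨u₂, e3, e4⟩ := hl' x x hx (k.toEquiv x (D.p.toFun x u))
  refine ⟨u₂ + D'.j.toFun x Z, ?_, ?_⟩
  · change G x x _ = _
    rw [hZ, map_add, e1, hGφ x x ⟨hxM x, hxM' x⟩, hGσ x x ⟨hxM x, hxM' x⟩, map_add, e3, D'.i_j]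
  · rw [map_add, e4, (D'.exact.exact x _).2 ⟨_, rfl⟩, add_zero]

/-! ### The trace of the square of the Higgs field -/

namespace HiggsBundle

variable {n : ℕ}

/-- On `V` the square is the rank one operator `v ↦ Q(φZ, v) φZ`, and on the trivial summand it is
the scalar `Q(φZ, φZ)`; each contributes `Q(φZ, φZ)` to the trace. -/
theorem trace_Φ_sq (H : HiggsBundle X n) (x : X) (Z : (tangent X).E x) :
    LinearMap.trace ℂ (H.E x × ℂ) (H.Φ x Z ∘ₗ H.Φ x Z) =
      2 * H.Q x (H.φ.toFun x Z) (H.φ.toFun x Z) := by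
  have := H.toHolBundle.finiteDimensional_fiber x
  let q : H.E x →ₗ[ℂ] ℂ := (H.Q x (H.φ.toFun x Z)).toLinearMap
  have h1 : H.Φ x Z ∘ₗ H.Φ x Z = LinearMap.prodMap (q.smulRight (H.φ.toFun x Z))
      (H.Q x (H.φ.toFun x Z) (H.φ.toFun x Z) • LinearMap.id) := by
    refine LinearMap.ext fun u => Prod.ext ?_ ?_
    · change H.Q x u.1 (H.φ.toFun x Z) • H.φ.toFun x Z = H.Q x (H.φ.toFun x Z) u.1 • H.φ.toFun x Z
      rw [H.Q_symm]
    · change H.Q x (u.2 • H.φ.toFun x Z) (H.φ.toFun x Z) =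
        H.Q x (H.φ.toFun x Z) (H.φ.toFun x Z) * u.2
      rw [map_smul, smul_apply, smul_eq_mul, mul_comm]
  rw [h1, LinearMap.trace_prodMap', LinearMap.trace_smulRight, map_smul, LinearMap.trace_id]
  change H.Q x (H.φ.toFun x Z) (H.φ.toFun x Z) + _ = _
  simp
  ring

theorem φt_φ_apply (H : HiggsBundle X n) (x : X) (v : H.E x) :
    H.φt x v = 0 ↔ ∀ Z, H.Q x v (H.φ.toFun x Z) = 0 :=
  ⟨fun h Z => DFunLike.congr_fun (F := (tangent X).E x →L[ℂ] ℂ) h Z,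
    fun h => ContinuousLinearMap.ext (R₁ := ℂ) h⟩

/-- As the tangent space is a line, `Q(φZ, φZ') = 0` for all pairs once it holds for one generator
paired with itself. -/
theorem traceSqZero_iff (H : HiggsBundle X n) :
    H.TraceSqZero ↔ ∀ x Z, H.φt x (H.φ.toFun x Z) = 0 := by
  constructor
  · intro h x Z
    refine (H.φt_φ_apply x _).2 fun Z' => ?_
    obtain ⟨c, rfl⟩ := exists_smul_localField x x Z
    obtain ⟨c', rfl⟩ := exists_smul_localField x x Z'
    have h1 := h x (localField x x)
    rw [trace_Φ_sq, mul_eq_zero, or_iff_right two_ne_zero] at h1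
    rw [map_smul, map_smul, map_smul, smul_apply, map_smul, h1, smul_zero, smul_zero]
  · intro h x Z
    rw [trace_Φ_sq, (H.φt_φ_apply x _).1 (h x Z) Z, mul_zero]

end HiggsBundle

/-! ### Volume forms of orthogonal bundles -/

/-- Top-degree forms make up a line, and a family on which one of them does not vanish is a basis.
Volumes are compared below by a single value on an adapted frame. -/
theorem alternating_eq_of_apply_eq {E : Type*} [AddCommGroup E] [Module ℂ E]
    [FiniteDimensional ℂ E] {r : ℕ} (hr : Module.finrank ℂ E = r) {α β : E [⋀^Fin r]→ₗ[ℂ] ℂ}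
    {e : Fin r → E} (he : α e ≠ 0) (h : α e = β e) : α = β := by
  have hli : LinearIndependent ℂ e := by
    by_contra hcon
    exact he (α.map_linearDependent _ hcon)
  -- Building a basis from the independent family needs a nonempty index type, so rank `0` is
  -- treated apart.
  rcases Nat.eq_zero_or_pos r with rfl | hpos
  · ext v
    rw [Subsingleton.elim v e, h]
  have : Nonempty (Fin r) := ⟨⟨0, hpos⟩⟩
  let b := basisOfLinearIndependentOfCardEqFinrank hli (by simp [hr])
  have hb : (b : Fin r → E) = e := coe_basisOfLinearIndependentOfCardEqFinrank _ _
  rw [AlternatingMap.eq_smul_basis_det b α, AlternatingMap.eq_smul_basis_det b β, hb, h]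

/-! ### Maps induced on the quotients -/

section Induced

/-- A bundle map matching the flags of two extensions induces a map of the quotients. -/
theorem exists_induced_hom [FiniteDimensional ℂ F'] (D : Extension W φ N)
    (D' : Extension W' φ' N') (G : HolHom V V')
    (hφ : ∀ x Z, G.toFun x (φ.toFun x Z) = φ'.toFun x Z)
    (hN : ∀ x, ∀ v ∈ N x, G.toFun x v ∈ N' x) :
    ∃ k : HolHom W.toHolBundle W'.toHolBundle, ∀ x u u',
      G.toFun x (D.i.toFun x u) = D'.i.toFun x u' → k.toFun x (D.p.toFun x u) = D'.p.toFun x u' := by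
  choose U _ hU hxU s hs using fun x => exists_local_rightInverse isOpen_univ (mem_univ x)
    (fun z _ => D.p.regSecAt (ρ := .hol) z) (D.exact.surjective x)
  choose g hg using fun x => exists_clm_lift (j := D'.i) (C := W.toHolBundle) (B := V')
    D'.i_injective (z := x) ((G.toFun x).comp ((D.i.toFun x).comp (s x x)))
    (fun w => D'.exists_i (hN x _ (D.i_mem x _)))
  have key : ∀ x u u', G.toFun x (D.i.toFun x u) = D'.i.toFun x u' →
      D'.p.toFun x (g x (D.p.toFun x u)) = D'.p.toFun x u' := by
    intro x u u' h
    obtain ⟨Z, hZ⟩ := D.exists_of_p_eq (u := u) (v := s x x (D.p.toFun x u))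
      ((hs x x (hxU x)).2 _).symm
    -- Two lifts of the same vector of `W` differ by `φ Z`, which `G` sends to `φ' Z`; so the class
    -- in `W'` does not depend on the lift.
    have h1 : u' = g x (D.p.toFun x u) + D'.j.toFun x Z := by
      refine D'.i_injective x ?_
      rw [← h, hZ, map_add, map_add, hφ, D'.i_j, hg]
      rfl
    rw [h1, map_add, (D'.exact.exact x _).2 ⟨_, rfl⟩, add_zero]
  refine ⟨⟨fun x => (D'.p.toFun x).comp (g x), isHolSection_univ_iff.2 fun x =>
    RegSecAt.hom_of_apply fun w hw => ?_⟩, key⟩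
  choose u' hu' using fun z => D'.exists_i (hN z _ (D.i_mem z (s x z (w z))))
  have h1 : RegSecAt .hol D'.V₁ u' x := by
    refine RegSecAt.of_injective isOpen_univ (mem_univ x)
      (fun z _ => D'.i.regSecAt (ρ := .hol) z) (D'.i_injective x) ?_
    refine (G.apply (D.i.apply ((hs x x (hxU x)).1.hom_apply hw))).congr
      (.of_forall fun z => hu' z)
  refine (D'.p.apply h1).congr ?_
  filter_upwards [(hU x).mem_nhds (hxU x)] with z hz
  rw [← key z _ _ (hu' z).symm, (hs x z hz).2]
  rfl

/-- Splittings are transported: `G⁻¹ ∘ i' ∘ s' ∘ k` takes values in `N` and splits `p`. As `G`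
matches `φ` with `φ'`, the differences of these splittings are `a ∘ k`, for the cocycle `a` of the
`s'`. -/
theorem IsExtensionClass.of_induced [FiniteDimensional ℂ F] {G : ∀ x, V.E x ≃L[ℂ] V'.E x}
    (hGs : IsHolSection (V'.hom V) univ (fun x => ((G x).symm : V'.E x →L[ℂ] V.E x)))
    (hφ : ∀ x Z, G x (φ.toFun x Z) = φ'.toFun x Z)
    (hN : ∀ x v, G x v ∈ N' x → v ∈ N x) {k : HolHom W.toHolBundle W'.toHolBundle}
    (hkinj : ∀ x, Function.Injective (k.toFun x))
    (hk : ∀ x u u', G x (D.i.toFun x u) = D'.i.toFun x u' →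
      k.toFun x (D.p.toFun x u) = D'.p.toFun x u') {ξ' : ExtH1 W'}
    (hξ' : IsExtensionClass D'.j D'.p ξ') :
    IsExtensionClass D.j D.p (H1.precomp k ξ') := by
  obtain ⟨a, s', hs', hp', hc', rfl⟩ := hξ'
  have hN' : ∀ x (v : D'.V₁.E x), ∃ u, D.i.toFun x u = (G x).symm (D'.i.toFun x v) := fun x v =>
    D.exists_i (hN x _ (by rw [ContinuousLinearEquiv.apply_symm_apply]; exact D'.i_mem x v))
  choose s hs using fun x z => exists_clm_lift (j := D.i) (C := W.toHolBundle) (B := V)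
    D.i_injective (z := z)
    (((G z).symm : V'.E z →L[ℂ] V.E z).comp ((D'.i.toFun z).comp ((s' x z).comp (k.toFun z))))
    (fun w => hN' z _)
  refine ⟨a.precomp k, s, fun x => (isHolSection_iff (a.isOpen x)).2 fun z hz => ?_,
    fun x z hz w => ?_, fun x y z hx hy w => ?_, rfl⟩
  · refine regSecAt_hom_of_injective D.i_injective ?_
    refine ((isHolSection_univ_iff.1 hGs z).comp ((D'.i.regSecAt z).comp
      (((isHolSection_iff (a.isOpen x)).1 (hs' x) z hz).comp (k.regSecAt z)))).congr
      (.of_forall fun y => ?_)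
    ext w
    exact hs x y w
  · refine hkinj z ?_
    rw [hk z (s x z w) (s' x z (k.toFun z w)) (by rw [hs]; simp), hp' x z hz]
  · refine D.i_injective z ?_
    rw [D.i_j, map_sub, hs, hs]
    refine (G z).injective ?_
    rw [map_sub, hφ]
    simp only [ContinuousLinearMap.comp_apply, ContinuousLinearEquiv.coe_coe,
      ContinuousLinearEquiv.apply_symm_apply]
    rw [← map_sub, ← hc' x y z hx hy, D'.i_j]
    rfl

end Induced

/-! ### Higgs bundles and the triples they determine -/

section Determines

variable {H H' : HiggsBundle X (m + 2)}

theorem HiggsBundle.nullExtension {D : Extension W H.φ (fun x => LinearMap.ker (H.φt x))}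
    (hQ : ∀ x u v, W.Q x (D.p.toFun x u) (D.p.toFun x v) =
      H.Q x (D.i.toFun x u) (D.i.toFun x v)) : NullExtension H.Q D where
  hol := H.Q_hol
  symm := H.Q_symm
  nondeg := H.Q_nondeg
  perp := fun x v => H.φt_φ_apply x v
  isometric := hQ

theorem NullExtension.exists_dual {Q : ∀ x, V.E x →L[ℂ] V.E x →L[ℂ] ℂ} {D : Extension W φ N}
    (h : NullExtension Q D) (x : X) : ∃ v, Q x (φ.toFun x (localField x x)) v = 1 := by
  by_contra hcon
  refine localField_ne_zero x x (D.φ_injective x ((h.nondeg x _ fun w => ?_).trans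
    (map_zero _).symm))
  by_contra hw
  exact hcon ⟨(Q x (φ.toFun x (localField x x)) w)⁻¹ • w, by
    rw [map_smul, smul_eq_mul, inv_mul_cancel₀ hw]⟩

theorem Determines.traceSqZero {ξ : ExtH1 W} (h : Determines H W ξ) : H.TraceSqZero := by
  obtain ⟨D, hQ, -, -⟩ := h
  exact H.traceSqZero_iff.2 fun x Z => D.φ_mem x Z

theorem Determines.nowhereZero {ξ : ExtH1 W} (h : Determines H W ξ) : H.NowhereZero := by
  obtain ⟨D, -, -, -⟩ := h
  intro x h0
  refine localField_ne_zero x x (D.φ_injective x ?_)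
  rw [h0]
  rfl

/-- The bundle `ker φᵗ` is kept and only its projection is replaced, by `k ∘ p`. The splittings
become `s ∘ k⁻¹`, so the new class is the pullback of `ξ` by `k⁻¹`. -/
theorem Determines.congr {ξ : ExtH1 W} {ξ' : ExtH1 W'} (h : Determines H W ξ) (k : SOIso W W')
    (hk : ξ = pull k ξ') : Determines H W' ξ' := by
  obtain ⟨D, hQ, hvol, a, s, hs, hp, hc, rfl⟩ := h
  have hpk : ∀ x v, k.toEquiv x (D.p.toFun x v) = 0 ↔ D.p.toFun x v = 0 := fun x v =>
    (k.toEquiv x).map_eq_zero_iff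
  let D' : Extension W' H.φ (fun x => LinearMap.ker (H.φt x)) :=
    { V₁ := D.V₁
      i := D.i
      i_injective := D.i_injective
      i_range := D.i_range
      j := D.j
      p := ⟨fun x => (k.toEquiv x : W.E x →L[ℂ] W'.E x).comp (D.p.toFun x),
        isHolSection_comp k.hol D.p.hol⟩
      i_j := D.i_j
      exact := ⟨D.exact.injective, fun x v => (hpk x v).trans (D.exact.exact x v),
        fun x => (k.toEquiv x).surjective.comp (D.exact.surjective x)⟩ }
  refine ⟨D', fun x u v => (k.Q_eq x _ _).trans (hQ x u v), fun x Z u v => ?_,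
    a.precomp k.symm.toHom, fun x z => (s x z).comp ((k.toEquiv z).symm : W'.E z →L[ℂ] W.E z),
    fun x => isHolSection_comp (hs x) (k.hol_symm.mono (subset_univ _)), fun x z hz w => ?_,
    fun x y z hx hy w => hc x y z hx hy _, ?_⟩
  · rw [hvol]
    exact congrArg _ (k.vol_eq x _).symm
  · change k.toEquiv z (D.p.toFun z (s x z _)) = w
    rw [hp x z hz]
    exact (k.toEquiv z).apply_symm_apply w
  · rw [← pull_symm_pull k ξ', ← hk]
    rfl

/-- An isomorphism `g` matching the fields preserves the flag `im φ ⊂ φ^⊥`, so `g` and its inverse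
descend to mutually inverse maps of the quotients. Form and volume are compared on lifts, and the
class is transported by `IsExtensionClass.of_induced`. -/
theorem Determines.exists_soIso {ξ : ExtH1 W} {ξ' : ExtH1 W'} (h : Determines H W ξ)
    (h' : Determines H' W' ξ') (hH : H.Iso H') : ∃ k : SOIso W W', ξ = pull k ξ' := by
  obtain ⟨D, hQ, hvol, hξ⟩ := h
  obtain ⟨D', hQ', hvol', hξ'⟩ := h'
  obtain ⟨g, hg⟩ := hH
  have hn := H.nullExtension hQ
  have hn' := H'.nullExtension hQ'
  have hN : ∀ x v, v ∈ LinearMap.ker (H.φt x) ↔ g.toEquiv x v ∈ LinearMap.ker (H'.φt x) := by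
    intro x v
    rw [hn.perp, hn'.perp]
    exact forall_congr' fun Z => by rw [← hg, g.Q_eq]
  obtain ⟨k, hk⟩ := exists_induced_hom D D' g.toHom hg fun x v hv => (hN x v).1 hv
  obtain ⟨k', hk'⟩ := exists_induced_hom D' D g.symm.toHom
    (fun x Z => by
      change (g.toEquiv x).symm _ = _
      rw [← hg, ContinuousLinearEquiv.symm_apply_apply])
    (fun x v hv => (hN x _).2 (by
      change g.toEquiv x ((g.toEquiv x).symm v) ∈ _
      rwa [ContinuousLinearEquiv.apply_symm_apply]))
  have hex : ∀ x (w : W.E x), ∃ u u', D.p.toFun x u = w ∧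
      g.toEquiv x (D.i.toFun x u) = D'.i.toFun x u' := by
    intro x w
    obtain ⟨u, rfl⟩ := D.exact.surjective x w
    obtain ⟨u', hu'⟩ := D'.exists_i ((hN x _).1 (D.i_mem x u))
    exact ⟨u, u', rfl, hu'.symm⟩
  have hex' : ∀ x (w : W'.E x), ∃ u u', D'.p.toFun x u' = w ∧
      g.toEquiv x (D.i.toFun x u) = D'.i.toFun x u' := by
    intro x w
    obtain ⟨u', rfl⟩ := D'.exact.surjective x w
    obtain ⟨u, hu⟩ := D.exists_i ((hN x ((g.toEquiv x).symm (D'.i.toFun x u'))).2 (by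
      rw [ContinuousLinearEquiv.apply_symm_apply]; exact D'.i_mem x u'))
    exact ⟨u, u', rfl, by rw [hu, ContinuousLinearEquiv.apply_symm_apply]⟩
  have hsymm : ∀ {x u u'}, g.toEquiv x (D.i.toFun x u) = D'.i.toFun x u' →
      g.symm.toHom.toFun x (D'.i.toFun x u') = D.i.toFun x u := by
    intro x u u' h
    rw [← h]
    exact (g.toEquiv x).symm_apply_apply _
  have hkk' : ∀ x w, k'.toFun x (k.toFun x w) = w := by
    intro x w
    obtain ⟨u, u', rfl, h⟩ := hex x w
    rw [hk x u u' h, hk' x u' u (hsymm h)]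
  have hk'k : ∀ x w, k.toFun x (k'.toFun x w) = w := by
    intro x w
    obtain ⟨u, u', rfl, h⟩ := hex' x w
    rw [hk' x u' u (hsymm h), hk x u u' h]
  let K : SOIso W W' :=
    { toEquiv := fun x => ContinuousLinearEquiv.equivOfInverse (k.toFun x) (k'.toFun x)
        (hkk' x) (hk'k x)
      hol := k.hol
      hol_symm := k'.hol
      Q_eq := fun x v w => by
        obtain ⟨u, u', rfl, h⟩ := hex x v
        obtain ⟨t, t', rfl, ht⟩ := hex x w
        change W'.Q x (k.toFun x _) (k.toFun x _) = _
        rw [hk x u u' h, hk x t t' ht, hQ, hQ', ← h, ← ht]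
        exact g.Q_eq x _ _
      vol_eq := fun x e => by
        choose u u' hu h using fun i => hex x (e i)
        -- With `Q(φZ, v) = 1`, the volume rule expresses the volumes of `W` and `W'` through those
        -- of `V` and `V'` on frames matched by `g`.
        obtain ⟨v, hv⟩ := hn.exists_dual x
        have e1 := hvol x (localField x x) u v
        have e2 := hvol' x (localField x x) u' (g.toEquiv x v)
        rw [← hg, g.Q_eq, hv] at e2
        rw [hv] at e1
        have e3 : (Fin.cons (g.toEquiv x (H.φ.toFun x (localField x x)))
            (Fin.snoc (fun k => D'.i.toFun x (u' k)) (g.toEquiv x v) :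
              Fin (m + 1) → H'.E x) : Fin (m + 2) → H'.E x) =
            fun k => g.toEquiv x ((Fin.cons (H.φ.toFun x (localField x x))
              (Fin.snoc (fun k => D.i.toFun x (u k)) v : Fin (m + 1) → H.E x) :
                Fin (m + 2) → H.E x) k) := by
          funext k
          refine Fin.cases ?_ (fun k => ?_) k
          · simp
          · refine Fin.lastCases ?_ (fun k => ?_) k
            · simp
            · simp [h]
        rw [e3, g.vol_eq, e1] at e2
        have e4 : (fun i => D.p.toFun x (u i)) = e := funext hu
        have e5 : (fun i => D'.p.toFun x (u' i)) = fun i => k.toFun x (e i) :=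
          funext fun i => by rw [← hk x (u i) (u' i) (h i), hu]
        rw [e4, e5] at e2
        exact (mul_left_cancel₀ (by simp) e2).symm }
  refine ⟨K, hξ.unique D.exact ?_⟩
  exact IsExtensionClass.of_induced (D := D) (D' := D') (G := g.toEquiv) (k := K.toHom) g.hol_symm
    hg (fun x v hv => (hN x v).2 hv) (fun x => (K.toEquiv x).injective) hk hξ'

/-- `NullExtension.exists_isometry` with the identity of `W` gives an isometry matching the fields.
It preserves volumes automatically: on one adapted frame both sides equal `√-1` times the same
volume of `W`. -/
theorem Determines.higgsIso {ξ : ExtH1 W} (h : Determines H W ξ) (h' : Determines H' W ξ) :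
    H.Iso H' := by
  obtain ⟨D, hQ, hvol, hξ⟩ := h
  obtain ⟨D', hQ', hvol', hξ'⟩ := h'
  have hn := H.nullExtension hQ
  have hn' := H'.nullExtension hQ'
  obtain ⟨G, hG, hGs, hGQ, hGφ, hGp⟩ := hn.exists_isometry hn' (SOIso.refl W) hξ hξ'
    (pull_refl ξ).symm
  refine ⟨⟨G, hG, hGs, hGQ, fun x e => ?_⟩, hGφ⟩
  have := H.toHolBundle.finiteDimensional_fiber x
  obtain ⟨w, hw⟩ := W.exists_vol_ne_zero x
  choose u hu using fun i => D.exact.surjective x (w i)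
  choose u' hu' hpu' using fun i => hGp x (u i)
  obtain ⟨v, hv⟩ := hn.exists_dual x
  have e1 := hvol x (localField x x) u v
  have e2 := hvol' x (localField x x) u' (G x v)
  rw [← hGφ, hGQ, hv] at e2
  rw [hv] at e1
  have e3 : (Fin.cons (G x (H.φ.toFun x (localField x x)))
      (Fin.snoc (fun k => D'.i.toFun x (u' k)) (G x v) :
        Fin (m + 1) → H'.E x) : Fin (m + 2) → H'.E x) =
      fun k => G x ((Fin.cons (H.φ.toFun x (localField x x))
        (Fin.snoc (fun k => D.i.toFun x (u k)) v : Fin (m + 1) → H.E x) :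
          Fin (m + 2) → H.E x) k) := by
    funext k
    refine Fin.cases ?_ (fun k => ?_) k
    · simp
    · refine Fin.lastCases ?_ (fun k => ?_) k
      · simp
      · simp [hu']
  have e4 : (fun i => D.p.toFun x (u i)) = w := funext hu
  have e5 : (fun i => D'.p.toFun x (u' i)) = w :=
    funext fun i => (hpu' i).trans (hu i)
  rw [e4] at e1
  rw [e5, e3] at e2
  have key : H.vol x = (H'.vol x).compLinearMap (G x : H.E x →L[ℂ] H'.E x).toLinearMap := by
    refine alternating_eq_of_apply_eq (H.finrank_fiber x) ?_ (e1.trans e2.symm)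
    rw [e1]
    exact mul_ne_zero (by simp) hw
  exact (DFunLike.congr_fun key e).symm

end Determines

/-! ### The orthogonal complement of a null line -/

/-- The complement of a holomorphic null line is a holomorphic bundle containing the line. -/
theorem exists_perp_bundle {V : HolBundle X (Fin (m + 2) → ℂ)} {φ : HolHom (tangent X) V}
    {Q : ∀ x, V.E x →L[ℂ] V.E x →L[ℂ] ℂ}
    (hQ : IsHolSection (V.hom (V.hom (trivialLine X))) univ Q)
    {v₀ : ∀ x, V.E x} (hv₀ : ∀ x, Q x (v₀ x) (φ.toFun x (localField x x)) = 1)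
    (hφ : ∀ x Z Z', Q x (φ.toFun x Z) (φ.toFun x Z') = 0) {N : ∀ x, Submodule ℂ (V.E x)}
    (hN : ∀ x v, v ∈ N x ↔ ∀ Z, Q x v (φ.toFun x Z) = 0) :
    ∃ (V₁ : HolBundle X (Fin (m + 1) → ℂ)) (i : HolHom V₁ V) (j : HolHom (tangent X) V₁),
      (∀ x, Function.Injective (i.toFun x)) ∧
      (∀ x, LinearMap.range (i.toFun x : V₁.E x →ₗ[ℂ] V.E x) = N x) ∧
      (∀ x Z, i.toFun x (j.toFun x Z) = φ.toFun x Z) ∧ ∀ x, Function.Injective (j.toFun x) := by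
  let T : ∀ x, V.E x →ₗ[ℂ] (canonical X).E x := fun x =>
    { toFun := fun v => (Q x v).comp (φ.toFun x)
      map_add' := fun v w => by rw [map_add]; rfl
      map_smul' := fun c v => by rw [map_smul]; rfl }
  let f : HolHom V (canonical X) :=
    { toFun := fun x => V.clm (T x)
      hol := isHolSection_univ_iff.2 fun x => RegSecAt.hom_of_apply fun s hs =>
        ((isHolSection_hom_apply hQ hs).comp (φ.regSecAt x)).congr (.of_forall fun z => by
          rw [HolBundle.clm_apply]; rfl) }
  have hf : ∀ x v, f.toFun x v = T x v := fun x v => HolBundle.clm_apply _ _ _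
  -- `K` is a line and `v₀` maps to a covector with value `1` on the local field, hence to a
  -- generator.
  have hsurj : ∀ x, Function.Surjective (f.toFun x) := by
    intro x η
    refine ⟨(show (tangent X).E x →L[ℂ] ℂ from η) (localField x x) • v₀ x, ?_⟩
    rw [hf]
    refine ContinuousLinearMap.ext (R₁ := ℂ) fun Z => ?_
    obtain ⟨c, rfl⟩ := exists_smul_localField x x Z
    change Q x (_ • v₀ x) (φ.toFun x (c • localField x x)) = _
    rw [map_smul, smul_apply, map_smul, map_smul, hv₀, map_smul, smul_eq_mul, smul_eq_mul,
      mul_one, smul_eq_mul, mul_comm]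
  obtain ⟨V₁, i, hi, hr⟩ := exists_kernel_bundle hsurj (r := m + 1) (by
    rw [finrank_clm_dual, Module.finrank_fin_fun, Module.finrank_self])
  have hker : ∀ x v, v ∈ LinearMap.ker (f.toFun x : V.E x →ₗ[ℂ] (canonical X).E x) ↔ v ∈ N x := by
    intro x v
    rw [hN]
    change f.toFun x v = 0 ↔ _
    rw [hf]
    exact ⟨fun h Z => DFunLike.congr_fun (F := (tangent X).E x →L[ℂ] ℂ) h Z,
      fun h => ContinuousLinearMap.ext (R₁ := ℂ) h⟩
  have hr' : ∀ x, LinearMap.range (i.toFun x : V₁.E x →ₗ[ℂ] V.E x) = N x := fun x => by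
    rw [hr]
    exact Submodule.ext (hker x)
  choose j hj using fun x => exists_clm_lift (j := i) (C := tangent X) hi (φ.toFun x) (fun Z => by
    change φ.toFun x Z ∈ LinearMap.range (i.toFun x : V₁.E x →ₗ[ℂ] V.E x)
    rw [hr', hN]
    exact hφ x Z)
  refine ⟨V₁, i, ⟨j, isHolSection_univ_iff.2 fun x => regSecAt_hom_of_injective hi
    ((φ.regSecAt x).congr (.of_forall fun z => ?_))⟩, hi, hr', hj, fun x => ?_⟩
  · exact ContinuousLinearMap.ext fun Z => hj z Z
  · rw [injective_iff_map_eq_zero]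
    intro Z hZ
    obtain ⟨c, rfl⟩ := exists_smul_localField x x Z
    change j x _ = 0 at hZ
    have h1 := hv₀ x
    have h2 := hj x (c • localField x x)
    rw [hZ, map_zero, map_smul] at h2
    have h3 := congrArg (Q x (v₀ x)) h2
    rw [map_zero, map_smul, h1, smul_eq_mul, mul_one] at h3
    rw [← h3, zero_smul]

/-- Every Higgs bundle with `tr Φ² = 0` and `φ` without zeroes determines a triple. -/
theorem HiggsBundle.exists_determines {H : HiggsBundle X (m + 2)} (h1 : H.TraceSqZero)
    (h2 : H.NowhereZero) : ∃ (W : SOBundle X m) (ξ : ExtH1 W), Determines H W ξ := by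
  have hnull : ∀ x Z Z', H.Q x (H.φ.toFun x Z) (H.φ.toFun x Z') = 0 := fun x Z =>
    (H.φt_φ_apply x _).1 (H.traceSqZero_iff.1 h1 x Z)
  let e : ∀ y x, H.E x := fun y x => H.φ.toFun x (localField y x)
  have he : ∀ y x, e y x ≠ 0 := by
    intro y x h
    refine h2 x (ContinuousLinearMap.ext fun Z => ?_)
    obtain ⟨c, rfl⟩ := exists_smul_localField y x Z
    rw [map_smul]
    change c • e y x = 0
    rw [h, smul_zero]
  have hdual : ∀ x, ∃ v, H.Q x v (e x x) = 1 := by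
    intro x
    by_contra hcon
    refine he x x (H.Q_nondeg x _ fun w => ?_)
    by_contra hw
    exact hcon ⟨(H.Q x (e x x) w)⁻¹ • w, by
      rw [H.Q_symm, map_smul, smul_eq_mul, inv_mul_cancel₀ hw]⟩
  choose v₀ hv₀ using hdual
  have hv₀' : ∀ x, H.Q x (e x x) (v₀ x) = 1 := fun x => (H.Q_symm x _ _).trans (hv₀ x)
  obtain ⟨V₁, i, j, hi, hr, hij, hj⟩ := exists_perp_bundle H.Q_hol hv₀ hnull
    (N := fun x => LinearMap.ker (H.φt x)) (fun x v => H.φt_φ_apply x v)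
  have hiN : ∀ x u, i.toFun x u ∈ LinearMap.ker (H.φt x) := fun x u => by
    rw [← hr]
    exact ⟨u, rfl⟩
  have hNi : ∀ x v, v ∈ LinearMap.ker (H.φt x) → ∃ u, i.toFun x u = v := fun x v hv => by
    rw [← hr] at hv
    exact hv
  have hiφ : ∀ x u Z, H.Q x (i.toFun x u) (H.φ.toFun x Z) = 0 := fun x u =>
    (H.φt_φ_apply x _).1 (hiN x u)
  obtain ⟨B, p, hex⟩ := exists_cokernel_bundle hj (r := m) (by
    rw [Module.finrank_fin_fun, Module.finrank_self])
  choose U _ hU hxU r hr' using fun x => exists_local_rightInverse isOpen_univ (mem_univ x)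
    (fun z _ => p.regSecAt (ρ := .hol) z) (hex.surjective x)
  have hpr : ∀ x w, p.toFun x (r x x w) = w := fun x => (hr' x x (hxU x)).2
  have hpeq : ∀ y x u v, p.toFun x u = p.toFun x v →
      ∃ a : ℂ, i.toFun x u = i.toFun x v + a • e y x := by
    intro y x u v huv
    obtain ⟨Z, hZ⟩ := (hex.exact x (u - v)).1 (by rw [map_sub, huv, sub_self])
    obtain ⟨c, rfl⟩ := exists_smul_localField y x Z
    refine ⟨c, ?_⟩
    change _ = _ + c • H.φ.toFun x _
    rw [← map_smul, ← hij, hZ, map_sub, add_sub_cancel]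
  -- Lifts of the same class differ by multiples of `e`, which is orthogonal to all of `φ^⊥`; so the
  -- form descends to the quotient.
  have hQp : ∀ x u u' v v', p.toFun x u = p.toFun x u' → p.toFun x v = p.toFun x v' →
      H.Q x (i.toFun x u) (i.toFun x v) = H.Q x (i.toFun x u') (i.toFun x v') := by
    intro x u u' v v' hu hv
    obtain ⟨a, ha⟩ := hpeq x x u u' hu
    obtain ⟨b, hb⟩ := hpeq x x v v' hv
    have e1 : ∀ u, H.Q x (i.toFun x u) (e x x) = 0 := fun u => hiφ x u _
    have e2 : ∀ u, H.Q x (e x x) (i.toFun x u) = 0 := fun u => (H.Q_symm x _ _).trans (e1 u)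
    have e3 : H.Q x (e x x) (e x x) = 0 := hnull x _ _
    rw [ha, hb]
    simp only [map_add, map_smul, add_apply, smul_apply, smul_eq_mul, e1, e2, e3, mul_zero,
      add_zero]
  let ir : ∀ x, B.E x →L[ℂ] H.E x := fun x => (i.toFun x).comp (r x x)
  let q : ∀ x, B.E x →L[ℂ] B.E x →L[ℂ] ℂ := fun x => B.clm
    { toFun := fun w => (H.Q x (ir x w)).comp (ir x)
      map_add' := fun v w => by rw [map_add, map_add]; rfl
      map_smul' := fun c v => by rw [map_smul, map_smul]; rfl }
  have hq0 : ∀ x w w', q x w w' = H.Q x (ir x w) (ir x w') := fun x w w' =>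
    DFunLike.congr_fun (F := B.E x →L[ℂ] ℂ) (HolBundle.clm_apply B _ w) w'
  have hq : ∀ x u v, q x (p.toFun x u) (p.toFun x v) = H.Q x (i.toFun x u) (i.toFun x v) := by
    intro x u v
    rw [hq0]
    exact hQp x _ _ _ _ (hpr x _) (hpr x _)
  have hdecomp : ∀ x v, ∃ (α : ℂ) (w : B.E x), v = α • e x x + ir x w +
      H.Q x v (e x x) • v₀ x := by
    intro x v
    obtain ⟨u, hu⟩ := hNi x (v - H.Q x v (e x x) • v₀ x) ((H.φt_φ_apply x _).2 fun Z => by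
      obtain ⟨c, rfl⟩ := exists_smul_localField x x Z
      rw [map_smul, map_smul]
      change c • H.Q x _ (e x x) = 0
      rw [map_sub, map_smul, sub_apply, smul_apply, hv₀, smul_eq_mul, smul_eq_mul, mul_one,
        sub_self, mul_zero])
    obtain ⟨a, ha⟩ := hpeq x x u (r x x (p.toFun x u)) (hpr x _).symm
    refine ⟨a, p.toFun x u, ?_⟩
    rw [← sub_eq_iff_eq_add, ← hu, ha]
    exact add_comm _ _
  have hfr : ∀ x, Module.finrank ℂ (B.E x) = m := fun x =>
    (B.finrank_fiber x).trans (Module.finrank_fin_fun ℂ)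
  -- The factor `-√-1` inverts the `√-1` of the volume rule, `v₀` being normalised by `Q(e, v₀) =
  -- 1`. Its square `-1` cancels the sign of the Gram determinant in `gram_det_cons_snoc`, which
  -- gives `vol_sq`.
  let vol : ∀ x, B.E x [⋀^Fin m]→ₗ[ℂ] ℂ := fun x =>
    (-Complex.I) • (consSnoc (H.vol x) (e x x) (v₀ x)).compLinearMap (ir x).toLinearMap
  have hvol0 : ∀ x w, vol x w =
      -Complex.I * consSnoc (H.vol x) (e x x) (v₀ x) (fun k => ir x (w k)) := fun _ _ => rfl
  -- `vol` was defined from choices `r x x` and `v₀ x` made separately at each point. This formula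
  -- computes it from arbitrary lifts `u` and arbitrary `v`, in particular from holomorphic ones.
  have hvol : ∀ x Z (u : Fin m → V₁.E x) v,
      consSnoc (H.vol x) (H.φ.toFun x Z) v (fun k => i.toFun x (u k)) =
        Complex.I * H.Q x (H.φ.toFun x Z) v * vol x (fun k => p.toFun x (u k)) := by
    intro x Z u v
    obtain ⟨c, rfl⟩ := exists_smul_localField x x Z
    obtain ⟨α, w', hw'⟩ := hdecomp x v
    choose a ha using fun k => hpeq x x (u k) (r x x (p.toFun x (u k))) (hpr x _).symm
    have := B.finiteDimensional_fiber x
    have e1 := volume_adapted (hfr x) (H.vol x) (e x x) (v₀ x) (ir x).toLinearMap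
      (fun k => p.toFun x (u k)) w' a c α (H.Q x v (e x x))
    have e2 : H.Q x (H.φ.toFun x (c • localField x x)) v = c * H.Q x v (e x x) := by
      rw [map_smul, map_smul, smul_apply, smul_eq_mul, H.Q_symm]
    rw [hvol0, e2]
    have e3 : (fun k => i.toFun x (u k)) =
        fun k => (ir x).toLinearMap (p.toFun x (u k)) + a k • e x x := funext ha
    rw [e3]
    conv_lhs => rw [hw', map_smul]
    refine e1.trans ?_
    have e4 : Complex.I * -Complex.I = 1 := by simp
    change c * _ * consSnoc (H.vol x) (e x x) (v₀ x) (fun k => ir x (p.toFun x (u k))) = _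
    linear_combination (-(c * H.Q x v (e x x) *
      consSnoc (H.vol x) (e x x) (v₀ x) (fun k => ir x (p.toFun x (u k))))) * e4
  let W : SOBundle X m :=
    { toHolBundle := B
      Q := q
      Q_hol := isHolSection_univ_iff.2 fun x => regSecAt_pairing_of_apply fun s t hs ht => by
        have hr1 := (hr' x x (hxU x)).1
        refine (regAt_pairing (isHolSection_univ_iff.1 H.Q_hol x)
          (i.apply (hr1.hom_apply hs)) (i.apply (hr1.hom_apply ht))).congr ?_
        filter_upwards [(hU x).mem_nhds (hxU x)] with z hz
        rw [← hq, (hr' x z hz).2, (hr' x z hz).2]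
      Q_symm := fun x v w => by rw [hq0, hq0, H.Q_symm]
      Q_nondeg := fun x w hw => by
        have e0 : H.Q x (e x x) (e x x) = 0 := hnull x _ _
        have e1 : ∀ w, H.Q x (ir x w) (e x x) = 0 := fun w => hiφ x _ _
        -- If `w` is in the radical, this combination is orthogonal to `e`, to the lift of `W` and
        -- to `v₀`, which together span the fibre. So the lift of `w` is a multiple of `e`, and `w =
        -- 0`.
        have key : ir x w - H.Q x (ir x w) (v₀ x) • e x x = 0 := by
          refine H.Q_nondeg x _ fun v => ?_
          obtain ⟨α, w', hw'⟩ := hdecomp x v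
          rw [hw']
          have e2 : H.Q x (ir x w) (ir x w') = 0 := (hq0 x w w').symm.trans (hw w')
          simp only [map_add, map_sub, map_smul, sub_apply, smul_apply, smul_eq_mul, e0, e1, e2,
            hv₀', (H.Q_symm x (e x x) (ir x w')).trans (e1 w')]
          ring
        rw [sub_eq_zero] at key
        obtain ⟨c, hc⟩ : ∃ c : ℂ, ir x w = c • e x x := ⟨_, key⟩
        have e3 : r x x w = j.toFun x (c • localField x x) := hi x (by
          rw [hij, map_smul]
          exact hc)
        rw [← hpr x w, e3]
        exact (hex.exact x _).2 ⟨_, rfl⟩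
      vol := vol
      vol_hol := fun O hO s hs => (isHolSection_iff hO).2 fun x hx => by
        -- Near `x` the pointwise choice `v₀` is replaced by a holomorphic `v` through `v₀ x`. The
        -- pairing `c = Q(e, v)` is `1` at `x`, hence invertible nearby, and `hvol` recovers `vol`
        -- after division by `√-1 c`.
        let v : ∀ z, H.E z := fun z => (H.coord x z).symm (H.coord x x (v₀ x))
        let c : X → ℂ := fun z => H.Q z (e x z) (v z)
        let O' : Set X := O ∩ (U x ∩ ((tangent X).dom x ∩ H.dom x))
        have hO' : IsOpen O' := hO.inter ((hU x).inter
          (((tangent X).isOpen_dom x).inter (H.isOpen_dom x)))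
        have hxO' : x ∈ O' := ⟨hx, hxU x, (tangent X).mem_dom x, H.mem_dom x⟩
        have he' : ∀ z ∈ O', RegSecAt .hol H.toHolBundle (e x) z := fun z hz =>
          H.φ.apply (regSecAt_localField hz.2.2.1)
        have hv' : ∀ z ∈ O', RegSecAt .hol H.toHolBundle v z := fun z hz =>
          RegSecAt.coord_symm hz.2.2.2 (RegAt.const _)
        have hs' : ∀ k, ∀ z ∈ O', RegSecAt .hol H.toHolBundle
            (fun z => i.toFun z (r x z (s k z))) z := fun k z hz =>
          i.apply ((hr' x z hz.2.1).1.hom_apply ((isHolSection_iff hO).1 (hs k) z hz.1))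
        have hV := H.vol_hol O' hO' (fun k z => (Fin.cons (e x z)
          (Fin.snoc (fun k => i.toFun z (r x z (s k z))) (v z) : Fin (m + 1) → H.E z) :
            Fin (m + 2) → H.E z) k) (fun k => (isHolSection_iff hO').2 fun z hz => by
              refine Fin.cases ?_ (fun k => ?_) k
              · simpa using he' z hz
              · refine Fin.lastCases ?_ (fun k => ?_) k
                · simpa using hv' z hz
                · simpa using hs' k z hz)
        have hV' := regSecAt_trivialLine_iff.1 ((isHolSection_iff hO').1 hV x hxO')
        have hc : RegAt .hol c x := regAt_pairing (isHolSection_univ_iff.1 H.Q_hol x)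
          (he' x hxO') (hv' x hxO')
        have hcx : c x ≠ 0 := by
          simp only [c, v, ContinuousLinearEquiv.symm_apply_apply]
          rw [hv₀']
          exact one_ne_zero
        refine regSecAt_trivialLine_iff.2 ((((RegAt.const (-Complex.I)).mul
          (hc.inv hcx)).mul hV').congr ?_)
        filter_upwards [hO'.mem_nhds hxO', hc.continuousAt.eventually_ne hcx] with z hz hcz
        have e1 := hvol z (localField x z) (fun k => r x z (s k z)) (v z)
        have e2 : (fun k => p.toFun z (r x z (s k z))) = fun k => s k z :=
          funext fun k => (hr' x z hz.2.1).2 _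
        rw [e2] at e1
        have e3 : -Complex.I * Complex.I = 1 := by simp
        change _ = -Complex.I * (c z)⁻¹ * consSnoc (H.vol z) (H.φ.toFun z (localField x z)) (v z)
          (fun k => i.toFun z (r x z (s k z)))
        rw [e1]
        change _ = -Complex.I * (c z)⁻¹ * (Complex.I * c z * _)
        have e4 := inv_mul_cancel₀ hcz
        linear_combination (-(vol z fun k => s k z)) * e3 -
          (-Complex.I * Complex.I * (vol z fun k => s k z)) * e4
      vol_sq := fun x w => by
        have e1 := H.vol_sq x (Fin.cons (e x x)
          (Fin.snoc (fun k => ir x (w k)) (v₀ x) : Fin (m + 1) → H.E x))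
        have e2 := gram_det_cons_snoc (bilinearOf (H.Q x)) (H.Q_symm x) (e := e x x) (f := v₀ x)
          (u := fun k => ir x (w k)) (hnull x _ _)
          (fun k => (H.Q_symm x _ _).trans (hiφ x _ _)) (hv₀' x)
        have e3 := e1.trans e2
        have e4 : (Matrix.of fun k l => q x (w k) (w l)) =
            Matrix.of fun k l => bilinearOf (H.Q x) (ir x (w k)) (ir x (w l)) := by
          ext k l
          exact hq0 x _ _
        rw [hvol0, mul_pow, consSnoc_apply, e3, e4, neg_sq, Complex.I_sq]
        ring }
  let D : Extension W H.φ (fun x => LinearMap.ker (H.φt x)) :=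
    ⟨V₁, i, hi, hr, j, p, hij, hex⟩
  obtain ⟨ξ, hξ⟩ := hex.exists_isExtensionClass
  exact ⟨W, ξ, D, hq, hvol, hξ⟩

/-! ### Unipotent isometries of `K⁻¹ ⊕ W ⊕ K` -/

section Unipotent

variable {x : X}

/-- The adjoint `K → W` of a map `W → K⁻¹`. -/
noncomputable def adjoint (W : SOBundle X m) (β : W.E x →L[ℂ] (tangent X).E x)
    (η : (tangent X).E x →L[ℂ] ℂ) : W.E x :=
  W.sharp x (η.comp β)

theorem Q_adjoint (β : W.E x →L[ℂ] (tangent X).E x) (η : (tangent X).E x →L[ℂ] ℂ) (w : W.E x) :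
    W.Q x (adjoint W β η) w = η (β w) :=
  W.Q_sharp x _ w

theorem Q_adjoint' (β : W.E x →L[ℂ] (tangent X).E x) (η : (tangent X).E x →L[ℂ] ℂ) (w : W.E x) :
    W.Q x w (adjoint W β η) = η (β w) :=
  W.Q_sharp' x _ w

theorem adjoint_add (β : W.E x →L[ℂ] (tangent X).E x) (η η' : (tangent X).E x →L[ℂ] ℂ) :
    adjoint W β (η + η') = adjoint W β η + adjoint W β η' :=
  W.ext_Q fun u => by simp only [map_add, add_apply, Q_adjoint]

theorem adjoint_smul (β : W.E x →L[ℂ] (tangent X).E x) (c : ℂ) (η : (tangent X).E x →L[ℂ] ℂ) :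
    adjoint W β (c • η) = c • adjoint W β η :=
  W.ext_Q fun u => by simp only [map_smul, smul_apply, Q_adjoint]

theorem add_adjoint (β β' : W.E x →L[ℂ] (tangent X).E x) (η : (tangent X).E x →L[ℂ] ℂ) :
    adjoint W (β + β') η = adjoint W β η + adjoint W β' η :=
  W.ext_Q fun u => by simp only [map_add, add_apply, Q_adjoint]

/-- After applying `η` both sides become `Q_W` of the two adjoints of `η`, which is symmetric. A
nonzero `η` is injective on the line `K⁻¹`, and for `η = 0` both sides vanish. This is where `Λ² K⁻¹
= 0` is used. -/
theorem apply_adjoint_comm (β β' : W.E x →L[ℂ] (tangent X).E x) (η : (tangent X).E x →L[ℂ] ℂ) :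
    β (adjoint W β' η) = β' (adjoint W β η) := by
  have h : η (β (adjoint W β' η)) = η (β' (adjoint W β η)) := by
    rw [← Q_adjoint, ← Q_adjoint, W.Q_symm]
  obtain ⟨c, hc⟩ := exists_smul_localField x x (β (adjoint W β' η))
  obtain ⟨c', hc'⟩ := exists_smul_localField x x (β' (adjoint W β η))
  rw [← hc, ← hc', map_smul, map_smul, smul_eq_mul, smul_eq_mul] at h
  by_cases h0 : η (localField x x) = 0
  · have h1 : η = 0 := ContinuousLinearMap.ext fun Z => by
      obtain ⟨c, rfl⟩ := exists_smul_localField x x Z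
      rw [map_smul, h0, smul_zero]
      rfl
    have h2 : ∀ β : W.E x →L[ℂ] (tangent X).E x, adjoint W β η = 0 := fun β =>
      W.ext_Q fun u => by
        rw [Q_adjoint, h1, map_zero]
        rfl
    rw [h2, h2, map_zero, map_zero]
  · rw [← hc, ← hc', mul_right_cancel₀ h0 h]

/-- The unipotent isometry of `K⁻¹ ⊕ W ⊕ K` defined by a map `β : W → K⁻¹`. -/
noncomputable def unipotent (W : SOBundle X m) (β : W.E x →L[ℂ] (tangent X).E x) :
    (model W).E x →ₗ[ℂ] (model W).E x where
  toFun := fun t => model.mk W (t.1 + β t.2.1 - (1 / 2 : ℂ) • β (adjoint W β t.2.2))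
    (t.2.1 - adjoint W β t.2.2) t.2.2
  map_add' := fun t t' => by
    refine Prod.ext ?_ (Prod.ext ?_ rfl)
    · change t.1 + t'.1 + β (t.2.1 + t'.2.1) - (1 / 2 : ℂ) • β (adjoint W β (t.2.2 + t'.2.2)) =
        (t.1 + β t.2.1 - (1 / 2 : ℂ) • β (adjoint W β t.2.2)) +
          (t'.1 + β t'.2.1 - (1 / 2 : ℂ) • β (adjoint W β t'.2.2))
      rw [adjoint_add, map_add, map_add, smul_add]
      abel
    · change t.2.1 + t'.2.1 - adjoint W β (t.2.2 + t'.2.2) =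
        (t.2.1 - adjoint W β t.2.2) + (t'.2.1 - adjoint W β t'.2.2)
      rw [adjoint_add]
      abel
  map_smul' := fun c t => by
    refine Prod.ext ?_ (Prod.ext ?_ rfl)
    · change c • t.1 + β (c • t.2.1) - (1 / 2 : ℂ) • β (adjoint W β (c • t.2.2)) =
        c • (t.1 + β t.2.1 - (1 / 2 : ℂ) • β (adjoint W β t.2.2))
      rw [adjoint_smul, map_smul, map_smul, smul_sub, smul_add, smul_comm c]
    · change c • t.2.1 - adjoint W β (c • t.2.2) = c • (t.2.1 - adjoint W β t.2.2)
      rw [adjoint_smul, smul_sub]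

theorem unipotent_mk (β : W.E x →L[ℂ] (tangent X).E x) (Z : (tangent X).E x) (w : W.E x)
    (η : (canonical X).E x) :
    unipotent W β (model.mk W Z w η) =
      model.mk W (Z + β w - (1 / 2 : ℂ) • β (adjoint W β η)) (w - adjoint W β η) η :=
  rfl

theorem unipotent_mk_zero (β : W.E x →L[ℂ] (tangent X).E x) (Z : (tangent X).E x) (w : W.E x) :
    unipotent W β (model.mk W Z w 0) = model.mk W (Z + β w) w 0 := by
  have h : adjoint W β 0 = 0 := W.ext_Q fun u => by
    rw [Q_adjoint, map_zero]
    rfl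
  rw [unipotent_mk]
  change model.mk W (Z + β w - (1 / 2 : ℂ) • β (adjoint W β 0)) (w - adjoint W β 0) 0 = _
  rw [h, map_zero, smul_zero, sub_zero, sub_zero]

/-- `unipotent W β` is the exponential `1 + N + N²/2` of the skew map `N (Z, w, η) = (β w, -β* η,
0)`. The cross terms `β β'*` and `β' β*` agree by `apply_adjoint_comm`, so these exponentials
multiply additively. Hence an additive cocycle yields a multiplicative one. -/
theorem unipotent_comp (β β' : W.E x →L[ℂ] (tangent X).E x) (t : (model W).E x) :
    unipotent W β (unipotent W β' t) = unipotent W (β + β') t := by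
  refine Prod.ext ?_ (Prod.ext ?_ rfl)
  · change (t.1 + β' t.2.1 - (1 / 2 : ℂ) • β' (adjoint W β' t.2.2)) +
      β (t.2.1 - adjoint W β' t.2.2) - (1 / 2 : ℂ) • β (adjoint W β t.2.2) =
        t.1 + (β + β') t.2.1 - (1 / 2 : ℂ) • (β + β') (adjoint W (β + β') t.2.2)
    rw [add_adjoint, map_sub, add_apply, add_apply, map_add, map_add,
      apply_adjoint_comm β' β]
    module
  · change t.2.1 - adjoint W β' t.2.2 - adjoint W β t.2.2 = t.2.1 - adjoint W (β + β') t.2.2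
    rw [add_adjoint]
    abel

theorem unipotent_zero (t : (model W).E x) : unipotent W 0 t = t := by
  have h : ∀ η, adjoint W (x := x) 0 η = 0 := fun η => W.ext_Q fun u => by
    rw [Q_adjoint, map_zero]
    exact map_zero η
  refine Prod.ext ?_ (Prod.ext ?_ rfl)
  · change t.1 + 0 - (1 / 2 : ℂ) • 0 = t.1
    rw [smul_zero, add_zero, sub_zero]
  · change t.2.1 - adjoint W 0 t.2.2 = t.2.1
    rw [h, sub_zero]

theorem unipotent_neg_apply (β : W.E x →L[ℂ] (tangent X).E x) (t : (model W).E x) :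
    unipotent W (-β) (unipotent W β t) = t := by
  rw [unipotent_comp, neg_add_cancel, unipotent_zero]

theorem unipotent_apply_neg (β : W.E x →L[ℂ] (tangent X).E x) (t : (model W).E x) :
    unipotent W β (unipotent W (-β) t) = t := by
  rw [unipotent_comp, add_neg_cancel, unipotent_zero]

/-- The terms linear in `β` cancel by adjointness, and the two halves `-(1/2) β β*` cancel the
pairing `Q_W` of the two adjoint vectors. -/
theorem modelQ_unipotent (β : W.E x →L[ℂ] (tangent X).E x) (t t' : (model W).E x) :
    modelQ W x (unipotent W β t) (unipotent W β t') = modelQ W x t t' := by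
  obtain ⟨Z, w, η⟩ := t
  obtain ⟨Z', w', η'⟩ := t'
  let θ : (tangent X).E x →L[ℂ] ℂ := η
  let θ' : (tangent X).E x →L[ℂ] ℂ := η'
  change θ' (Z + β w - (1 / 2 : ℂ) • β (adjoint W β θ)) +
    W.Q x (w - adjoint W β θ) (w' - adjoint W β θ') +
    θ (Z' + β w' - (1 / 2 : ℂ) • β (adjoint W β θ')) = θ' Z + W.Q x w w' + θ Z'
  simp only [map_sub, map_add, map_smul, sub_apply, Q_adjoint, Q_adjoint', smul_eq_mul]
  have h : θ' (β (adjoint W β θ)) = θ (β (adjoint W β θ')) := by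
    rw [← Q_adjoint, ← Q_adjoint, W.Q_symm]
  rw [h]
  ring

theorem regSecAt_model_mk {Z : ∀ z, (tangent X).E z} {w : ∀ z, W.E z}
    {η : ∀ z, (canonical X).E z} :
    RegSecAt ρ (model W) (fun z => model.mk W (Z z) (w z) (η z)) x ↔
      RegSecAt ρ (tangent X) Z x ∧ RegSecAt ρ W.toHolBundle w x ∧ RegSecAt ρ (canonical X) η x :=
  regSecAt_sum_iff.trans (and_congr_right fun _ => regSecAt_sum_iff)

theorem regSecAt_unipotent {β : ∀ z, W.E z →L[ℂ] (tangent X).E z}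
    (hβ : RegSecAt ρ (W.toHolBundle.hom (tangent X)) β x) {t : ∀ z, (model W).E z}
    (ht : RegSecAt ρ (model W) t x) :
    RegSecAt ρ (model W) (fun z => unipotent W (β z) (t z)) x := by
  obtain ⟨h1, h2, h3⟩ := regSecAt_model_mk (Z := fun z => (t z).1) (w := fun z => (t z).2.1)
    (η := fun z => (t z).2.2) |>.1 ht
  have h4 : RegSecAt ρ W.toHolBundle (fun z => adjoint W (β z) (t z).2.2) x :=
    W.regSecAt_sharp (RegSecAt.comp (C := trivialLine X) h3 hβ)
  exact regSecAt_model_mk.2 ⟨(h1.add (hβ.hom_apply h2)).sub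
    (RegSecAt.smul (RegAt.const _) (hβ.hom_apply h4)), h2.sub h4, h3⟩

end Unipotent

/-! ### The bundle defined by a cocycle -/

section Twisted

variable {a : Cocycle (W.toHolBundle.hom (tangent X))}
  {s : X → ∀ z, W.E z →L[ℂ] (tangent X).E z}

/-- Since `-s x = a.c x y - s y`, the descriptions over `x` and over `y` differ by `unipotent W (a.c
x y)`, which is holomorphic. No regularity of `s` itself is needed. -/
theorem regSecAt_unipotent_change
    (hs : ∀ x y z, z ∈ a.U x → z ∈ a.U y → s y z - s x z = a.c x y z) {x y z : X}
    (hx : z ∈ a.U x) (hy : z ∈ a.U y) {t : ∀ z, (model W).E z}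
    (ht : RegSecAt ρ (model W) (fun w => unipotent W (-s y w) (t w)) z) :
    RegSecAt ρ (model W) (fun w => unipotent W (-s x w) (t w)) z := by
  have h : RegSecAt ρ (W.toHolBundle.hom (tangent X)) (a.c x y) z := RegSecAt.of_hol
    ((isHolSection_iff ((a.isOpen x).inter (a.isOpen y))).1 (a.hol x y) z ⟨hx, hy⟩)
  refine (regSecAt_unipotent h ht).congr ?_
  filter_upwards [(a.isOpen x).mem_nhds hx, (a.isOpen y).mem_nhds hy] with w h1 h2
  have h3 : -s x w = a.c x y w + -s y w := by
    rw [← hs x y w h1 h2]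
    abel
  rw [unipotent_comp, h3]

/-- The holomorphic bundle obtained by gluing copies of `K⁻¹ ⊕ W ⊕ K` with the unipotent isometries
defined by a cocycle `a`, identified fibrewise with `K⁻¹ ⊕ W ⊕ K` by a splitting of `a`. -/
theorem exists_twisted_bundle
    (hs : ∀ x y z, z ∈ a.U x → z ∈ a.U y → s y z - s x z = a.c x y z) :
    ∃ (B : HolBundle X (Fin (m + 2) → ℂ)) (κ : ∀ z, B.E z ≃ₗ[ℂ] (model W).E z),
      ∀ (ρ : Regularity) (t : ∀ z, B.E z) (x z : X), z ∈ a.U x →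
        (RegSecAt ρ B t z ↔
          RegSecAt ρ (model W) (fun w => unipotent W (-s x w) (κ w (t w))) z) := by
  have hdim : Module.finrank ℂ (Fin (m + 2) → ℂ) =
      Module.finrank ℂ (ℂ × (Fin m → ℂ) × (ℂ →L[ℂ] ℂ)) := by
    rw [Module.finrank_prod, Module.finrank_prod, finrank_clm_dual, Module.finrank_fin_fun,
      Module.finrank_fin_fun, Module.finrank_self]
    ring
  let L : (Fin (m + 2) → ℂ) ≃L[ℂ] (ℂ × (Fin m → ℂ) × (ℂ →L[ℂ] ℂ)) :=
    ContinuousLinearEquiv.ofFinrankEq hdim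
  -- Over `U x` the frames of the new bundle are those of `K⁻¹ ⊕ W ⊕ K` moved by `unipotent W (s x
  -- z)`; so a section is holomorphic exactly when the inverse isometry makes it holomorphic in the
  -- untwisted sense.
  let P : X → ∀ z, (model W).E z ≃ₗ[ℂ] (model W).E z := fun x z =>
    LinearEquiv.ofLinearMap (unipotent W (s x z)) (unipotent W (-s x z))
      (LinearMap.ext fun t => unipotent_apply_neg _ t)
      (LinearMap.ext fun t => unipotent_neg_apply _ t)
  let τ : X → ∀ z, (Fin (m + 2) → ℂ) ≃ₗ[ℂ] (model W).E z := fun x z =>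
    (L.trans ((model W).coord x z).symm).toLinearEquiv.trans (P x z)
  have hτ : ∀ x z t, (τ x z).symm t =
      L.symm ((model W).coord x z (unipotent W (-s x z) t)) := fun _ _ _ => rfl
  have hreg : ∀ (ρ : Regularity) (x z : X) (t : ∀ z, (model W).E z), z ∈ (model W).dom x →
      (RegAt ρ (fun w => (τ x w).symm (t w)) z ↔
        RegSecAt ρ (model W) (fun w => unipotent W (-s x w) (t w)) z) := by
    intro ρ x z t hz
    rw [regSecAt_iff hz]
    constructor
    · intro h
      refine (h.clm (L : (Fin (m + 2) → ℂ) →L[ℂ] _)).congr (.of_forall fun w => ?_)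
      exact ((congrArg L (hτ x w (t w))).trans (L.apply_symm_apply _)).symm
    · intro h
      exact h.clm (L.symm : _ →L[ℂ] (Fin (m + 2) → ℂ))
  obtain ⟨B, κ, hκ⟩ := exists_bundle_of_frames (fun x => a.U x ∩ (model W).dom x)
    (fun x => (a.isOpen x).inter ((model W).isOpen_dom x))
    (fun x => ⟨a.mem x, (model W).mem_dom x⟩) τ (fun x y z hz => RegAt.clm_of_apply fun v => by
      refine (hreg .hol x z (fun w => τ y w v) hz.1.2).2
        (regSecAt_unipotent_change hs hz.1.1 hz.2.1 ?_)
      refine ((hreg .hol y z (fun w => τ y w v) hz.2.2).1 ?_)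
      exact (RegAt.const v).congr (.of_forall fun w => LinearEquiv.symm_apply_apply _ _))
  refine ⟨B, κ, fun ρ t x z hz => ?_⟩
  rw [hκ ρ t z z ⟨a.mem z, (model W).mem_dom z⟩, hreg ρ z z _ ((model W).mem_dom z)]
  exact ⟨regSecAt_unipotent_change hs hz (a.mem z), regSecAt_unipotent_change hs (a.mem z) hz⟩

end Twisted

/-! ### The orthogonal structure and the determinant of `K⁻¹ ⊕ W ⊕ K` -/

section Model

variable {x : X}

theorem model.mk_add_mk (Z Z' : (tangent X).E x) (w w' : W.E x) (η η' : (canonical X).E x) :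
    model.mk W Z w η + model.mk W Z' w' η' = model.mk W (Z + Z') (w + w') (η + η') :=
  rfl

theorem model.smul_mk_left (c : ℂ) (Z : (tangent X).E x) :
    c • model.mk W Z 0 0 = model.mk W (c • Z) 0 0 :=
  Prod.ext rfl (Prod.ext (smul_zero c) (smul_zero (A := (canonical X).E x) c))

/-- The orthogonal structure of `K⁻¹ ⊕ W ⊕ K` as a bilinear form. -/
noncomputable def modelForm (W : SOBundle X m) (x : X) :
    (model W).E x →ₗ[ℂ] (model W).E x →ₗ[ℂ] ℂ :=
  LinearMap.mk₂ ℂ (modelQ W x)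
    (fun a a' b => by
      change (show (tangent X).E x →L[ℂ] ℂ from b.2.2) (a.1 + a'.1) +
        W.Q x (a.2.1 + a'.2.1) b.2.1 + ((show (tangent X).E x →L[ℂ] ℂ from a.2.2) b.1 +
          (show (tangent X).E x →L[ℂ] ℂ from a'.2.2) b.1) = _
      rw [map_add, map_add, add_apply, modelQ, modelQ]
      ring)
    (fun c a b => by
      change (show (tangent X).E x →L[ℂ] ℂ from b.2.2) (c • a.1) +
        W.Q x (c • a.2.1) b.2.1 + c * (show (tangent X).E x →L[ℂ] ℂ from a.2.2) b.1 = _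
      rw [map_smul, map_smul, smul_apply, modelQ, smul_eq_mul, smul_eq_mul, smul_eq_mul]
      ring)
    (fun a b b' => by
      change ((show (tangent X).E x →L[ℂ] ℂ from b.2.2) a.1 +
        (show (tangent X).E x →L[ℂ] ℂ from b'.2.2) a.1) + W.Q x a.2.1 (b.2.1 + b'.2.1) +
          (show (tangent X).E x →L[ℂ] ℂ from a.2.2) (b.1 + b'.1) = _
      rw [map_add, map_add, modelQ, modelQ]
      ring)
    (fun c a b => by
      change c * (show (tangent X).E x →L[ℂ] ℂ from b.2.2) a.1 + W.Q x a.2.1 (c • b.2.1) +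
        (show (tangent X).E x →L[ℂ] ℂ from a.2.2) (c • b.1) = _
      rw [map_smul, map_smul, modelQ, smul_eq_mul, smul_eq_mul, smul_eq_mul]
      ring)

theorem modelQ_symm (a b : (model W).E x) : modelQ W x a b = modelQ W x b a := by
  rw [modelQ, modelQ, W.Q_symm]
  ring

/-- The covector dual to the local vector field. -/
noncomputable def localForm (x z : X) : (canonical X).E z :=
  ((tangent X).coord x z : (tangent X).E z →L[ℂ] ℂ)

theorem localForm_localField (x z : X) :
    (show (tangent X).E z →L[ℂ] ℂ from localForm x z) (localField x z) = 1 :=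
  ((tangent X).coord x z).apply_symm_apply 1

theorem regSecAt_localForm (x : X) : RegSecAt ρ (canonical X) (localForm x) x :=
  RegSecAt.hom_of_apply fun _ hs => regSecAt_trivialLine_iff.2
    (RegAt.of_hol ((regSecAt_iff ((tangent X).mem_dom x)).1 hs))

theorem modelQ_nondeg {a : (model W).E x} (h : ∀ b, modelQ W x a b = 0) : a = 0 := by
  obtain ⟨Z, w, η⟩ := a
  let θ : (tangent X).E x →L[ℂ] ℂ := η
  have h0 : ∀ Z' w' (η' : (tangent X).E x →L[ℂ] ℂ), η' Z + W.Q x w w' + θ Z' = 0 :=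
    fun Z' w' η' => h (model.mk W Z' w' η')
  have hθ : η = 0 := ContinuousLinearMap.ext (R₁ := ℂ) fun Z' => by
    have := h0 Z' 0 0
    rw [map_zero, add_zero] at this
    exact (zero_add _).symm.trans this
  have hw : w = 0 := W.Q_nondeg x w fun w' => by
    have := h0 0 w' 0
    rw [map_zero, add_zero] at this
    exact (zero_add _).symm.trans this
  have hZ : Z = 0 := by
    obtain ⟨c, rfl⟩ := exists_smul_localField x x Z
    have := h0 0 0 (localForm x x)
    rw [map_zero, map_zero, add_zero, add_zero, map_smul] at this
    have h1 : c * 1 = 0 := by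
      rw [← localForm_localField x x]
      exact this
    rw [← mul_one c, h1, zero_smul]
  rw [hZ, hw, hθ]
  rfl

theorem regAt_modelQ {s t : ∀ z, (model W).E z} (hs : RegSecAt ρ (model W) s x)
    (ht : RegSecAt ρ (model W) t x) : RegAt ρ (fun z => modelQ W z (s z) (t z)) x := by
  obtain ⟨h1, h2, h3⟩ := regSecAt_model_mk (Z := fun z => (s z).1) (w := fun z => (s z).2.1)
    (η := fun z => (s z).2.2) |>.1 hs
  obtain ⟨k1, k2, k3⟩ := regSecAt_model_mk (Z := fun z => (t z).1) (w := fun z => (t z).2.1)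
    (η := fun z => (t z).2.2) |>.1 ht
  exact ((regSecAt_trivialLine_iff.1 (RegSecAt.hom_apply (B := trivialLine X) k3 h1)).add
    (regAt_pairing (W.regSecAt_Q x) h2 k2)).add
      (regSecAt_trivialLine_iff.1 (RegSecAt.hom_apply (B := trivialLine X) h3 k1))

/-- The inclusion of `W` in `K⁻¹ ⊕ W ⊕ K`. -/
noncomputable def modelInl (W : SOBundle X m) (x : X) : W.E x →ₗ[ℂ] (model W).E x where
  toFun := fun w => model.mk W 0 w 0
  map_add' := fun _ _ => Prod.ext (add_zero _).symm (Prod.ext rfl (add_zero _).symm)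
  map_smul' := fun c _ => Prod.ext (smul_zero c).symm
    (Prod.ext rfl (smul_zero (A := (canonical X).E x) c).symm)

theorem finrank_model (x : X) : Module.finrank ℂ ((model W).E x) = m + 2 := by
  rw [(model W).finrank_fiber, Module.finrank_prod, Module.finrank_prod, finrank_clm_dual,
    Module.finrank_fin_fun, Module.finrank_self]
  ring

/-- The determinant of `K⁻¹ ⊕ W ⊕ K` induced from `W`. -/
theorem exists_model_volume (W : SOBundle X m) (x : X) :
    ∃ θ : (model W).E x [⋀^Fin (m + 2)]→ₗ[ℂ] ℂ,
      (∀ (Z : (tangent X).E x) (w : Fin m → W.E x) (η : (tangent X).E x →L[ℂ] ℂ),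
        θ (Fin.cons (model.mk W Z 0 0) (Fin.snoc (fun k => model.mk W 0 (w k) 0)
          (model.mk W 0 0 η))) = Complex.I * η Z * W.vol x w) ∧
      ∀ e e' : Fin (m + 2) → (model W).E x,
        θ e * θ e' = (Matrix.of fun k l => modelQ W x (e k) (e' l)).det := by
  have := (model W).finiteDimensional_fiber x
  have := W.toHolBundle.finiteDimensional_fiber x
  obtain ⟨w₀, hw₀⟩ := W.exists_vol_ne_zero x
  let e : (model W).E x := model.mk W (localField x x) 0 0
  let f : (model W).E x := model.mk W 0 0 (localForm x x)
  have hef : modelForm W x e f = 1 := by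
    change (show (tangent X).E x →L[ℂ] ℂ from localForm x x) (localField x x) + W.Q x 0 0 + 0 = 1
    rw [localForm_localField, map_zero, add_zero, add_zero]
  have hee : modelForm W x e e = 0 := by
    change 0 + W.Q x 0 0 + 0 = (0 : ℂ)
    rw [map_zero, add_zero, add_zero]
  have hew : ∀ w, modelForm W x e (modelInl W x w) = 0 := fun w => by
    change 0 + W.Q x 0 w + 0 = (0 : ℂ)
    rw [map_zero, add_zero, zero_add]
    rfl
  have hww : ∀ w w', modelForm W x (modelInl W x w) (modelInl W x w') = W.Q x w w' :=
    fun w w' => by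
      change 0 + W.Q x w w' + 0 = _
      rw [zero_add, add_zero]
  let E : (Fin m → W.E x) → Fin (m + 2) → (model W).E x := fun w =>
    Fin.cons e (Fin.snoc (fun k => modelInl W x (w k)) f : Fin (m + 1) → (model W).E x)
  have hdet : ∀ w, (Matrix.of fun k l => modelForm W x (E w k) (E w l)).det = -(W.vol x w ^ 2) := by
    intro w
    rw [W.vol_sq]
    refine (gram_det_cons_snoc (modelForm W x) modelQ_symm hee (fun k => hew (w k)) hef).trans ?_
    simp only [hww]
  -- `w₀` has nonzero volume, so the adapted frame `E w₀` has nonzero Gram determinant `-vol(w₀)²`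
  -- and is a basis.
  have hli : LinearIndependent ℂ (E w₀) := linearIndependent_of_gram_det_ne_zero (modelForm W x)
    (by rw [hdet]; exact neg_ne_zero.2 (pow_ne_zero 2 hw₀))
  let b := basisOfLinearIndependentOfCardEqFinrank hli (by rw [finrank_model, Fintype.card_fin])
  have hb : (b : Fin (m + 2) → (model W).E x) = E w₀ :=
    coe_basisOfLinearIndependentOfCardEqFinrank _ _
  -- The scalar is dictated by the volume rule on `E w₀`. Its square is `-vol(w₀)²`, the Gram
  -- determinant of that basis, so the normalisation holds on one basis and hence everywhere.
  let θ : (model W).E x [⋀^Fin (m + 2)]→ₗ[ℂ] ℂ := (Complex.I * W.vol x w₀) • b.det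
  have hθb : θ b = Complex.I * W.vol x w₀ := by
    change (Complex.I * W.vol x w₀) * b.det b = _
    rw [b.det_self, mul_one]
  have hθ : ∀ w, consSnoc θ e f (fun k => modelInl W x (w k)) = Complex.I * W.vol x w := by
    have key : (consSnoc θ e f).compLinearMap (modelInl W x) = Complex.I • W.vol x := by
      refine alternating_eq_of_apply_eq (W.finrank_fiber x) (e := w₀) ?_ ?_
      · change θ (E w₀) ≠ 0
        rw [← hb, hθb]
        exact mul_ne_zero Complex.I_ne_zero hw₀
      · change θ (E w₀) = _
        rw [← hb, hθb]
        rfl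
    exact fun w => DFunLike.congr_fun key w
  refine ⟨θ, fun Z w η => ?_, volume_mul_of_basis b θ (modelForm W x) ?_⟩
  · obtain ⟨c, rfl⟩ := exists_smul_localField x x Z
    have e1 : model.mk W (c • localField x x) 0 0 = c • e := (model.smul_mk_left c _).symm
    have e0 : η = η (localField x x) • localForm x x := by
      refine ContinuousLinearMap.ext (R₁ := ℂ) fun Z => ?_
      obtain ⟨c, rfl⟩ := exists_smul_localField x x Z
      change η (c • _) = η (localField x x) *
        (show (tangent X).E x →L[ℂ] ℂ from localForm x x) (c • localField x x)
      rw [map_smul, map_smul, localForm_localField, smul_eq_mul, smul_eq_mul]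
      ring
    have e2 : model.mk W 0 0 η = (0 : ℂ) • e + modelInl W x 0 + η (localField x x) • f := by
      have h1 : (0 : ℂ) • e + modelInl W x 0 = 0 := by
        rw [map_zero, add_zero]
        exact zero_smul ℂ e
      rw [h1]
      refine Eq.trans ?_ (zero_add _).symm
      refine Prod.ext (smul_zero _).symm (Prod.ext (smul_zero _).symm e0)
    have e3 := volume_adapted (W.finrank_fiber x) θ e f (modelInl W x) w 0 0 c 0
      (η (localField x x))
    have e4 : (fun k => modelInl W x (w k) + (0 : Fin m → ℂ) k • e) =
        fun k => modelInl W x (w k) := funext fun k =>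
      (congrArg _ (zero_smul ℂ e)).trans (add_zero _)
    rw [hθ, ← e2, ← e1, e4] at e3
    rw [map_smul, smul_eq_mul]
    refine e3.trans ?_
    ring
  · rw [hθb, hb, hdet, mul_pow, Complex.I_sq]
    ring

/-- The determinant of `K⁻¹ ⊕ W ⊕ K` induced from `W`. -/
noncomputable def modelVol (W : SOBundle X m) (x : X) : (model W).E x [⋀^Fin (m + 2)]→ₗ[ℂ] ℂ :=
  (exists_model_volume W x).choose

theorem modelVol_mk (Z : (tangent X).E x) (w : Fin m → W.E x) (η : (tangent X).E x →L[ℂ] ℂ) :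
    modelVol W x (Fin.cons (model.mk W Z 0 0) (Fin.snoc (fun k => model.mk W 0 (w k) 0)
      (model.mk W 0 0 η))) = Complex.I * η Z * W.vol x w :=
  (exists_model_volume W x).choose_spec.1 Z w η

theorem modelVol_mul (e e' : Fin (m + 2) → (model W).E x) :
    modelVol W x e * modelVol W x e' = (Matrix.of fun k l => modelQ W x (e k) (e' l)).det :=
  (exists_model_volume W x).choose_spec.2 e e'

/-- A unipotent isometry is unitriangular for the flag `K⁻¹ ⊂ K⁻¹ ⊕ W`. It takes an adapted frame to
one that `volume_adapted` evaluates to the same volume, both extreme coefficients being `1`. -/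
theorem modelVol_unipotent (β : W.E x →L[ℂ] (tangent X).E x) (e : Fin (m + 2) → (model W).E x) :
    modelVol W x (fun k => unipotent W β (e k)) = modelVol W x e := by
  have := (model W).finiteDimensional_fiber x
  have := W.toHolBundle.finiteDimensional_fiber x
  obtain ⟨w, hw⟩ := W.exists_vol_ne_zero x
  have h1 := modelVol_mk (localField x x) w (localForm x x)
  refine DFunLike.congr_fun (f := (modelVol W x).compLinearMap (unipotent W β)) ?_ e
  refine (alternating_eq_of_apply_eq (finrank_model x) (e := Fin.cons
    (model.mk W (localField x x) 0 0) (Fin.snoc (fun k => model.mk W 0 (w k) 0)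
      (model.mk W 0 0 (localForm x x)) : Fin (m + 1) → (model W).E x)) ?_ ?_).symm
  · rw [h1, localForm_localField, mul_one]
    exact mul_ne_zero Complex.I_ne_zero hw
  choose c hc using fun k => exists_smul_localField x x (β (w k))
  let η : (tangent X).E x →L[ℂ] ℂ := localForm x x
  obtain ⟨α, hα⟩ := exists_smul_localField x x (-((1 / 2 : ℂ) • β (adjoint W β η)))
  have e3 := volume_adapted (W.finrank_fiber x) (modelVol W x) (model.mk W (localField x x) 0 0)
    (model.mk W 0 0 (localForm x x)) (modelInl W x) w (-adjoint W β η) c 1 α 1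
  rw [one_mul, one_mul] at e3
  refine Eq.symm (Eq.trans (congrArg (modelVol W x) (funext fun k => ?_)) e3)
  refine Fin.cases ?_ (fun k => ?_) k
  · refine (unipotent_mk_zero β _ 0).trans ?_
    rw [map_zero, add_zero]
    exact (one_smul ℂ (model.mk W (localField x x) 0 0)).symm
  · refine Fin.lastCases ?_ (fun k => ?_) k
    · simp only [Fin.cons_succ, Fin.snoc_last]
      refine (unipotent_mk β 0 0 η).trans ?_
      rw [map_zero, zero_add, zero_sub, ← hα, zero_sub, model.smul_mk_left]
      have h2 : model.mk W (α • localField x x) 0 0 + modelInl W x (-adjoint W β η) =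
          model.mk W (α • localField x x) (-adjoint W β η) 0 :=
        (model.mk_add_mk _ _ _ _ _ _).trans (by rw [add_zero, zero_add, add_zero])
      refine Eq.trans ?_ (congrArg₂ (· + ·) h2 (one_smul ℂ (model.mk W 0 0 η))).symm
      refine Eq.trans ?_ (model.mk_add_mk _ _ _ _ _ _).symm
      rw [add_zero, add_zero, zero_add]
    · simp only [Fin.cons_succ, Fin.snoc_castSucc]
      refine (unipotent_mk_zero β 0 (w k)).trans ?_
      rw [model.smul_mk_left, hc]
      refine Eq.trans ?_ (model.mk_add_mk _ _ _ _ _ _).symm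
      rw [add_zero, add_zero]

/-- `modelVol` is chosen point by point, so its regularity is not visible. The polarised identity
gives `θ(e) θ(E) = det Q(e, E)`; for a holomorphic adapted frame `E`, `θ(E) = √-1 vol_W` is
holomorphic and nonzero near `x`, and one divides. -/
theorem regAt_modelVol {e : Fin (m + 2) → ∀ z, (model W).E z}
    (he : ∀ k, RegSecAt .hol (model W) (e k) x) :
    RegAt .hol (fun z => modelVol W z fun k => e k z) x := by
  obtain ⟨w, hw⟩ := W.exists_vol_ne_zero x
  let b : Fin m → ∀ z, W.E z := fun k z => (W.coord x z).symm (W.coord x x (w k))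
  have hb : ∀ k, ∀ z ∈ W.dom x, RegSecAt .hol W.toHolBundle (b k) z := fun k z hz =>
    RegSecAt.coord_symm hz (RegAt.const _)
  have hb0 : ∀ k, b k x = w k := fun k => (W.coord x x).symm_apply_apply (w k)
  let E : Fin (m + 2) → ∀ z, (model W).E z := fun k z =>
    (Fin.cons (model.mk W (localField x z) 0 0) (Fin.snoc (fun k => model.mk W 0 (b k z) 0)
      (model.mk W 0 0 (localForm x z)) : Fin (m + 1) → (model W).E z) :
        Fin (m + 2) → (model W).E z) k
  have hE : ∀ k, RegSecAt .hol (model W) (E k) x := by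
    refine Fin.cases ?_ (Fin.lastCases ?_ fun k => ?_)
    · exact regSecAt_model_mk.2 ⟨regSecAt_localField ((tangent X).mem_dom x), .zero, .zero⟩
    · simp only [E, Fin.cons_succ, Fin.snoc_last]
      exact regSecAt_model_mk.2 ⟨.zero, .zero, regSecAt_localForm x⟩
    · simp only [E, Fin.cons_succ, Fin.snoc_castSucc]
      exact regSecAt_model_mk.2 ⟨.zero, hb k x (W.mem_dom x), .zero⟩
  have hEv : ∀ z, modelVol W z (fun k => E k z) = Complex.I * W.vol z (fun k => b k z) := by
    intro z
    refine (modelVol_mk (localField x z) (fun k => b k z) (localForm x z)).trans ?_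
    rw [localForm_localField, mul_one]
  have hv : RegAt .hol (fun z => W.vol z fun k => b k z) x := regSecAt_trivialLine_iff.1
    ((isHolSection_iff (W.isOpen_dom x)).1 (W.vol_hol _ (W.isOpen_dom x) b fun k =>
      (isHolSection_iff (W.isOpen_dom x)).2 (hb k)) x (W.mem_dom x))
  have hvx : (W.vol x fun k => b k x) ≠ 0 := by
    simp only [hb0]
    exact hw
  have h1 : RegAt .hol (fun z => (Matrix.of fun k l => modelQ W z (e k z) (E l z)).det) x :=
    RegAt.det fun k l => regAt_modelQ (he k) (hE l)
  refine (h1.mul (((RegAt.const Complex.I).mul hv).inv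
    (mul_ne_zero Complex.I_ne_zero hvx))).congr ?_
  filter_upwards [hv.continuousAt.eventually_ne hvx] with z hz
  rw [← modelVol_mul, hEv, mul_inv_cancel_right₀ (mul_ne_zero Complex.I_ne_zero hz)]

end Model

/-! ### The Higgs bundle with given data -/

section Existence

variable {a : Cocycle (W.toHolBundle.hom (tangent X))}
  {s : X → ∀ z, W.E z →L[ℂ] (tangent X).E z} {B : HolBundle X (Fin (m + 2) → ℂ)}
  {κ : ∀ z, B.E z ≃ₗ[ℂ] (model W).E z}

/-- `κ` identifies `B` with the bundle glued from copies of `K⁻¹ ⊕ W ⊕ K` by the cocycle `a`, by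
means of the splitting `s` of `a`. -/
def IsTwist (a : Cocycle (W.toHolBundle.hom (tangent X)))
    (s : X → ∀ z, W.E z →L[ℂ] (tangent X).E z) (κ : ∀ z, B.E z ≃ₗ[ℂ] (model W).E z) : Prop :=
  ∀ (ρ : Regularity) (t : ∀ z, B.E z) (x z : X), z ∈ a.U x →
    (RegSecAt ρ B t z ↔ RegSecAt ρ (model W) (fun w => unipotent W (-s x w) (κ w (t w))) z)

namespace IsTwist

theorem symm_apply (h : IsTwist a s κ) {t : ∀ z, (model W).E z} {x z : X} (hz : z ∈ a.U x)
    (ht : RegSecAt ρ (model W) (fun w => unipotent W (-s x w) (t w)) z) :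
    RegSecAt ρ B (fun w => (κ w).symm (t w)) z := by
  refine (h ρ _ x z hz).2 (ht.congr (.of_forall fun w => ?_))
  rw [LinearEquiv.apply_symm_apply]

/-- The twisting isometries fix `K⁻¹` pointwise, so the inclusion of `K⁻¹` stays holomorphic. -/
theorem exists_field (h : IsTwist a s κ) :
    ∃ φ : HolHom (tangent X) B, ∀ x Z, φ.toFun x Z = (κ x).symm (model.mk W Z 0 0) := by
  let f : ∀ x, (tangent X).E x →ₗ[ℂ] B.E x := fun x => (κ x).symm.toLinearMap ∘ₗ
    LinearMap.inl ℂ ((tangent X).E x) (W.E x × (canonical X).E x)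
  have hf : ∀ x Z, (tangent X).clm (f x) Z = (κ x).symm (model.mk W Z 0 0) := fun x Z =>
    HolBundle.clm_apply _ _ _
  refine ⟨⟨fun x => (tangent X).clm (f x), isHolSection_univ_iff.2 fun x =>
    RegSecAt.hom_of_apply fun Z hZ => ?_⟩, hf⟩
  refine (h.symm_apply (a.mem x) ?_).congr (.of_forall fun z => hf z (Z z))
  refine (regSecAt_model_mk.2 ⟨hZ, .zero, .zero⟩).congr (.of_forall fun z => ?_)
  refine (unipotent_mk_zero _ _ _).trans ?_
  rw [map_zero, add_zero]

/-- The twist is by isometries, so the form computed through `κ` equals the one computed in any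
untwisted local description, where it is holomorphic. -/
theorem exists_form (h : IsTwist a s κ) : ∃ Q : ∀ x, B.E x →L[ℂ] B.E x →L[ℂ] ℂ,
    IsHolSection (B.hom (B.hom (trivialLine X))) univ Q ∧
    ∀ x v w, Q x v w = modelQ W x (κ x v) (κ x w) := by
  let f : ∀ x, B.E x →ₗ[ℂ] B.E x →L[ℂ] ℂ := fun x =>
    { toFun := fun v => B.clm ((modelForm W x (κ x v)).comp (κ x).toLinearMap)
      map_add' := fun v v' => ContinuousLinearMap.ext fun w => by
        rw [add_apply, HolBundle.clm_apply, HolBundle.clm_apply, HolBundle.clm_apply, map_add,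
          map_add]
        rfl
      map_smul' := fun c v => ContinuousLinearMap.ext fun w => by
        rw [smul_apply, HolBundle.clm_apply, HolBundle.clm_apply, map_smul, map_smul]
        rfl }
  have hf : ∀ x v w, B.clm (f x) v w = modelQ W x (κ x v) (κ x w) := fun x v w =>
    (DFunLike.congr_fun (F := B.E x →L[ℂ] ℂ) (HolBundle.clm_apply B (f x) v) w).trans
      (HolBundle.clm_apply _ _ _)
  refine ⟨fun x => B.clm (f x), isHolSection_univ_iff.2 fun x => regSecAt_pairing_of_apply
    fun v w hv hw => ?_, hf⟩
  refine (regAt_modelQ ((h .hol v x x (a.mem x)).1 hv) ((h .hol w x x (a.mem x)).1 hw)).congr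
    (.of_forall fun z => (hf z _ _).trans (modelQ_unipotent _ _ _).symm)

theorem regAt_vol (h : IsTwist a s κ) {e : Fin (m + 2) → ∀ z, B.E z} {x : X}
    (he : ∀ k, RegSecAt .hol B (e k) x) :
    RegAt .hol (fun z => modelVol W z fun k => κ z (e k z)) x :=
  (regAt_modelVol fun k => (h .hol (e k) x x (a.mem x)).1 (he k)).congr
    (.of_forall fun z => (modelVol_unipotent (-s x z) _).symm)

/-- The smooth bundle underlying `B` is `K⁻¹ ⊕ W ⊕ K`, if the splitting `s` is smooth. -/
theorem exists_holStructure (h : IsTwist a s κ)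
    (hs : ∀ x, ∀ z ∈ a.U x, RegSecAt .smooth (W.toHolBundle.hom (tangent X)) (s x) z) :
    ∃ Θ : ∀ x, (model W).E x ≃L[ℂ] B.E x, (∀ x t, Θ x t = (κ x).symm t) ∧
      IsSmoothSection ((model W).hom B) (fun x => (Θ x : (model W).E x →L[ℂ] B.E x)) ∧
      IsSmoothSection (B.hom (model W)) (fun x => ((Θ x).symm : B.E x →L[ℂ] (model W).E x)) := by
  let Θ : ∀ x, (model W).E x ≃L[ℂ] B.E x := fun x => ContinuousLinearEquiv.equivOfInverse
    ((model W).clm (κ x).symm.toLinearMap) (B.clm (κ x).toLinearMap)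
    (fun v => by
      rw [HolBundle.clm_apply, HolBundle.clm_apply]
      exact (κ x).apply_symm_apply v)
    (fun v => by
      rw [HolBundle.clm_apply, HolBundle.clm_apply]
      exact (κ x).symm_apply_apply v)
  have hΘ : ∀ x t, Θ x t = (κ x).symm t := fun x t => HolBundle.clm_apply _ _ _
  have hreg : ∀ x, RegSecAt .smooth ((model W).hom B)
      (fun x => (Θ x : (model W).E x →L[ℂ] B.E x)) x := fun x =>
    RegSecAt.hom_of_apply fun t ht => (h.symm_apply (a.mem x) (regSecAt_unipotent
      (hs x x (a.mem x)).neg (RegSecAt.of_hol ht))).congr (.of_forall fun z => hΘ z (t z))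
  exact ⟨Θ, hΘ, isSmoothSection_iff.2 hreg, isSmoothSection_iff.2 fun x => (hreg x).symm⟩

/-- The subbundle `K⁻¹ ⊕ W` of `B` is an extension of `W` by `K⁻¹` with class `[a]`. -/
theorem exists_extension (h : IsTwist a s κ)
    (hs : ∀ x y z, z ∈ a.U x → z ∈ a.U y → s y z - s x z = a.c x y z)
    {φ : HolHom (tangent X) B} (hφ : ∀ x Z, φ.toFun x Z = (κ x).symm (model.mk W Z 0 0))
    {N : ∀ x, Submodule ℂ (B.E x)} (hN : ∀ x v, v ∈ N x ↔ (κ x v).2.2 = 0) :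
    ∃ D : Extension W φ N, (∀ x u, D.p.toFun x u = (κ x (D.i.toFun x u)).2.1) ∧
      IsExtensionClass D.j D.p (H1.mk a) := by
  obtain ⟨Q, hQ, hQκ⟩ := h.exists_form
  have hQφ : ∀ x v Z, Q x v (φ.toFun x Z) =
      (show (tangent X).E x →L[ℂ] ℂ from (κ x v).2.2) Z := by
    intro x v Z
    rw [hQκ, hφ, LinearEquiv.apply_symm_apply]
    change 0 + W.Q x _ 0 + _ = _
    rw [map_zero, add_zero, zero_add]
    rfl
  -- `K⁻¹ ⊕ W` is the orthogonal complement of `K⁻¹`, so it carries the bundle structure of a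
  -- kernel; the dual vectors are supplied by the local form on `K`.
  obtain ⟨V₁, i, j, hi, hr, hij, hj⟩ := exists_perp_bundle hQ (φ := φ)
    (v₀ := fun x => (κ x).symm (model.mk W 0 0 (localForm x x)))
    (fun x => by
      rw [hQφ, LinearEquiv.apply_symm_apply]
      exact localForm_localField x x)
    (fun x Z Z' => by
      rw [hQφ, hφ, LinearEquiv.apply_symm_apply]
      rfl)
    (N := N) (fun x v => by
      rw [hN]
      refine ⟨fun h0 Z => ?_, fun h0 => ContinuousLinearMap.ext (R₁ := ℂ) fun Z => ?_⟩
      · rw [hQφ, h0]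
        rfl
      · exact (hQφ x v Z).symm.trans (h0 Z))
  have hi0 : ∀ x u, (κ x (i.toFun x u)).2.2 = 0 := fun x u => by
    rw [← hN, ← hr]
    exact ⟨u, rfl⟩
  have hNi : ∀ x t, t.2.2 = 0 → ∃ u, i.toFun x u = (κ x).symm t := fun x t ht => by
    have : (κ x).symm t ∈ N x := by rwa [hN, LinearEquiv.apply_symm_apply]
    rwa [← hr] at this
  let f : ∀ x, V₁.E x →ₗ[ℂ] W.E x := fun x =>
    (LinearMap.fst ℂ (W.E x) ((canonical X).E x) ∘ₗ
      LinearMap.snd ℂ ((tangent X).E x) (W.E x × (canonical X).E x)) ∘ₗ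
        (κ x).toLinearMap ∘ₗ (i.toFun x).toLinearMap
  have hf : ∀ x u, V₁.clm (f x) u = (κ x (i.toFun x u)).2.1 := fun x u => HolBundle.clm_apply _ _ _
  have hfeq : ∀ x u, κ x (i.toFun x u) =
      model.mk W (κ x (i.toFun x u)).1 (κ x (i.toFun x u)).2.1 0 := fun x u =>
    Prod.ext rfl (Prod.ext rfl (hi0 x u))
  let p : HolHom V₁ W.toHolBundle :=
    { toFun := fun x => V₁.clm (f x)
      hol := isHolSection_univ_iff.2 fun x => RegSecAt.hom_of_apply fun u hu => by
        have h1 := (h .hol _ x x (a.mem x)).1 (i.apply hu)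
        have h2 := regSecAt_model_mk (Z := fun z => (unipotent W (-s x z) (κ z (i.toFun z (u z)))).1)
          (w := fun z => (unipotent W (-s x z) (κ z (i.toFun z (u z)))).2.1)
          (η := fun z => (unipotent W (-s x z) (κ z (i.toFun z (u z)))).2.2) |>.1 h1
        refine h2.2.1.congr (.of_forall fun z => ?_)
        -- On `K⁻¹ ⊕ W` the twist changes only the `K⁻¹`-component, so the projection to `W` is read
        -- off the untwisted holomorphic section.
        rw [hf, hfeq z (u z), unipotent_mk_zero]
        rfl }
  have hex : IsShortExact j p := by
    refine ⟨hj, fun x u => ?_, fun x w => ?_⟩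
    · change V₁.clm (f x) u = 0 ↔ _
      rw [hf]
      constructor
      · intro h0
        refine ⟨(κ x (i.toFun x u)).1, hi x ?_⟩
        rw [hij, hφ, LinearEquiv.symm_apply_eq]
        conv_rhs => rw [hfeq, h0]
      · rintro ⟨Z, rfl⟩
        rw [hij, hφ, LinearEquiv.apply_symm_apply]
        rfl
    · obtain ⟨u, hu⟩ := hNi x (model.mk W 0 w 0) rfl
      refine ⟨u, ?_⟩
      change V₁.clm (f x) u = w
      rw [hf, hu, LinearEquiv.apply_symm_apply]
      rfl
  -- The local splittings are `w ↦ (s x w, w, 0)`. Untwisting by `-s x` turns them into `w ↦ (0, w,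
  -- 0)`, so they are holomorphic over `U x`, and their differences are `s y - s x = a.c x y`.
  have hlin : ∀ x z, ∃ g : W.E z →L[ℂ] B.E z, ∀ w,
      g w = (κ z).symm (model.mk W (s x z w) w 0) := fun x z =>
    ⟨W.clm ((κ z).symm.toLinearMap ∘ₗ (unipotent W (s x z) ∘ₗ modelInl W z)), fun w => by
      rw [HolBundle.clm_apply]
      change (κ z).symm (unipotent W (s x z) (model.mk W 0 w 0)) = _
      rw [unipotent_mk_zero, zero_add]⟩
  choose g hg using hlin
  choose σ hσ using fun x z => exists_clm_lift (j := i) (C := W.toHolBundle) hi (g x z)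
    (fun w => by rw [hg]; exact hNi z _ rfl)
  refine ⟨⟨V₁, i, hi, hr, j, p, hij, hex⟩, hf, a, σ, fun x =>
    (isHolSection_iff (a.isOpen x)).2 fun z hz => ?_, fun x z _ w => ?_, fun x y z hx hy w => ?_,
    rfl⟩
  · refine regSecAt_hom_of_injective hi (RegSecAt.hom_of_apply fun w hw => ?_)
    refine RegSecAt.congr (s := fun z => (κ z).symm (model.mk W (s x z (w z)) (w z) 0))
      (h.symm_apply hz ?_) (.of_forall fun z => (hσ x z (w z)).trans (hg x z (w z)))
    refine (regSecAt_model_mk.2 ⟨.zero, hw, .zero⟩).congr (.of_forall fun z => ?_)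
    rw [unipotent_mk_zero]
    exact congrArg (fun Z => model.mk W Z (w z) 0) (add_neg_cancel _)
  · change V₁.clm (f z) _ = w
    rw [hf, hσ, hg, LinearEquiv.apply_symm_apply]
    rfl
  · refine hi z ?_
    change i.toFun z (j.toFun z _) = _
    rw [hij, map_sub, hσ, hσ, hg, hg, hφ, ← hs x y z hx hy]
    refine Eq.trans (congrArg (κ z).symm ?_) ((κ z).symm.toLinearMap.map_sub _ _)
    refine (Prod.ext rfl (Prod.ext (sub_self w).symm ?_))
    exact (sub_self (0 : (canonical X).E z)).symm

end IsTwist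

/-- Every triple is determined by a Higgs bundle, whose underlying smooth bundle is
`K⁻¹ ⊕ W ⊕ K`. -/
theorem exists_isAdmissible_carries [T2Space X] [CompactSpace X] (W : SOBundle X m)
    (ξ : ExtH1 W) : ∃ (S : HolStructure W) (H : HiggsBundle X (m + 2)),
      S.IsAdmissible (ExtOrbit.mk ξ) ∧ S.Carries H := by
  obtain ⟨a, rfl⟩ := Quotient.exists_rep ξ
  obtain ⟨s, hsm, hs⟩ := exists_smooth_splitting a
  obtain ⟨B, κ, h⟩ := exists_twisted_bundle hs
  replace h : IsTwist a s κ := h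
  obtain ⟨φ, hφ⟩ := h.exists_field
  obtain ⟨Q, hQ, hQκ⟩ := h.exists_form
  obtain ⟨Θ, hΘ, hΘs, hΘs'⟩ := h.exists_holStructure hsm
  have hΘκ : ∀ x v, (Θ x).symm v = κ x v := fun x v => by
    rw [ContinuousLinearEquiv.symm_apply_eq, hΘ, LinearEquiv.symm_apply_apply]
  have hQΘ : ∀ x t t', Q x (Θ x t) (Θ x t') = modelQ W x t t' := fun x t t' => by
    rw [hQκ, hΘ, hΘ, LinearEquiv.apply_symm_apply, LinearEquiv.apply_symm_apply]
  obtain ⟨D, hD, hξ⟩ := h.exists_extension hs hφ (N := fun x => Submodule.map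
      ((Θ x).toLinearEquiv : (model W).E x →ₗ[ℂ] B.E x) (modelFlag W x)) (fun x v => by
    rw [Submodule.mem_map]
    constructor
    · rintro ⟨t, ht, rfl⟩
      change (κ x (Θ x t)).2.2 = 0
      rw [hΘ, LinearEquiv.apply_symm_apply]
      exact ht
    · exact fun h0 => ⟨κ x v, h0, (hΘ x _).trans ((κ x).symm_apply_apply v)⟩)
  let H : HiggsBundle X (m + 2) :=
    { toHolBundle := B
      Q := Q
      Q_hol := hQ
      Q_symm := fun x v w => by rw [hQκ, hQκ, modelQ_symm]
      Q_nondeg := fun x v hv => (κ x).map_eq_zero_iff.1 (modelQ_nondeg fun t => by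
        rw [← hv ((κ x).symm t), hQκ, LinearEquiv.apply_symm_apply])
      vol := fun x => (modelVol W x).compLinearMap (κ x).toLinearMap
      vol_hol := fun U hU e he => (isHolSection_iff hU).2 fun x hx => regSecAt_trivialLine_iff.2
        (h.regAt_vol fun k => (isHolSection_iff hU).1 (he k) x hx)
      vol_sq := fun x e => by
        rw [sq]
        refine (modelVol_mul _ _).trans ?_
        simp only [hQκ]
        rfl
      φ := φ }
  refine ⟨⟨B, Θ, hΘs, hΘs'⟩, H, ⟨⟨φ, D, H1.mk a, fun x Z => ?_, fun x u => ?_, hξ, rfl⟩,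
    Q, hQ, hQΘ⟩, fun x => ContinuousLinearEquiv.refl ℂ _, isHolSection_id _ _,
    isHolSection_id _ _, hQΘ, fun x Z => ?_, fun x Z w η => ?_⟩
  · exact (hφ x Z).trans (hΘ x _).symm
  · rw [hD]
    exact congrArg (fun t : (model W).E x => t.2.1) (hΘκ x _).symm
  · exact (hφ x Z).trans (hΘ x _).symm
  · refine Eq.trans ?_ (modelVol_mk Z w η)
    refine congrArg (modelVol W x) (funext fun k => ?_)
    refine Fin.cases ?_ (fun k => ?_) k
    · exact (congrArg (κ x) (hΘ x _)).trans ((κ x).apply_symm_apply _)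
    · refine Fin.lastCases ?_ (fun k => ?_) k
      · simp only [Fin.cons_succ, Fin.snoc_last]
        exact (congrArg (κ x) (hΘ x _)).trans ((κ x).apply_symm_apply _)
      · simp only [Fin.cons_succ, Fin.snoc_castSucc]
        exact (congrArg (κ x) (hΘ x _)).trans ((κ x).apply_symm_apply _)

end Existence

/-! ### Holomorphic structures on `K⁻¹ ⊕ W ⊕ K` -/

section HolStructure

variable {S S' : HolStructure W} {H H' : HiggsBundle X (m + 2)} {ξ : ExtH1 W}

theorem exists_eq_model {x : X} (t : (model W).E x) : ∃ α : ℂ,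
    t = α • model.mk W (localField x x) 0 0 + modelInl W x t.2.1 +
      (show (tangent X).E x →L[ℂ] ℂ from t.2.2) (localField x x) •
        model.mk W 0 0 (localForm x x) := by
  obtain ⟨Z, w, η⟩ := t
  let θ : (tangent X).E x →L[ℂ] ℂ := η
  obtain ⟨α, rfl⟩ := exists_smul_localField x x Z
  have h1 : η = θ (localField x x) • localForm x x := by
    refine ContinuousLinearMap.ext (R₁ := ℂ) fun Z => ?_
    obtain ⟨c, rfl⟩ := exists_smul_localField x x Z
    change θ (c • _) = θ (localField x x) *
      (show (tangent X).E x →L[ℂ] ℂ from localForm x x) (c • localField x x)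
    rw [map_smul, map_smul, localForm_localField, smul_eq_mul, smul_eq_mul]
    ring
  refine ⟨α, ?_⟩
  rw [model.smul_mk_left]
  have h2 : model.mk W (α • localField x x) 0 0 + modelInl W x w =
      model.mk W (α • localField x x) w 0 :=
    (model.mk_add_mk _ _ _ _ _ _).trans (by rw [add_zero, zero_add, add_zero])
  refine Eq.trans ?_ (congrArg (· + θ (localField x x) • model.mk W 0 0 (localForm x x)) h2).symm
  refine Prod.ext ?_ (Prod.ext ?_ ?_)
  · change α • localField x x = α • localField x x + θ (localField x x) • 0
    rw [smul_zero, add_zero]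
  · change w = w + θ (localField x x) • 0
    rw [smul_zero, add_zero]
  · exact h1.trans (zero_add _).symm

theorem modelQ_mk_left {x : X} (t : (model W).E x) (Z : (tangent X).E x) :
    modelQ W x (model.mk W Z 0 0) t = (show (tangent X).E x →L[ℂ] ℂ from t.2.2) Z := by
  change _ + W.Q x 0 _ + 0 = _
  rw [map_zero, add_zero]
  exact add_zero _

theorem mem_modelFlag_iff {x : X} {t : (model W).E x} :
    t ∈ modelFlag W x ↔ ∀ Z, modelQ W x t (model.mk W Z 0 0) = 0 := by
  simp only [modelQ_symm t, modelQ_mk_left]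
  exact ⟨fun h Z => DFunLike.congr_fun (F := (tangent X).E x →L[ℂ] ℂ) h Z,
    fun h => ContinuousLinearMap.ext (R₁ := ℂ) h⟩

theorem modelQ_of_mem_modelFlag {x : X} {t t' : (model W).E x} (ht : t ∈ modelFlag W x)
    (ht' : t' ∈ modelFlag W x) : modelQ W x t t' = W.Q x t.2.1 t'.2.1 := by
  have h : t.2.2 = 0 := ht
  have h' : t'.2.2 = 0 := ht'
  rw [modelQ, h, h']
  change 0 + _ + 0 = _
  rw [zero_add, add_zero]

/-! ### Admissible holomorphic structures as null extensions -/

section Flag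

variable {Θ : ∀ x, (model W).E x ≃L[ℂ] V.E x}
  {D : Extension W φ fun x => Submodule.map
    ((Θ x).toLinearEquiv : (model W).E x →ₗ[ℂ] V.E x) (modelFlag W x)}

theorem mem_map_modelFlag_iff {x : X} {v : V.E x} : v ∈ Submodule.map
    ((Θ x).toLinearEquiv : (model W).E x →ₗ[ℂ] V.E x) (modelFlag W x) ↔
      (Θ x).symm v ∈ modelFlag W x := by
  rw [Submodule.mem_map]
  constructor
  · rintro ⟨t, ht, rfl⟩
    have h : (Θ x).symm ((Θ x).toLinearEquiv t) = t := (Θ x).symm_apply_apply t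
    exact h.symm ▸ ht
  · exact fun h => ⟨_, h, (Θ x).apply_symm_apply v⟩

/-- The flag `K⁻¹ ⊕ W` is the orthogonal complement of `K⁻¹`, and there the form of the model is
`Q_W` of the `W`-components. This brings structures on the smooth bundle within reach of
`NullExtension.exists_isometry`. -/
theorem nullExtension_of_model {Q : ∀ x, V.E x →L[ℂ] V.E x →L[ℂ] ℂ}
    (hφ : ∀ x Z, φ.toFun x Z = Θ x (model.mk W Z 0 0))
    (hp : ∀ x u, D.p.toFun x u = ((Θ x).symm (D.i.toFun x u)).2.1)
    (hQ : IsHolSection (V.hom (V.hom (trivialLine X))) univ Q)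
    (hQΘ : ∀ x a b, Q x (Θ x a) (Θ x b) = modelQ W x a b) : NullExtension Q D := by
  have hQ' : ∀ x v w, Q x v w = modelQ W x ((Θ x).symm v) ((Θ x).symm w) := fun x v w => by
    rw [← hQΘ, ContinuousLinearEquiv.apply_symm_apply, ContinuousLinearEquiv.apply_symm_apply]
  refine ⟨hQ, fun x v w => by rw [hQ', hQ', modelQ_symm], fun x v hv => ?_, fun x v => ?_,
    fun x u v => ?_⟩
  · refine (Θ x).symm.map_eq_zero_iff.1 (modelQ_nondeg fun t => ?_)
    rw [← hv (Θ x t), hQ', ContinuousLinearEquiv.symm_apply_apply]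
  · rw [mem_map_modelFlag_iff, mem_modelFlag_iff]
    refine forall_congr' fun Z => ?_
    rw [hφ, hQ', ContinuousLinearEquiv.symm_apply_apply]
  · rw [hp, hp, hQ', modelQ_of_mem_modelFlag (mem_map_modelFlag_iff.1 (D.i_mem x u))
      (mem_map_modelFlag_iff.1 (D.i_mem x v))]

end Flag

/-- Admissible holomorphic structures for the same triple are gauge equivalent. -/
theorem HolStructure.IsAdmissible.gaugeEquiv (h : S.IsAdmissible (ExtOrbit.mk ξ))
    (h' : S'.IsAdmissible (ExtOrbit.mk ξ)) : S.GaugeEquiv S' := by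
  obtain ⟨⟨φ, D, ξ₁, hφ, hp, hξ₁, h1⟩, Q, hQ, hQΘ⟩ := h
  obtain ⟨⟨φ', D', ξ₂, hφ', hp', hξ₂, h2⟩, Q', hQ', hQΘ'⟩ := h'
  -- The two extension classes need only lie in one orbit; the element `k` of `SO(Q_W)` relating
  -- them becomes the action of the gauge transformation on `W`.
  obtain ⟨k, hk⟩ := Quotient.exact (h1.trans h2.symm)
  obtain ⟨G, hG, hGs, hGQ, hGφ, hGp⟩ := (nullExtension_of_model hφ hp hQ hQΘ).exists_isometry
    (nullExtension_of_model hφ' hp' hQ' hQΘ') k hξ₁ hξ₂ hk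
  have hT : ∀ x, ((S.Θ x).symm.trans (((S.Θ x).trans (G x)).trans (S'.Θ x).symm)).trans (S'.Θ x) =
      G x := fun x => by
    ext v
    simp
  -- The gauge transformation is the holomorphic isometry `G` seen through the two smooth
  -- identifications; it is only smooth because these are.
  refine ⟨fun x => ((S.Θ x).trans (G x)).trans (S'.Θ x).symm, k, isSmoothSection_iff.2 fun x => ?_,
    isSmoothSection_iff.2 fun x => ?_, fun x a b => ?_, fun x Z => ?_, fun x w => ?_, ?_, ?_⟩
  · exact RegSecAt.comp (isSmoothSection_iff.1 S'.smooth_symm x)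
      (RegSecAt.comp (RegSecAt.of_hol (isHolSection_univ_iff.1 hG x))
        (isSmoothSection_iff.1 S.smooth x))
  · exact RegSecAt.comp (isSmoothSection_iff.1 S.smooth_symm x)
      (RegSecAt.comp (RegSecAt.of_hol (isHolSection_univ_iff.1 hGs x))
        (isSmoothSection_iff.1 S'.smooth x))
  · simp only [ContinuousLinearEquiv.trans_apply]
    rw [← hQΘ', ContinuousLinearEquiv.apply_symm_apply, ContinuousLinearEquiv.apply_symm_apply,
      hGQ, hQΘ]
  · simp only [ContinuousLinearEquiv.trans_apply]
    rw [← hφ, hGφ, hφ', ContinuousLinearEquiv.symm_apply_apply]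
  · obtain ⟨u, hu⟩ := D.exists_i (v := S.Θ x (model.mk W 0 w 0)) ⟨model.mk W 0 w 0, rfl, rfl⟩
    obtain ⟨u', hu', hpu'⟩ := hGp x u
    have h0 : ((S'.Θ x).symm (D'.i.toFun x u')).2.2 = 0 :=
      mem_map_modelFlag_iff.1 (D'.i_mem x u')
    have h3 : D.p.toFun x u = w := by
      rw [hp, hu, ContinuousLinearEquiv.symm_apply_apply]
      rfl
    rw [hp', h3] at hpu'
    refine ⟨((S'.Θ x).symm (D'.i.toFun x u')).1, ?_⟩
    simp only [ContinuousLinearEquiv.trans_apply]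
    rw [← hu, hu']
    exact Prod.ext rfl (Prod.ext hpu' h0)
  · simp only [hT]
    exact hG
  · simp only [hT]
    exact hGs

/-- The Higgs bundle carried by an admissible holomorphic structure determines the triple. -/
theorem HolStructure.IsAdmissible.determines (h : S.IsAdmissible (ExtOrbit.mk ξ))
    (hH : S.Carries H) : Determines H W ξ := by
  obtain ⟨⟨φ, D, ξ', hφ, hp, hξ', hξ⟩, -⟩ := h
  obtain ⟨g, hg, -, hgQ, hgφ, hgvol⟩ := hH
  have hHφ : ∀ x Z, g x (φ.toFun x Z) = H.φ.toFun x Z := fun x Z => by rw [hφ, hgφ]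
  have hmem : ∀ x t, t ∈ modelFlag W x ↔ g x (S.Θ x t) ∈ LinearMap.ker (H.φt x) := by
    intro x t
    rw [mem_modelFlag_iff]
    refine Iff.trans ?_ (H.φt_φ_apply x _).symm
    exact forall_congr' fun Z => by rw [hgφ, hgQ]
  let iH : HolHom D.V₁ H.toHolBundle :=
    ⟨fun x => (g x : S.V.E x →L[ℂ] H.E x).comp (D.i.toFun x), isHolSection_comp hg D.i.hol⟩
  let D' : Extension W H.φ (fun x => LinearMap.ker (H.φt x)) :=
    { V₁ := D.V₁
      i := iH
      i_injective := fun x => (g x).injective.comp (D.i_injective x)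
      i_range := fun x => by
        ext v
        constructor
        · rintro ⟨u, rfl⟩
          change g x (D.i.toFun x u) ∈ _
          obtain ⟨t, ht, h1⟩ := D.i_mem x u
          rw [← h1]
          exact (hmem x t).1 ht
        · intro hv
          obtain ⟨t, rfl⟩ := ((S.Θ x).trans (g x)).surjective v
          obtain ⟨u, hu⟩ := D.exists_i (v := S.Θ x t) ⟨t, (hmem x t).2 hv, rfl⟩
          exact ⟨u, congrArg (g x) hu⟩
      j := D.j
      p := D.p
      i_j := fun x Z => by
        change g x (D.i.toFun x _) = _
        rw [D.i_j, hHφ]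
      exact := D.exact }
  have hflag : ∀ x u, (S.Θ x).symm (D.i.toFun x u) ∈ modelFlag W x := fun x u =>
    mem_map_modelFlag_iff.1 (D.i_mem x u)
  have hD : ∀ x u, D'.i.toFun x u = g x (S.Θ x ((S.Θ x).symm (D.i.toFun x u))) := fun x u => by
    rw [ContinuousLinearEquiv.apply_symm_apply]
    rfl
  -- Admissibility fixes the class only up to `SO(Q_W)`, so the data are first found with the class
  -- `ξ'` and then moved to `ξ` by `k`.
  obtain ⟨k, hk⟩ := Quotient.exact hξ
  refine Determines.congr (ξ := ξ') ⟨D', fun x u v => ?_, fun x Z u v => ?_, hξ'⟩ k hk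
  · rw [hD, hD, hgQ, modelQ_of_mem_modelFlag (hflag x u) (hflag x v)]
    exact congrArg₂ (fun v w => W.Q x v w) (hp x u) (hp x v)
  · have := W.toHolBundle.finiteDimensional_fiber x
    obtain ⟨c, rfl⟩ := exists_smul_localField x x Z
    obtain ⟨t, rfl⟩ := ((S.Θ x).trans (g x)).surjective v
    let L : (model W).E x →ₗ[ℂ] H.E x := ((S.Θ x).trans (g x)).toLinearEquiv.toLinearMap
    let e : H.E x := L (model.mk W (localField x x) 0 0)
    let f : H.E x := L (model.mk W 0 0 (localForm x x))
    let η : (tangent X).E x →L[ℂ] ℂ := t.2.2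
    have he : e = H.φ.toFun x (localField x x) := (hgφ x _).symm
    obtain ⟨α, hα⟩ := exists_eq_model t
    have e1 : L t = α • e + (L ∘ₗ modelInl W x) t.2.1 + η (localField x x) • f := by
      conv_lhs => rw [hα]
      rw [map_add, map_add, map_smul, map_smul]
      rfl
    have e2 : ∀ k, ∃ a : ℂ, D'.i.toFun x (u k) = (L ∘ₗ modelInl W x) (D.p.toFun x (u k)) + a • e := by
      intro k
      obtain ⟨a, ha⟩ := exists_eq_model ((S.Θ x).symm (D.i.toFun x (u k)))
      have h0 : ((S.Θ x).symm (D.i.toFun x (u k))).2.2 = 0 := hflag x (u k)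
      rw [← hp, h0] at ha
      refine ⟨a, (hD x _).trans ((congrArg L ha).trans ?_)⟩
      rw [map_add, map_add, map_smul, map_smul]
      refine (congrArg (a • e + L (modelInl W x (D.p.toFun x (u k))) + ·)
        (zero_smul ℂ f)).trans ?_
      rw [add_zero]
      exact add_comm (a • e) _
    choose a ha using e2
    -- `Carries` gives the volume only on split frames. A vector of `K⁻¹ ⊕ W` differs from its
    -- `W`-part by a multiple of `e`, and the last vector `v` counts only through its `K`-component,
    -- so the rule for arbitrary lifts follows.
    have e3 := volume_adapted (W.finrank_fiber x) (H.vol x) e f (L ∘ₗ modelInl W x)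
      (fun k => D.p.toFun x (u k)) t.2.1 a c α (η (localField x x))
    have e4 : consSnoc (H.vol x) e f (fun k => (L ∘ₗ modelInl W x) (D.p.toFun x (u k))) =
        Complex.I * (show (tangent X).E x →L[ℂ] ℂ from localForm x x) (localField x x) *
          W.vol x (fun k => D.p.toFun x (u k)) := hgvol x _ _ _
    have e5 : (fun k => D'.i.toFun x (u k)) =
        fun k => (L ∘ₗ modelInl W x) (D.p.toFun x (u k)) + a k • e := funext ha
    have e6 : H.Q x (H.φ.toFun x (c • localField x x)) (L t) = c * η (localField x x) := by
      rw [hgφ]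
      refine (hgQ x _ t).trans ((modelQ_mk_left t _).trans ?_)
      exact η.map_smul c _
    rw [← e1, ← e5, e4, localForm_localField] at e3
    refine Eq.trans ?_ (e3.trans ?_)
    · rw [map_smul, he]
      rfl
    · refine Eq.trans ?_ (congrArg (fun q => Complex.I * q *
        W.vol x fun k => D.p.toFun x (u k)) e6.symm)
      ring

theorem HolStructure.Carries.congr (h : S.Carries H) (hH : H.Iso H') : S.Carries H' := by
  obtain ⟨g, hg, hgs, hgQ, hgφ, hgvol⟩ := h
  obtain ⟨k, hk⟩ := hH
  refine ⟨fun x => (g x).trans (k.toEquiv x), isHolSection_comp k.hol hg,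
    isHolSection_comp hgs k.hol_symm, fun x a b => (k.Q_eq x _ _).trans (hgQ x a b),
    fun x Z => (hk x Z).symm.trans (congrArg (k.toEquiv x) (hgφ x Z)), fun x Z w η => ?_⟩
  rw [← hgvol, ← k.vol_eq]
  congr 1
  funext i
  refine Fin.cases ?_ (fun i => ?_) i
  · simp
  · refine Fin.lastCases ?_ (fun i => ?_) i <;> simp

/-- For the forward direction, some admissible structure `S` carries a Higgs bundle `H₀`, which then
determines `(W, ξ)` as `H` does. So `H₀` and `H` are isomorphic, and `S` carries `H` too. -/
theorem determines_iff_exists_carries [T2Space X] [CompactSpace X] : Determines H W ξ ↔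
    ∃ S : HolStructure W, S.IsAdmissible (ExtOrbit.mk ξ) ∧ S.Carries H := by
  refine ⟨fun h => ?_, fun ⟨S, hS, hH⟩ => hS.determines hH⟩
  obtain ⟨S, H₀, hS, hH₀⟩ := exists_isAdmissible_carries W ξ
  exact ⟨S, hS, hH₀.congr ((hS.determines hH₀).higgsIso h)⟩

end HolStructure

/-! ### The classification -/

section Classification

/-- The automorphisms of `W` and `W'` hidden in the two orbits are absorbed into the isomorphism `W
≅ W'`. -/
theorem triple_equiv_iff {ξ : ExtH1 W} {ξ' : ExtH1 W'} :
    (⟨W, ExtOrbit.mk ξ⟩ : Triple X m) ≈ ⟨W', ExtOrbit.mk ξ'⟩ ↔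
      ∃ k : SOIso W W', ξ = pull k ξ' := by
  constructor
  · rintro ⟨g, ζ, h1, h2⟩
    obtain ⟨k, hk⟩ := Quotient.exact h1
    obtain ⟨l, hl⟩ := Quotient.exact h2
    refine ⟨(l.trans g).trans k.symm, ?_⟩
    rw [pull_trans, pull_trans, hk, pull_symm_pull]
    exact hl
  · rintro ⟨k, rfl⟩
    exact ⟨k, ξ', rfl, rfl⟩

/-- The triple determined by a Higgs bundle. -/
noncomputable def NullHiggs.triple (H : NullHiggs X (m + 2)) : Triple X m :=
  ⟨(HiggsBundle.exists_determines H.2.1 H.2.2).choose,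
    ExtOrbit.mk (HiggsBundle.exists_determines H.2.1 H.2.2).choose_spec.choose⟩

theorem NullHiggs.determines (H : NullHiggs X (m + 2)) :
    Determines H.1 H.triple.W (HiggsBundle.exists_determines H.2.1 H.2.2).choose_spec.choose :=
  (HiggsBundle.exists_determines H.2.1 H.2.2).choose_spec.choose_spec

/-- `NullHiggs.triple` rests on arbitrary choices; up to isomorphism they do not matter, by
`Determines.exists_soIso` in one direction and `Determines.congr` in the other. -/
theorem NullHiggs.determines_iff (H : NullHiggs X (m + 2)) {ξ : ExtH1 W} :
    Determines H.1 W ξ ↔ H.triple ≈ ⟨W, ExtOrbit.mk ξ⟩ := by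
  refine Iff.trans ?_ triple_equiv_iff.symm
  constructor
  · exact fun h => H.determines.exists_soIso h ⟨SOIso.refl _, fun _ _ => rfl⟩
  · rintro ⟨k, hk⟩
    exact H.determines.congr k hk

theorem NullHiggs.triple_equiv_triple_iff (H H' : NullHiggs X (m + 2)) :
    H.triple ≈ H'.triple ↔ H ≈ H' := by
  refine ⟨fun h => ?_, fun h => ?_⟩
  · exact Determines.higgsIso (H.determines_iff.2 h) H'.determines
  · exact triple_equiv_iff.2 (H.determines.exists_soIso H'.determines h)

/-- Isomorphism classes of Higgs bundles with `tr Φ² = 0` and `φ` without zeroes correspond to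
isomorphism classes of triples. -/
theorem exists_equiv_tripleClass [T2Space X] [CompactSpace X] :
    ∃ e : NullHiggsClass X (m + 2) ≃ TripleClass X m,
      ∀ (H : NullHiggs X (m + 2)) (W : SOBundle X m) (ξ : ExtH1 W),
        Determines H.1 W ξ ↔ e (Quotient.mk _ H) = Quotient.mk _ ⟨W, ExtOrbit.mk ξ⟩ := by
  let f : NullHiggsClass X (m + 2) → TripleClass X m :=
    Quotient.map NullHiggs.triple fun H H' h => (NullHiggs.triple_equiv_triple_iff H H').2 h
  have hf : ∀ (H : NullHiggs X (m + 2)) (W : SOBundle X m) (ξ : ExtH1 W),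
      Determines H.1 W ξ ↔ f (Quotient.mk _ H) = Quotient.mk _ ⟨W, ExtOrbit.mk ξ⟩ :=
    fun H W ξ => H.determines_iff.trans Quotient.eq.symm
  refine ⟨Equiv.ofBijective f ⟨fun q q' => ?_, fun q => ?_⟩, hf⟩
  · refine Quotient.inductionOn₂ q q' fun H H' h => Quotient.sound ?_
    exact (NullHiggs.triple_equiv_triple_iff H H').1 (Quotient.exact h)
  · refine Quotient.inductionOn q ?_
    rintro ⟨W, o⟩
    obtain ⟨ξ, rfl⟩ := Quotient.exists_rep o
    obtain ⟨S, H, hS, hH⟩ := exists_isAdmissible_carries W ξ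
    have h := hS.determines hH
    exact ⟨Quotient.mk _ ⟨H, h.traceSqZero, h.nowhereZero⟩, (hf _ _ _).1 h⟩

end Classification

end HiggsSO

end

theorem lemma2 {X : Type*} [TopologicalSpace X] [T2Space X] [CompactSpace X] [ConnectedSpace X]
    [ChartedSpace ℂ X] [IsManifold 𝓘(ℂ) ω X] (m : ℕ) (hm : 1 ≤ m) :
    (∀ H : HiggsSO.HiggsBundle X (m + 2),
      H.TraceSqZero ↔ ∀ x Z, H.φt x (H.φ.toFun x Z) = 0) ∧
    (∃ e : HiggsSO.NullHiggsClass X (m + 2) ≃ HiggsSO.TripleClass X m,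
      ∀ (H : HiggsSO.NullHiggs X (m + 2)) (W : HiggsSO.SOBundle X m) (ξ : HiggsSO.ExtH1 W),
        HiggsSO.Determines H.1 W ξ ↔
          e (Quotient.mk _ H) = Quotient.mk _ ⟨W, HiggsSO.ExtOrbit.mk ξ⟩) ∧
    (∀ (W : HiggsSO.SOBundle X m) (ξ : HiggsSO.ExtH1 W),
      (∃ S : HiggsSO.HolStructure W, S.IsAdmissible (HiggsSO.ExtOrbit.mk ξ)) ∧
      (∀ S S' : HiggsSO.HolStructure W, S.IsAdmissible (HiggsSO.ExtOrbit.mk ξ) →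
        S'.IsAdmissible (HiggsSO.ExtOrbit.mk ξ) → S.GaugeEquiv S') ∧
      ∀ H : HiggsSO.HiggsBundle X (m + 2), HiggsSO.Determines H W ξ ↔
        ∃ S : HiggsSO.HolStructure W, S.IsAdmissible (HiggsSO.ExtOrbit.mk ξ) ∧ S.Carries H) := by
  refine ⟨fun H => H.traceSqZero_iff, HiggsSO.exists_equiv_tripleClass, fun W ξ => ⟨?_, ?_, ?_⟩⟩
  · obtain ⟨S, -, hS, -⟩ := HiggsSO.exists_isAdmissible_carries W ξ
    exact ⟨S, hS⟩
  · exact fun S S' hS hS' => hS.gaugeEquiv hS'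
  · exact fun H => HiggsSO.determines_iff_exists_carries
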